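/- **Setting.** Let $\delta\ge 0$ be an integer and let $S_\delta$ be the complex Hirzebruch surface, regarded as the quotient of $(\mathbb C^2\setminus\{0\})\times(\mathbb C^2\setminus\{0\})$, with coordinates $(X_0,X_1,Y_0,Y_1)$, by the action $(\lambda,\mu)\cdot(X_0,X_1,Y_0,Y_1)=(\lambda X_0,\lambda X_1,\mu Y_0,\lambda^{-\delta}\mu Y_1)$ of $(\mathbb C^*)^2$; let $\pi$ be the quotient map, $\mathcal O$ the structure sheaf and $\Theta$ the tangent sheaf. The variables $X_0,X_1,Y_0,Y_1$ have bi-degrees $(1,0),(1,0),(0,1),(-\delta,1)$, and sections of $\mathcal O(d_1,d_2)$ are the regular functions upstairs that are bi-homogeneous of bi-degree $(d_1,d_2)$. Put $\mathcal H=\mathcal O(1,0)^{\oplus 2}\oplus\mathcal O(0,1)\oplus\mathcal O(-\delta,1)$, with the surjection $d\pi:\mathcal H\to\Theta$ of the Euler sequence. A $4\times4$ matrix $A$ of polynomials *represents* an endomorphism $\Phi$ of $\Theta$ if multiplication by $A$ maps $\mathcal H$ to $\mathcal H$ and $\Phi\circ d\pi=d\pi\circ A$. For $d_1,d_2\in\mathbb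 Z$ and an invertible sheaf $\mathcal L\cong\mathcal O(-d_1,-d_2)$, an affine vector field $X=V_0\partial_{X_0}+V_1\partial_{X_1}+W_0\partial_{Y_0}+W_1\partial_{Y_1}$, with $V_0,V_1,W_0,W_1$ bi-homogeneous polynomials of bi-degrees $(d_1+1,d_2)$, $(d_1+1,d_2)$, $(d_1,d_2+1)$, $(d_1-\delta,d_2+1)$, *represents* a section $s$ of $\mathrm{Hom}_{\mathcal O}(\mathcal L,\Theta)$ if $s(g)=d\pi(gX)$ for all local sections $g$ of $\mathcal O(-d_1,-d_2)\cong\mathcal L$. The affine $1$-form attached to $X$ is $$\Omega_X=\begin{vmatrix}dX_0&dX_1&dY_0&dY_1\\X_0&X_1&0&-\delta Y_1\\0&0&Y_0&Y_1\\V_0&V_1&W_0&W_1\end{vmatrix}=A_0\,dX_0+A_1\,dX_1+B_0\,dY_0+B_1\,dY_1 .$$ **Theorem.** The complex vector space of global endomorphisms of the tangent bundle $TS_\delta$ has dimension $$h^0(S_\delta,\mathrm{Hom}_{\mathcal O}(\Theta,\Theta))=\begin{cases}2&\text{if }\delta=0,\\ \delta&\text{if }\delta\ge 1.\end{cases}$$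 Every global endomorphism $\Phi$ is represented by exactly one matrix of the form $$A(a,d)=a\,\mathbf 1_{2\times2}\oplus d\,\mathbf 1_{2\times2}\ \ (\delta=0),\qquad A(a)=a\,\mathbf 1_{4\times4}\ \ (\delta=1),$$ $$A(a,C)=\begin{pmatrix}a&0&0&0\\0&a&0&0\\X_1Y_1C&-X_0Y_1C&a&0\\0&0&0&a\end{pmatrix}\ \ (\delta\ge2),$$ where $a,d\in\mathbb C$ and $C=C(X_0,X_1)$ is zero or a homogeneous polynomial of degree $\delta-2$; conversely, each such matrix represents exactly one $\Phi$, and different parameters give different endomorphisms. Let $A$ be the matrix of this form that represents $\Phi$. Then: (a) $\Phi$ is invertible if and only if $ad\ne0$ (for $\delta=0$), respectively $a\neq0$ (for $\delta\ge1$). (b) For every invertible sheaf $\mathcal L$ on $S_\delta$ and every global section $s$ of $\mathrm{Hom}_{\mathcal O}(\mathcal L,\Theta)$, the composite $\Phi\circ s$ is a global section of $\mathrm{Hom}_{\mathcal O}(\mathcal L,\Theta)$. If $s$ is represented by the affine vector field with coefficients $(V_0,V_1,W_0,W_1)$, then $\Phi\circ s$ is represented by the affine vector field with coefficients $(V_0',V_1',W_0',W_1')^t=A\cdot(V_0,V_1,W_0,W_1)^t$.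 (c) Let $A^\sharp=A(d,a)$, $A(a)$, $A(a,-C)$ for $A=A(a,d)$, $A(a)$, $A(a,C)$ respectively. If $s$ and $\Phi\circ s$ are represented by affine vector fields $X$ and $X'$, then the coefficients of $\Omega_X$ and $\Omega_{X'}$ satisfy $$(A_0',A_1',B_0',B_1')=(A_0,A_1,B_0,B_1)\cdot A^\sharp .$$ Finally, if $\mathcal L\cong\mathcal O(-d_1,-d_2)$ with $d_2\ge0$ and either $\delta=0$, $d_1\ge0$, or $\delta\ge1$, $d_1\ge-1$, then every global section of $\mathrm{Hom}_{\mathcal O}(\mathcal L,\Theta)$ is represented by an affine vector field. -/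

import Mathlib

namespace Hirzebruch

open TopologicalSpace

/-! ### The surface as a quotient of the product of two punctured planes -/

/-- The polynomial ring in the variables `X₀, X₁, Y₀, Y₁`, numbered `0, 1, 2, 3`. -/
abbrev CoxPoly : Type := MvPolynomial (Fin 4) ℂ

/-- The bi-degrees of `X₀, X₁, Y₀, Y₁`. -/
def coxDeg (δ : ℕ) : Fin 4 → ℤ × ℤ := ![(1, 0), (1, 0), (0, 1), (-(δ : ℤ), 1)]

/-- The character `(t₁, t₂) ↦ t₁ ^ d₁ * t₂ ^ d₂` of the torus. -/
def chr (t : ℂˣ × ℂˣ) (d : ℤ × ℤ) : ℂ := ((t.1 ^ d.1 * t.2 ^ d.2 : ℂˣ) : ℂ)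

theorem chr_mul (t u : ℂˣ × ℂˣ) (d : ℤ × ℤ) : chr (t * u) d = chr t d * chr u d := by
  simp only [chr, Prod.fst_mul, Prod.snd_mul, mul_zpow, ← Units.val_mul]
  congr 1
  exact mul_mul_mul_comm _ _ _ _

theorem chr_one (d : ℤ × ℤ) : chr 1 d = 1 := by simp [chr]

/-- The points of `(ℂ² ∖ 0) × (ℂ² ∖ 0)`, with coordinates `(X₀, X₁, Y₀, Y₁)`. -/
def Cone : Type := {z : Fin 4 → ℂ // (z 0 ≠ 0 ∨ z 1 ≠ 0) ∧ (z 2 ≠ 0 ∨ z 3 ≠ 0)}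

/-- The orbit relation of the action
`(t₁, t₂) · (X₀, X₁, Y₀, Y₁) = (t₁ X₀, t₁ X₁, t₂ Y₀, t₁ ^ (-δ) t₂ Y₁)`. -/
def torusSetoid (δ : ℕ) : Setoid Cone where
  r z w := ∃ t : ℂˣ × ℂˣ, ∀ i, w.1 i = chr t (coxDeg δ i) * z.1 i
  iseqv :=
    { refl := fun z => ⟨1, fun i => by rw [chr_one, one_mul]⟩
      symm := by
        rintro z w ⟨t, ht⟩
        refine ⟨t⁻¹, fun i => ?_⟩
        rw [ht i, ← mul_assoc, ← chr_mul, inv_mul_cancel, chr_one, one_mul]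
      trans := by
        rintro z w v ⟨t, ht⟩ ⟨u, hu⟩
        refine ⟨u * t, fun i => ?_⟩
        rw [hu i, ht i, chr_mul, mul_assoc] }

/-- The (closed points of the) Hirzebruch surface. -/
def Surface (δ : ℕ) : Type := Quotient (torusSetoid δ)

/-- The quotient map. -/
def proj (δ : ℕ) (z : Cone) : Surface δ := Quotient.mk (torusSetoid δ) z

/-- The Zariski topology on `Cone`: the one induced from the affine space `Spec ℂ[X₀, X₁, Y₀, Y₁]`,
in which the points of `ℂ⁴` are the closed points. -/
@[reducible]
noncomputable def coneZariski : TopologicalSpace Cone :=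
  TopologicalSpace.induced
    (fun z : Cone => (MvPolynomial.pointToPoint z.1 : PrimeSpectrum CoxPoly)) inferInstance

/-- The Zariski topology on the surface: the quotient topology. -/
noncomputable instance (δ : ℕ) : TopologicalSpace (Surface δ) :=
  TopologicalSpace.coinduced (proj δ) coneZariski

variable {δ : ℕ}

/-! ### Regular functions and the sheaves `𝒪(d₁, d₂)` -/

/-- The inverse image in `Cone` of an open set of the surface. -/
def Pre (U : Opens (Surface δ)) : Type := {z : Cone // proj δ z ∈ U}

/-- The value of a polynomial at a point of `Pre U`. -/
noncomputable def Pre.eval {U : Opens (Surface δ)} (z : Pre U) (P : CoxPoly) : ℂ :=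
  MvPolynomial.eval z.1.1 P

/-- The image of a point of `Pre U` in `U`. -/
def Pre.pt {U : Opens (Surface δ)} (z : Pre U) : U := ⟨proj δ z.1, z.2⟩

/-- The inclusion `Pre V ⊆ Pre U`. -/
def Pre.incl {U V : Opens (Surface δ)} (h : V ≤ U) (z : Pre V) : Pre U := ⟨z.1, h z.2⟩

/-- A function on `Pre U` is regular if it is locally a quotient of polynomials. -/
def IsRegular (U : Opens (Surface δ)) (g : Pre U → ℂ) : Prop :=
  ∀ z : Pre U, ∃ P Q : CoxPoly, z.eval Q ≠ 0 ∧ ∀ w : Pre U, w.eval Q ≠ 0 → g w = w.eval P / w.eval Q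

theorem IsRegular.add {U : Opens (Surface δ)} {f g : Pre U → ℂ} (hf : IsRegular U f)
    (hg : IsRegular U g) : IsRegular U (fun z => f z + g z) := by
  intro z
  obtain ⟨P, Q, hQ, h⟩ := hf z
  obtain ⟨P', Q', hQ', h'⟩ := hg z
  refine ⟨P * Q' + Q * P', Q * Q', ?_, fun w hw => ?_⟩
  · simpa [Pre.eval] using And.intro hQ hQ'
  · have hw' : w.eval Q ≠ 0 ∧ w.eval Q' ≠ 0 := by simpa [Pre.eval] using hw
    simp only [h w hw'.1, h' w hw'.2, div_add_div _ _ hw'.1 hw'.2]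
    simp [Pre.eval]

theorem IsRegular.mul {U : Opens (Surface δ)} {f g : Pre U → ℂ} (hf : IsRegular U f)
    (hg : IsRegular U g) : IsRegular U (fun z => f z * g z) := by
  intro z
  obtain ⟨P, Q, hQ, h⟩ := hf z
  obtain ⟨P', Q', hQ', h'⟩ := hg z
  refine ⟨P * P', Q * Q', ?_, fun w hw => ?_⟩
  · simpa [Pre.eval] using And.intro hQ hQ'
  · have hw' : w.eval Q ≠ 0 ∧ w.eval Q' ≠ 0 := by simpa [Pre.eval] using hw
    simp only [h w hw'.1, h' w hw'.2, div_mul_div_comm]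
    simp [Pre.eval]

theorem IsRegular.const (U : Opens (Surface δ)) (c : ℂ) : IsRegular U (fun _ => c) := by
  intro z
  exact ⟨MvPolynomial.C c, 1, by simp [Pre.eval], fun w _ => by simp [Pre.eval]⟩

theorem IsRegular.comp_incl {U V : Opens (Surface δ)} (h : V ≤ U) {g : Pre U → ℂ}
    (hg : IsRegular U g) : IsRegular V (fun z => g (z.incl h)) := by
  intro z
  obtain ⟨P, Q, hQ, hPQ⟩ := hg (z.incl h)
  exact ⟨P, Q, hQ, fun w hw => hPQ (w.incl h) hw⟩

/-- The ring `𝒪(U)` of regular functions on `U`. -/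
def regFun (U : Opens (Surface δ)) : Subalgebra ℂ (U → ℂ) where
  carrier := {f | IsRegular U (fun z => f z.pt)}
  mul_mem' hf hg := IsRegular.mul hf hg
  add_mem' hf hg := IsRegular.add hf hg
  algebraMap_mem' c := IsRegular.const U c

/-- Restriction of regular functions. -/
def resFun {U V : Opens (Surface δ)} (h : V ≤ U) : regFun U →ₐ[ℂ] regFun V where
  toFun f := ⟨fun p => f.1 ⟨p.1, h p.2⟩, IsRegular.comp_incl h f.2⟩
  map_one' := rfl
  map_mul' _ _ := rfl
  map_zero' := rfl
  map_add' _ _ := rfl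
  commutes' _ := rfl

/-- The sections of `𝒪(d₁, d₂)` over `U`: the regular functions on `Pre U` that are
bi-homogeneous of bi-degree `(d₁, d₂)`. -/
def twistSec (d : ℤ × ℤ) (U : Opens (Surface δ)) : AddSubgroup (Pre U → ℂ) where
  carrier := {g | IsRegular U g ∧ ∀ (t : ℂˣ × ℂˣ) (z w : Pre U),
    (∀ i, w.1.1 i = chr t (coxDeg δ i) * z.1.1 i) → g w = chr t d * g z}
  add_mem' := by
    rintro f g ⟨hf, hf'⟩ ⟨hg, hg'⟩
    refine ⟨hf.add hg, fun t z w h => ?_⟩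
    simp only [Pi.add_apply, hf' t z w h, hg' t z w h, mul_add]
  zero_mem' := ⟨IsRegular.const U 0, fun t z w _ => by simp⟩
  neg_mem' := by
    rintro f ⟨hf, hf'⟩
    have h1 : (-f : Pre U → ℂ) = fun z => -1 * f z := funext fun z => (neg_one_mul (f z)).symm
    refine ⟨h1 ▸ (IsRegular.const U (-1)).mul hf, fun t z w h => ?_⟩
    simp only [Pi.neg_apply, hf' t z w h, mul_neg]

instance (d : ℤ × ℤ) (U : Opens (Surface δ)) : SMul (regFun U) (twistSec d U) where
  smul f g := ⟨fun z => f.1 z.pt * g.1 z, IsRegular.mul f.2 g.2.1, fun t z w h => by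
    have hp : w.pt = z.pt :=
      Subtype.ext (Quotient.sound (s := torusSetoid δ) ⟨t, h⟩).symm
    show f.1 w.pt * g.1 w = chr t d * (f.1 z.pt * g.1 z)
    rw [hp, g.2.2 t z w h, mul_left_comm]⟩

theorem twistSec_smul_apply {d : ℤ × ℤ} {U : Opens (Surface δ)} (f : regFun U)
    (g : twistSec d U) (z : Pre U) : (f • g).1 z = f.1 z.pt * g.1 z := rfl

instance (d : ℤ × ℤ) (U : Opens (Surface δ)) : Module (regFun U) (twistSec d U) where
  one_smul g := Subtype.ext (funext fun z => one_mul (g.1 z))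
  mul_smul f f' g := Subtype.ext (funext fun z => mul_assoc (f.1 z.pt) (f'.1 z.pt) (g.1 z))
  smul_zero f := Subtype.ext (funext fun z => mul_zero (f.1 z.pt))
  smul_add f g g' := Subtype.ext (funext fun z => mul_add (f.1 z.pt) (g.1 z) (g'.1 z))
  add_smul f f' g := Subtype.ext (funext fun z => add_mul (f.1 z.pt) (f'.1 z.pt) (g.1 z))
  zero_smul g := Subtype.ext (funext fun z => zero_mul (g.1 z))

/-! ### Modules over the structure sheaf -/

/-- A presheaf of modules over the structure sheaf. -/
structure OMod (δ : ℕ) where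
  sec : Opens (Surface δ) → Type
  [addCommGroup : ∀ U, AddCommGroup (sec U)]
  [module : ∀ U, Module (regFun U) (sec U)]
  res : ∀ {U V : Opens (Surface δ)}, V ≤ U → sec U →+ sec V
  res_smul : ∀ {U V : Opens (Surface δ)} (h : V ≤ U) (f : regFun U) (m : sec U),
    res h (f • m) = resFun h f • res h m
  res_refl : ∀ {U : Opens (Surface δ)} (m : sec U), res le_rfl m = m
  res_res : ∀ {U V W : Opens (Surface δ)} (h : V ≤ U) (h' : W ≤ V) (m : sec U),
    res h' (res h m) = res (h'.trans h) m

attribute [instance] OMod.addCommGroup OMod.module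

/-- The scalars `ℂ ⊆ 𝒪(U)` act on sections. -/
instance (M : OMod δ) (U : Opens (Surface δ)) : Module ℂ (M.sec U) :=
  Module.compHom (M.sec U) (algebraMap ℂ (regFun U))

instance (M : OMod δ) (U : Opens (Surface δ)) : SMulCommClass (regFun U) ℂ (M.sec U) where
  smul_comm f c m := smul_comm f (algebraMap ℂ (regFun U) c) m

/-- The sheaf condition: compatible sections glue uniquely. -/
def OMod.IsSheaf (M : OMod δ) : Prop :=
  ∀ (ι : Type) (U : ι → Opens (Surface δ)) (s : ∀ i, M.sec (U i)),
    (∀ i j, M.res (inf_le_left : U i ⊓ U j ≤ U i) (s i) =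
      M.res (inf_le_right : U i ⊓ U j ≤ U j) (s j)) →
    ∃! t : M.sec (⨆ i, U i), ∀ i, M.res (le_iSup U i) t = s i

/-- Invertible sheaves: sheaves of modules that are locally free of rank one. -/
def OMod.IsInvertible (M : OMod δ) : Prop :=
  M.IsSheaf ∧ ∀ p : Surface δ, ∃ U : Opens (Surface δ), p ∈ U ∧ ∃ e : M.sec U,
    ∀ (V : Opens (Surface δ)) (h : V ≤ U),
      Function.Bijective (fun f : regFun V => f • M.res h e)

/-- Morphisms of `𝒪`-modules, that is, the global sections of the sheaf `Hom_𝒪(M, N)`, as a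
complex vector space. -/
def SheafHom (M N : OMod δ) : Submodule ℂ (∀ U : Opens (Surface δ), M.sec U →ₗ[regFun U] N.sec U) where
  carrier := {φ | ∀ (U V : Opens (Surface δ)) (h : V ≤ U) (m : M.sec U),
    N.res h (φ U m) = φ V (M.res h m)}
  add_mem' := by
    intro φ ψ hφ hψ U V h m
    simp only [Pi.add_apply, LinearMap.add_apply, map_add, hφ U V h m, hψ U V h m]
  zero_mem' := by
    intro U V h m
    simp
  smul_mem' := by
    intro c φ hφ U V h m
    have h1 : N.res h (algebraMap ℂ (regFun U) c • φ U m) =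
        algebraMap ℂ (regFun V) c • φ V (M.res h m) := by
      rw [N.res_smul, hφ U V h m, AlgHom.commutes]
    exact h1

/-- A morphism of `𝒪`-modules is an isomorphism iff it is bijective on sections. -/
def IsSheafIso {M N : OMod δ} (e : SheafHom M N) : Prop :=
  ∀ U : Opens (Surface δ), Function.Bijective (e.1 U)

/-- An endomorphism is invertible if it has a two-sided inverse. -/
def IsInvertibleEndo {M : OMod δ} (Φ : SheafHom M M) : Prop :=
  ∃ Ψ : SheafHom M M, ∀ (U : Opens (Surface δ)) (m : M.sec U),
    Ψ.1 U (Φ.1 U m) = m ∧ Φ.1 U (Ψ.1 U m) = m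

/-- The invertible sheaf `𝒪(d₁, d₂)`. -/
def twist (δ : ℕ) (d : ℤ × ℤ) : OMod δ where
  sec U := twistSec d U
  res h :=
    { toFun := fun g => ⟨fun z => g.1 (z.incl h), g.2.1.comp_incl h,
        fun t z w hw => g.2.2 t (z.incl h) (w.incl h) hw⟩
      map_zero' := rfl
      map_add' := fun _ _ => rfl }
  res_smul _ _ _ := rfl
  res_refl _ := rfl
  res_res _ _ _ := rfl

/-! ### The tangent sheaf -/

/-- A section over `U` of the tangent sheaf, the sheaf of `ℂ`-linear derivations of the structure
sheaf: derivations of `𝒪(V)` for all open `V ⊆ U`, compatible with restriction. -/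
@[ext]
structure TangentSec (U : Opens (Surface δ)) where
  der : ∀ V : Opens (Surface δ), V ≤ U → Derivation ℂ (regFun V) (regFun V)
  compat : ∀ (V W : Opens (Surface δ)) (hV : V ≤ U) (hW : W ≤ V) (f : regFun V),
    resFun hW (der V hV f) = der W (hW.trans hV) (resFun hW f)

namespace TangentSec

variable {U : Opens (Surface δ)}

instance : Zero (TangentSec U) := ⟨⟨fun _ _ => 0, fun _ _ _ _ _ => by simp⟩⟩

instance : Add (TangentSec U) :=
  ⟨fun D E => ⟨fun V h => D.der V h + E.der V h, fun V W hV hW f => by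
    simp [D.compat V W hV hW f, E.compat V W hV hW f]⟩⟩

instance : Neg (TangentSec U) :=
  ⟨fun D => ⟨fun V h => -D.der V h, fun V W hV hW f => by
    simp [D.compat V W hV hW f]⟩⟩

instance : SMul (regFun U) (TangentSec U) :=
  ⟨fun g D => ⟨fun V h => resFun h g • D.der V h, fun V W hV hW f => by
    simp only [Derivation.smul_apply, smul_eq_mul, map_mul, D.compat V W hV hW f]
    rfl⟩⟩

theorem zero_der (V : Opens (Surface δ)) (h : V ≤ U) : (0 : TangentSec U).der V h = 0 := rfl

theorem add_der (D E : TangentSec U) (V : Opens (Surface δ)) (h : V ≤ U) :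
    (D + E).der V h = D.der V h + E.der V h := rfl

theorem neg_der (D : TangentSec U) (V : Opens (Surface δ)) (h : V ≤ U) :
    (-D).der V h = -D.der V h := rfl

theorem smul_der (g : regFun U) (D : TangentSec U) (V : Opens (Surface δ)) (h : V ≤ U) :
    (g • D).der V h = resFun h g • D.der V h := rfl

theorem ext' {D E : TangentSec U} (h : ∀ V hV, D.der V hV = E.der V hV) : D = E :=
  TangentSec.ext (funext fun V => funext fun hV => h V hV)

instance : AddCommGroup (TangentSec U) where
  add_assoc D E F := ext' fun V h => by simp only [add_der, add_assoc]
  zero_add D := ext' fun V h => by simp only [add_der, zero_der, zero_add]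
  add_zero D := ext' fun V h => by simp only [add_der, zero_der, add_zero]
  neg_add_cancel D := ext' fun V h => by exact neg_add_cancel (D.der V h)
  add_comm D E := ext' fun V h => by simp only [add_der, add_comm]
  nsmul := nsmulRec
  zsmul := zsmulRec

instance : Module (regFun U) (TangentSec U) where
  one_smul D := ext' fun V h => by simp only [smul_der, map_one, one_smul]
  mul_smul f g D := ext' fun V h => by simp only [smul_der, map_mul, mul_smul]
  smul_zero f := ext' fun V h => by simp only [smul_der, zero_der, smul_zero]
  smul_add f D E := ext' fun V h => by simp only [smul_der, add_der, smul_add]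
  add_smul f g D := ext' fun V h => by simp only [smul_der, add_der, map_add, add_smul]
  zero_smul D := ext' fun V h => by simp only [smul_der, zero_der, map_zero, zero_smul]

end TangentSec

/-- The tangent sheaf `Θ` of the surface. -/
def tangentSheaf (δ : ℕ) : OMod δ where
  sec U := TangentSec U
  res h :=
    { toFun := fun D => ⟨fun V hV => D.der V (hV.trans h),
        fun V W hV hW f => D.compat V W (hV.trans h) hW f⟩
      map_zero' := rfl
      map_add' := fun _ _ => rfl }
  res_smul _ _ _ := rfl
  res_refl _ := rfl
  res_res _ _ _ := rfl

/-! ### Affine vector fields, affine `1`-forms and matrices -/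

open Classical in
/-- The pullback `f ∘ π` of a function on `V`, extended by zero to `ℂ⁴`. -/
noncomputable def pullback {V : Opens (Surface δ)} (f : V → ℂ) (z : Fin 4 → ℂ) : ℂ :=
  if h : ∃ w : Pre V, w.1.1 = z then f h.choose.pt else 0

/-- `D = dπ(v)` for a vector field `v` on `Pre U` and a tangent field `D` on `U`: for every regular
function `f` on an open subset of `U`, the value of `D f` at `π z` is the derivative of `f ∘ π` at
`z` in the direction `v z`. -/
def IsPushforward {U : Opens (Surface δ)} (v : Pre U → Fin 4 → ℂ) (D : TangentSec U) : Prop :=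
  ∀ (V : Opens (Surface δ)) (h : V ≤ U) (f : regFun V) (z : Pre V),
    HasLineDerivAt ℂ (pullback f.1) ((D.der V h f).1 z.pt) z.1.1 (v (z.incl h))

/-- The sections over `U` of `ℋ = 𝒪(1,0) ⊕ 𝒪(1,0) ⊕ 𝒪(0,1) ⊕ 𝒪(-δ,1)`, the middle term of the
Euler sequence `0 → 𝒪² → ℋ → Θ → 0`, whose second map is `dπ`. -/
def IsEulerSec (U : Opens (Surface δ)) (v : Pre U → Fin 4 → ℂ) : Prop :=
  ∀ i, (fun z => v z i) ∈ twistSec (coxDeg δ i) U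

/-- The matrix `A` represents the endomorphism `Φ` of the tangent sheaf: the square formed by
`dπ : ℋ → Θ` (twice), multiplication by `A` on `ℋ`, and `Φ` on `Θ` commutes. -/
def Represents (A : Matrix (Fin 4) (Fin 4) CoxPoly) (Φ : SheafHom (tangentSheaf δ) (tangentSheaf δ)) :
    Prop :=
  ∀ (U : Opens (Surface δ)) (v : Pre U → Fin 4 → ℂ) (D : TangentSec U),
    IsEulerSec U v → IsPushforward v D →
      IsEulerSec U (fun z => Matrix.mulVec (A.map z.eval) (v z)) ∧
      IsPushforward (fun z => Matrix.mulVec (A.map z.eval) (v z)) (Φ.1 U D)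

/-- The polynomial affine vector field
`V₀ ∂/∂X₀ + V₁ ∂/∂X₁ + W₀ ∂/∂Y₀ + W₁ ∂/∂Y₁`, given as `X = (V₀, V₁, W₀, W₁)` with `V₀, V₁`
bi-homogeneous of bi-degree `(d₁ + 1, d₂)`, `W₀` of bi-degree `(d₁, d₂ + 1)` and `W₁` of bi-degree
`(d₁ - δ, d₂ + 1)`, represents the section `s` of `Hom(L, Θ)`, where `L` is identified with
`𝒪(-d₁, -d₂)` by the isomorphism `e`. -/
def IsRepresentedBy {L : OMod δ} {d : ℤ × ℤ} (e : SheafHom (twist δ (-d)) L)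
    (s : SheafHom L (tangentSheaf δ)) (X : Fin 4 → CoxPoly) : Prop :=
  (∀ i, MvPolynomial.IsWeightedHomogeneous (coxDeg δ) (X i) (d + coxDeg δ i)) ∧
  ∀ (U : Opens (Surface δ)) (g : twistSec (-d) U),
    IsPushforward (fun z i => g.1 z * z.eval (X i)) (s.1 U (e.1 U g))

/-- The coefficients `(A₀, A₁, B₀, B₁)` of the affine `1`-form
`Ω = A₀ dX₀ + A₁ dX₁ + B₀ dY₀ + B₁ dY₁` attached to the affine vector field `X`: the determinant
with rows `(dX₀, dX₁, dY₀, dY₁)`, `R₁`, `R₂` and `X`, where `R₁, R₂` are the radial vector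
fields. -/
noncomputable def affineForm (δ : ℕ) (X : Fin 4 → CoxPoly) (j : Fin 4) : CoxPoly :=
  Matrix.det !![
    (Pi.single j 1 : Fin 4 → CoxPoly) 0, (Pi.single j 1 : Fin 4 → CoxPoly) 1,
      (Pi.single j 1 : Fin 4 → CoxPoly) 2, (Pi.single j 1 : Fin 4 → CoxPoly) 3;
    MvPolynomial.X 0, MvPolynomial.X 1, 0, -(δ : CoxPoly) * MvPolynomial.X 3;
    0, 0, MvPolynomial.X 2, MvPolynomial.X 3;
    X 0, X 1, X 2, X 3]

/-- The parameters of an endomorphism: `(a, d)` for `δ = 0`, `a` for `δ = 1`, and `(a, C)` with `C`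
a binary form of degree `δ - 2` for `δ ≥ 2`. -/
def Params : ℕ → Type
  | 0 => ℂ × ℂ
  | 1 => ℂ
  | n + 2 => ℂ × MvPolynomial.homogeneousSubmodule (Fin 2) ℂ n

/-- The matrices `A(a, d)`, `A(a)` and `A(a, C)`. -/
noncomputable def endoMatrix : (δ : ℕ) → Params δ → Matrix (Fin 4) (Fin 4) CoxPoly
  | 0, (a, d) => Matrix.diagonal
      ![MvPolynomial.C a, MvPolynomial.C a, MvPolynomial.C d, MvPolynomial.C d]
  | 1, a => Matrix.scalar (Fin 4) (MvPolynomial.C (show ℂ from a))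
  | _ + 2, (a, C) =>
      let c : CoxPoly := MvPolynomial.rename ![0, 1] C.1
      !![MvPolynomial.C a, 0, 0, 0;
         0, MvPolynomial.C a, 0, 0;
         MvPolynomial.X 1 * MvPolynomial.X 3 * c, -(MvPolynomial.X 0 * MvPolynomial.X 3 * c),
           MvPolynomial.C a, 0;
         0, 0, 0, MvPolynomial.C a]

/-- The conjugate parameters `(d, a)`, `a` and `(a, -C)`. -/
noncomputable def conjParams : (δ : ℕ) → Params δ → Params δ
  | 0, (a, d) => (d, a)
  | 1, a => a
  | _ + 2, (a, C) => (a, -C)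

/-- The condition `a d ≠ 0` for `δ = 0`, and `a ≠ 0` for `δ ≥ 1`. -/
def NonDegenerate : (δ : ℕ) → Params δ → Prop
  | 0, (a, d) => a * d ≠ 0
  | 1, a => (show ℂ from a) ≠ 0
  | _ + 2, (a, _) => a ≠ 0

end Hirzebruch

open Hirzebruch

namespace Hirzebruch

open TopologicalSpace

variable {δ : ℕ}

/-! ### Characters and the torus action -/

/-! The proof makes the Euler sequence 0 → 𝒪² → ℋ → Θ → 0 explicit on the cone. `IsLift` says that a
vector of ℂ⁴ lies over the value of a derivation at a point. Slices of the torus action show that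
tangent fields lift locally to ℋ (`Chart.exists_lift`) and that the kernel of dπ is spanned at each
point by the radial vectors R₁ = (X₀, X₁, 0, -δY₁) and R₂ = (0, 0, Y₀, Y₁) (`isLift_zero_iff`).

An endomorphism Φ becomes a matrix by lifting Φ ∘ dπ : ℋ → Θ through dπ. On a summand 𝒪(e) of ℋ the
obstruction lies in two copies of H¹(𝒪(-e)). If both entries of e are at most 1, as for all four
summands, it can be removed by splitting Laurent monomials, along the fibres and then along the base
(`exists_split_fibre`, `exists_split_base`, `RepOn.glue`). The coefficients of the lift are global
sections of twisting sheaves, hence polynomials (`exists_poly_of_global`). So Φ is multiplication by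
a matrix of bi-homogeneous polynomials (`exists_graded_represents`).

Such a matrix descends to Θ exactly when it preserves the radial span at every point. The bi-degrees
kill most entries, and the radial condition leaves the normal form (a, d, E) with E of bi-degree
(-2, 1) and δ(a - d) = 0 (`eq_normalMatrix`). The monomials available for E are Y₁X₀ⁱX₁^(δ-2-i).
There are δ - 1 of them for δ ≥ 1 and none for δ = 0, while the scalars contribute 1 and 2
dimensions respectively. The totals are δ and 2.

Invertibility follows from the product rule (a, d, E)(a', d', E') = (aa', dd', a'E + dE'). For the
1-forms, ω(v, w) = det(v, R₁, R₂, w) is an area form on the rank two quotient by the radial span.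
The endomorphism induced by A has trace a + d there, so ω(v, Aw) = ω((a + d - A)v, w), and (a + d)·1
- A is the normal matrix (d, a, -E), which is A♯. -/

theorem chr_ne_zero (t : ℂˣ × ℂˣ) (d : ℤ × ℤ) : chr t d ≠ 0 := Units.ne_zero _

theorem chr_add (t : ℂˣ × ℂˣ) (d e : ℤ × ℤ) : chr t (d + e) = chr t d * chr t e := by
  simp only [chr, Prod.fst_add, Prod.snd_add, zpow_add, ← Units.val_mul]
  congr 1
  exact mul_mul_mul_comm _ _ _ _

theorem chr_zero (t : ℂˣ × ℂˣ) : chr t 0 = 1 := by simp [chr]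

theorem chr_neg (t : ℂˣ × ℂˣ) (d : ℤ × ℤ) : chr t (-d) = (chr t d)⁻¹ :=
  eq_inv_of_mul_eq_one_left (by rw [← chr_add, neg_add_cancel, chr_zero])

theorem chr_inv (t : ℂˣ × ℂˣ) (d : ℤ × ℤ) : chr t⁻¹ d = (chr t d)⁻¹ :=
  eq_inv_of_mul_eq_one_left (by rw [← chr_mul, inv_mul_cancel, chr_one])

theorem chr_nsmul (t : ℂˣ × ℂˣ) (n : ℕ) (d : ℤ × ℤ) : chr t (n • d) = chr t d ^ n := by
  induction n with
  | zero => simp [chr_zero]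
  | succ n ih => rw [succ_nsmul, chr_add, ih, pow_succ]

/-- A character determines its exponent. -/
theorem chr_injective {d e : ℤ × ℤ} (h : ∀ t, chr t d = chr t e) : d = e := by
  have key : ∀ m n : ℤ, (2 : ℂ) ^ m = 2 ^ n → m = n := by
    intro m n hmn
    have h2 : (2 : ℝ) ^ m = 2 ^ n := Complex.ofReal_injective (by push_cast; exact hmn)
    exact zpow_right_injective₀ (by norm_num) (by norm_num) h2
  have h1 := h (Units.mk0 2 two_ne_zero, 1)
  have h2 := h (1, Units.mk0 2 two_ne_zero)
  simp only [chr, one_zpow, mul_one, one_mul, Units.val_zpow_eq_zpow_val, Units.val_mk0] at h1 h2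
  exact Prod.ext (key _ _ h1) (key _ _ h2)

/-- The action of the torus on `ℂ⁴`. -/
noncomputable def act (δ : ℕ) (t : ℂˣ × ℂˣ) (z : Fin 4 → ℂ) : Fin 4 → ℂ :=
  fun i => chr t (coxDeg δ i) * z i

theorem act_apply (t : ℂˣ × ℂˣ) (z : Fin 4 → ℂ) (i : Fin 4) :
    act δ t z i = chr t (coxDeg δ i) * z i := rfl

theorem act_mul (t u : ℂˣ × ℂˣ) (z : Fin 4 → ℂ) : act δ (t * u) z = act δ t (act δ u z) := by
  funext i; simp only [act_apply, chr_mul, mul_assoc]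

theorem act_inv_act (t : ℂˣ × ℂˣ) (z : Fin 4 → ℂ) : act δ t⁻¹ (act δ t z) = z := by
  rw [← act_mul, inv_mul_cancel]; funext i; simp [act_apply, chr_one]

theorem act_act_inv (t : ℂˣ × ℂˣ) (z : Fin 4 → ℂ) : act δ t (act δ t⁻¹ z) = z := by
  rw [← act_mul, mul_inv_cancel]; funext i; simp [act_apply, chr_one]

theorem act_add (t : ℂˣ × ℂˣ) (z w : Fin 4 → ℂ) : act δ t (z + w) = act δ t z + act δ t w := by
  funext i; simp only [act_apply, Pi.add_apply, mul_add]

theorem act_smul (t : ℂˣ × ℂˣ) (c : ℂ) (z : Fin 4 → ℂ) : act δ t (c • z) = c • act δ t z := by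
  funext i; simp only [act_apply, Pi.smul_apply, smul_eq_mul, mul_left_comm]

theorem act_ne_zero_iff (t : ℂˣ × ℂˣ) (z : Fin 4 → ℂ) (i : Fin 4) :
    act δ t z i ≠ 0 ↔ z i ≠ 0 := by
  simp [act_apply, chr_ne_zero]

/-- The action of the torus on the product of two punctured planes. -/
noncomputable def Cone.act (δ : ℕ) (t : ℂˣ × ℂˣ) (z : Cone) : Cone :=
  ⟨Hirzebruch.act δ t z.1, by simpa only [act_ne_zero_iff] using z.2⟩

theorem proj_act (t : ℂˣ × ℂˣ) (z : Cone) : proj δ (z.act δ t) = proj δ z :=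
  (Quotient.sound (s := torusSetoid δ) ⟨t, fun _ => rfl⟩).symm

theorem proj_eq_iff {z w : Cone} : proj δ z = proj δ w ↔ ∃ t, w = z.act δ t := by
  constructor
  · intro h
    obtain ⟨t, ht⟩ := Quotient.exact (s := torusSetoid δ) h
    exact ⟨t, Subtype.ext (funext ht)⟩
  · rintro ⟨t, rfl⟩
    exact (proj_act t z).symm

/-- The action of the torus on `Pre U`. -/
noncomputable def Pre.act {U : Opens (Surface δ)} (t : ℂˣ × ℂˣ) (z : Pre U) : Pre U :=
  ⟨z.1.act δ t, by rw [proj_act]; exact z.2⟩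

theorem Pre.act_pt {U : Opens (Surface δ)} (t : ℂˣ × ℂˣ) (z : Pre U) : (z.act t).pt = z.pt :=
  Subtype.ext (proj_act t z.1)

theorem Pre.pt_eq_iff {U : Opens (Surface δ)} {z w : Pre U} :
    z.pt = w.pt ↔ ∃ t, w = z.act t := by
  rw [Subtype.ext_iff]
  refine proj_eq_iff.trans (exists_congr fun t => ?_)
  exact ⟨fun h => Subtype.ext h, fun h => congrArg Subtype.val h⟩

theorem Pre.exists_pt {U : Opens (Surface δ)} (p : U) : ∃ z : Pre U, z.pt = p := by
  obtain ⟨z, hz⟩ := Quotient.exists_rep p.1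
  have hz' : proj δ z = p.1 := hz
  exact ⟨⟨z, by rw [hz']; exact p.2⟩, Subtype.ext hz'⟩

theorem Pre.ext_val {U : Opens (Surface δ)} {z w : Pre U} (h : z.1.1 = w.1.1) : z = w :=
  Subtype.ext (Subtype.ext h)

theorem mem_twistSec_iff {d : ℤ × ℤ} {U : Opens (Surface δ)} {g : Pre U → ℂ} :
    g ∈ twistSec d U ↔ IsRegular U g ∧ ∀ t z, g (z.act t) = chr t d * g z := by
  refine and_congr_right fun _ => ⟨fun h t z => h t z _ fun i => rfl, fun h t z w hw => ?_⟩
  rw [show w = z.act t from Pre.ext_val (funext hw), h]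

/-- Each monomial is an eigenvector of the torus, with character given by its weight. Keeping the
weights separate allows the converse, from equivariance back to homogeneity. -/
theorem eval_act (t : ℂˣ × ℂˣ) (z : Fin 4 → ℂ) (P : CoxPoly) :
    MvPolynomial.eval (act δ t z) P =
      ∑ m ∈ P.support, chr t (Finsupp.weight (coxDeg δ) m) *
        (P.coeff m * ∏ i, z i ^ m i) := by
  rw [MvPolynomial.eval_eq']
  refine Finset.sum_congr rfl fun m _ => ?_
  have h : ∏ i, act δ t z i ^ m i =
      chr t (Finsupp.weight (coxDeg δ) m) * ∏ i, z i ^ m i := by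
    simp only [act_apply, mul_pow, Finset.prod_mul_distrib]
    congr 1
    rw [Finsupp.weight_apply, Finsupp.sum_fintype _ _ (by simp)]
    simp only [← chr_nsmul]
    simp only [Fin.prod_univ_four, Fin.sum_univ_four, chr_add]
  rw [h]; ring

theorem eval_act_of_homogeneous {P : CoxPoly} {e : ℤ × ℤ}
    (hP : MvPolynomial.IsWeightedHomogeneous (coxDeg δ) P e) (t : ℂˣ × ℂˣ) (z : Fin 4 → ℂ) :
    MvPolynomial.eval (act δ t z) P = chr t e * MvPolynomial.eval z P := by
  rw [eval_act, MvPolynomial.eval_eq', Finset.mul_sum]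
  refine Finset.sum_congr rfl fun m hm => ?_
  rw [hP (MvPolynomial.mem_support_iff.1 hm)]

/-! ### Open sets and regular functions -/

theorem pointToPoint_mem_basicOpen (z : Fin 4 → ℂ) (Q : CoxPoly) :
    (MvPolynomial.pointToPoint z : PrimeSpectrum CoxPoly) ∈ PrimeSpectrum.basicOpen Q ↔
      MvPolynomial.eval z Q ≠ 0 := by
  rw [PrimeSpectrum.mem_basicOpen, ← MvPolynomial.coe_aeval_eq_eval]
  exact not_congr (MvPolynomial.mem_vanishingIdeal_singleton_iff z Q)

/-- The polynomial Q need not be bi-homogeneous: its nonvanishing locus is an open subset of the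
saturated set over U, not itself saturated. -/
theorem Pre.exists_basic_nhd {U : Opens (Surface δ)} (z : Pre U) :
    ∃ Q : CoxPoly, z.eval Q ≠ 0 ∧ ∀ w : Cone, MvPolynomial.eval w.1 Q ≠ 0 → proj δ w ∈ U := by
  have h1 : @IsOpen _ coneZariski (proj δ ⁻¹' (U : Set (Surface δ))) :=
    (@isOpen_coinduced _ _ coneZariski (U : Set (Surface δ)) (proj δ)).1 U.2
  obtain ⟨T, hT, hTU⟩ := isOpen_induced_iff.1 h1
  have hz : (MvPolynomial.pointToPoint z.1.1 : PrimeSpectrum CoxPoly) ∈ T := by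
    have : z.1 ∈ proj δ ⁻¹' (U : Set (Surface δ)) := z.2
    rwa [← hTU] at this
  obtain ⟨_, ⟨Q, rfl⟩, hQz, hQT⟩ :=
    PrimeSpectrum.isTopologicalBasis_basic_opens.exists_subset_of_mem_open hz hT
  refine ⟨Q, (pointToPoint_mem_basicOpen _ _).1 hQz, fun w hw => ?_⟩
  have : w ∈ proj δ ⁻¹' (U : Set (Surface δ)) := by
    rw [← hTU]; exact hQT ((pointToPoint_mem_basicOpen _ _).2 hw)
  exact this

/-- The open set where a bi-homogeneous polynomial does not vanish. -/
def basicOpen (h : CoxPoly) {e : ℤ × ℤ}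
    (hh : MvPolynomial.IsWeightedHomogeneous (coxDeg δ) h e) : Opens (Surface δ) where
  carrier := {p | ∀ z, proj δ z = p → MvPolynomial.eval z.1 h ≠ 0}
  is_open' := by
    refine (@isOpen_coinduced _ _ coneZariski _ (proj δ)).2
      (isOpen_induced_iff.2 ⟨PrimeSpectrum.basicOpen h, (PrimeSpectrum.basicOpen h).2, ?_⟩)
    ext z
    simp only [Set.mem_preimage, SetLike.mem_coe, pointToPoint_mem_basicOpen, Set.mem_ofPred_eq]
    refine ⟨fun hz w hw => ?_, fun hz => hz z rfl⟩
    obtain ⟨t, rfl⟩ := proj_eq_iff.1 hw.symm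
    rw [Cone.act, eval_act_of_homogeneous hh]
    exact mul_ne_zero (chr_ne_zero _ _) hz

theorem proj_mem_basicOpen {h : CoxPoly} {e : ℤ × ℤ}
    {hh : MvPolynomial.IsWeightedHomogeneous (coxDeg δ) h e} {z : Cone} :
    proj δ z ∈ basicOpen h hh ↔ MvPolynomial.eval z.1 h ≠ 0 := by
  refine ⟨fun hz => hz z rfl, fun hz w hw => ?_⟩
  obtain ⟨t, rfl⟩ := proj_eq_iff.1 hw.symm
  rw [Cone.act, eval_act_of_homogeneous hh]
  exact mul_ne_zero (chr_ne_zero _ _) hz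

/-- The denominator-free form of regularity. Its relation holds on all of `Pre U`, not only where Q
is nonzero, so it can be differentiated, and the admissible Q for a given function form an ideal. -/
theorem isRegular_iff {U : Opens (Surface δ)} {g : Pre U → ℂ} :
    IsRegular U g ↔ ∀ z : Pre U, ∃ P Q : CoxPoly, z.eval Q ≠ 0 ∧
      ∀ w : Pre U, w.eval Q * g w = w.eval P := by
  refine forall_congr' fun z => ⟨?_, ?_⟩
  · rintro ⟨P, Q, hQ, h⟩
    -- The fraction P/Q is written as QP/Q², so that both sides of the relation vanish where Q does.
    refine ⟨Q * P, Q * Q, by simpa [Pre.eval] using hQ, fun w => ?_⟩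
    by_cases hw : w.eval Q = 0
    · have hw' : MvPolynomial.eval w.1.1 Q = 0 := hw
      simp [Pre.eval, hw']
    · rw [h w hw]
      simp only [Pre.eval, map_mul] at hw ⊢
      field_simp
  · rintro ⟨P, Q, hQ, h⟩
    exact ⟨P, Q, hQ, fun w hw => by rw [← h w, mul_div_cancel_left₀ _ hw]⟩

theorem IsRegular.poly (U : Opens (Surface δ)) (P : CoxPoly) :
    IsRegular U (fun z => z.eval P) :=
  isRegular_iff.2 fun z => ⟨P, 1, by simp [Pre.eval], fun w => by simp [Pre.eval]⟩

theorem IsRegular.sum {U : Opens (Surface δ)} {ι : Type*} (s : Finset ι) {f : ι → Pre U → ℂ}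
    (hf : ∀ i ∈ s, IsRegular U (f i)) : IsRegular U (fun z => ∑ i ∈ s, f i z) := by
  classical
  induction s using Finset.induction_on with
  | empty => simpa using IsRegular.const U 0
  | insert a s ha ih =>
    simp only [Finset.sum_insert ha]
    exact (hf a (by simp)).add (ih fun i hi => hf i (by simp [hi]))

theorem IsRegular.sub {U : Opens (Surface δ)} {f g : Pre U → ℂ} (hf : IsRegular U f)
    (hg : IsRegular U g) : IsRegular U (fun z => f z - g z) := by
  have h := hf.add ((IsRegular.const U (-1)).mul hg)
  convert h using 2 with z
  ring

/-- A function is regular if near each point some multiple of it by a polynomial is regular. -/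
theorem isRegular_of_mul {U : Opens (Surface δ)} {g : Pre U → ℂ}
    (h : ∀ z : Pre U, ∃ Q : CoxPoly, z.eval Q ≠ 0 ∧ IsRegular U (fun w => w.eval Q * g w)) :
    IsRegular U g := by
  refine isRegular_iff.2 fun z => ?_
  obtain ⟨Q, hQ, h1⟩ := h z
  obtain ⟨P, Q', hQ', h2⟩ := isRegular_iff.1 h1 z
  refine ⟨P, Q' * Q, ?_, fun w => ?_⟩
  · simpa [Pre.eval] using And.intro hQ' hQ
  · rw [← h2 w]; simp [Pre.eval, mul_assoc]

theorem isRegular_of_local {U : Opens (Surface δ)} {g : Pre U → ℂ}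
    (h : ∀ z : Pre U, ∃ (V : Opens (Surface δ)) (hV : V ≤ U), proj δ z.1 ∈ V ∧
      IsRegular V (fun w => g (w.incl hV))) : IsRegular U g := by
  refine isRegular_iff.2 fun z => ?_
  obtain ⟨V, hV, hz, h1⟩ := h z
  obtain ⟨P, Q, hQ, h2⟩ := isRegular_iff.1 h1 ⟨z.1, hz⟩
  obtain ⟨S, hS, h3⟩ := Pre.exists_basic_nhd (⟨z.1, hz⟩ : Pre V)
  -- The factor S, whose nonvanishing locus lies over V, makes the relation trivial outside V.
  refine ⟨S * P, S * Q, ?_, fun w => ?_⟩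
  · simpa [Pre.eval] using And.intro hS hQ
  · by_cases hw : MvPolynomial.eval w.1.1 S = 0
    · simp [Pre.eval, hw]
    · have h4 := h2 ⟨w.1, h3 w.1 hw⟩
      simp only [Pre.eval, map_mul] at h4 ⊢
      rw [← h4, mul_assoc]
      rfl

/-! ### Derivatives of polynomials and of pulled back functions -/

/-- The differential of a polynomial. -/
noncomputable def dEval (P : CoxPoly) (z v : Fin 4 → ℂ) : ℂ :=
  ∑ k, v k * MvPolynomial.eval z (MvPolynomial.pderiv k P)

theorem dEval_add (P : CoxPoly) (z v w : Fin 4 → ℂ) :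
    dEval P z (v + w) = dEval P z v + dEval P z w := by
  simp only [dEval, Pi.add_apply, add_mul, Finset.sum_add_distrib]

theorem dEval_smul (P : CoxPoly) (z : Fin 4 → ℂ) (c : ℂ) (v : Fin 4 → ℂ) :
    dEval P z (c • v) = c * dEval P z v := by
  simp only [dEval, Pi.smul_apply, smul_eq_mul, Finset.mul_sum, mul_assoc]

theorem dEval_mul (P Q : CoxPoly) (z v : Fin 4 → ℂ) :
    dEval (P * Q) z v =
      dEval P z v * MvPolynomial.eval z Q + MvPolynomial.eval z P * dEval Q z v := by
  simp only [dEval, MvPolynomial.pderiv_mul, map_add, map_mul, Finset.sum_mul, Finset.mul_sum,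
    ← Finset.sum_add_distrib]
  exact Finset.sum_congr rfl fun k _ => by ring

theorem dEval_C (c : ℂ) (z v : Fin 4 → ℂ) : dEval (MvPolynomial.C c) z v = 0 := by
  simp [dEval]

theorem dEval_X (i : Fin 4) (z v : Fin 4 → ℂ) : dEval (MvPolynomial.X i) z v = v i := by
  simp [dEval, MvPolynomial.pderiv_X, Pi.single_apply, apply_ite (MvPolynomial.eval z)]

/-- The chain rule is needed along arbitrary curves: lines for directional derivatives, torus orbits
for the radial vectors. -/
theorem hasDerivAt_eval (P : CoxPoly) {γ : ℂ → Fin 4 → ℂ} {γ' : Fin 4 → ℂ} {s : ℂ}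
    (h : ∀ k, HasDerivAt (fun s => γ s k) (γ' k) s) :
    HasDerivAt (fun s => MvPolynomial.eval (γ s) P) (dEval P (γ s) γ') s := by
  induction P using MvPolynomial.induction_on with
  | C c => simpa [dEval_C] using hasDerivAt_const s c
  | add P Q hP hQ =>
    have : dEval (P + Q) (γ s) γ' = dEval P (γ s) γ' + dEval Q (γ s) γ' := by
      simp only [dEval, map_add, mul_add, Finset.sum_add_distrib]
    rw [this]
    simp only [map_add]
    exact hP.add hQ
  | mul_X P i hP =>
    rw [dEval_mul, dEval_X]
    simp only [map_mul, MvPolynomial.eval_X]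
    exact hP.mul (h i)

theorem hasDerivAt_eval_line (P : CoxPoly) (z v : Fin 4 → ℂ) :
    HasDerivAt (fun s : ℂ => MvPolynomial.eval (z + s • v) P) (dEval P z v) 0 := by
  have h := hasDerivAt_eval P (γ := fun s : ℂ => z + s • v) (γ' := v) (s := 0) fun k => by
    simpa using ((hasDerivAt_id (0 : ℂ)).mul_const (v k)).const_add (z k)
  simpa using h

theorem pullback_pt {V : Opens (Surface δ)} (f : V → ℂ) (z : Pre V) :
    pullback f z.1.1 = f z.pt := by
  have h : ∃ w : Pre V, w.1.1 = z.1.1 := ⟨z, rfl⟩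
  rw [pullback, dif_pos h, Pre.ext_val h.choose_spec]

theorem pullback_act {V : Opens (Surface δ)} (f : V → ℂ) (t : ℂˣ × ℂˣ) (z : Fin 4 → ℂ) :
    pullback f (act δ t z) = pullback f z := by
  by_cases h : ∃ w : Pre V, w.1.1 = z
  · obtain ⟨w, rfl⟩ := h
    rw [pullback_pt, show act δ t w.1.1 = (w.act t).1.1 from rfl, pullback_pt, Pre.act_pt]
  · have h' : ¬∃ w : Pre V, w.1.1 = act δ t z := by
      rintro ⟨w, hw⟩
      refine h ⟨w.act t⁻¹, ?_⟩
      show act δ t⁻¹ w.1.1 = z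
      rw [hw, act_inv_act]
    rw [pullback, dif_neg h', pullback, dif_neg h]

/-- Zariski open sets are open in the classical topology, so the extension by zero in `pullback` has
no influence on derivatives at points over V. -/
theorem Pre.eventually_mem {V : Opens (Surface δ)} (z : Pre V) :
    ∀ᶠ y in nhds z.1.1, ∃ w : Pre V, w.1.1 = y := by
  obtain ⟨Q, hQ, h⟩ := z.exists_basic_nhd
  have h0 : ∀ i, z.1.1 i ≠ 0 → ∀ᶠ y in nhds z.1.1, y i ≠ 0 := fun i hi =>
    (continuous_apply i).continuousAt.eventually_ne hi
  have h1 : ∀ᶠ y in nhds z.1.1, MvPolynomial.eval y Q ≠ 0 :=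
    (MvPolynomial.continuous_eval Q).continuousAt.eventually_ne hQ
  have h2 : ∀ᶠ y in nhds z.1.1, y 0 ≠ 0 ∨ y 1 ≠ 0 := by
    rcases z.1.2.1 with hz | hz
    · exact (h0 _ hz).mono fun _ => Or.inl
    · exact (h0 _ hz).mono fun _ => Or.inr
  have h3 : ∀ᶠ y in nhds z.1.1, y 2 ≠ 0 ∨ y 3 ≠ 0 := by
    rcases z.1.2.2 with hz | hz
    · exact (h0 _ hz).mono fun _ => Or.inl
    · exact (h0 _ hz).mono fun _ => Or.inr
  filter_upwards [h1, h2, h3] with y hy1 hy2 hy3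
  exact ⟨⟨⟨y, hy2, hy3⟩, h _ hy1⟩, rfl⟩

theorem tendsto_line (z v : Fin 4 → ℂ) :
    Filter.Tendsto (fun s : ℂ => z + s • v) (nhds 0) (nhds z) := by
  have : ContinuousAt (fun s : ℂ => z + s • v) 0 := by fun_prop
  simpa [ContinuousAt] using this

/-- Differentiating Q · (f ∘ π) = P in the direction v. Together with the converse below, it trades
an analytic derivative for an equation that is linear in the pair of v and the derivative l. -/
theorem rel_of_hasLineDerivAt {V : Opens (Surface δ)} {f : V → ℂ} {P Q : CoxPoly}
    (h : ∀ w : Pre V, w.eval Q * f w.pt = w.eval P) {z : Pre V} {v : Fin 4 → ℂ} {l : ℂ}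
    (hl : HasLineDerivAt ℂ (pullback f) l z.1.1 v) :
    z.eval Q * l + f z.pt * dEval Q z.1.1 v = dEval P z.1.1 v := by
  have h1 := (hasDerivAt_eval_line Q z.1.1 v).mul hl
  have h2 : (fun s : ℂ => MvPolynomial.eval (z.1.1 + s • v) P) =ᶠ[nhds 0]
      fun s => MvPolynomial.eval (z.1.1 + s • v) Q * pullback f (z.1.1 + s • v) := by
    filter_upwards [(tendsto_line z.1.1 v).eventually z.eventually_mem] with s hs
    obtain ⟨w, hw⟩ := hs
    rw [← hw, pullback_pt]
    exact (h w).symm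
  have h3 := (h1.congr_of_eventuallyEq h2).unique (hasDerivAt_eval_line P z.1.1 v)
  rw [← h3]
  simp only [zero_smul, add_zero, pullback_pt, Pre.eval]
  ring

theorem hasLineDerivAt_of_rel {V : Opens (Surface δ)} {f : V → ℂ} {P Q : CoxPoly}
    (h : ∀ w : Pre V, w.eval Q * f w.pt = w.eval P) {z : Pre V} {v : Fin 4 → ℂ} {l : ℂ}
    (hQ : z.eval Q ≠ 0) (hl : z.eval Q * l + f z.pt * dEval Q z.1.1 v = dEval P z.1.1 v) :
    HasLineDerivAt ℂ (pullback f) l z.1.1 v := by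
  have hQ' : MvPolynomial.eval (z.1.1 + (0 : ℂ) • v) Q ≠ 0 := by simpa [Pre.eval] using hQ
  have h1 := (hasDerivAt_eval_line P z.1.1 v).div (hasDerivAt_eval_line Q z.1.1 v) hQ'
  have h2 : (fun s : ℂ => pullback f (z.1.1 + s • v)) =ᶠ[nhds 0]
      fun s => MvPolynomial.eval (z.1.1 + s • v) P / MvPolynomial.eval (z.1.1 + s • v) Q := by
    have h3 : ∀ᶠ y in nhds z.1.1, MvPolynomial.eval y Q ≠ 0 :=
      (MvPolynomial.continuous_eval Q).continuousAt.eventually_ne hQ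
    filter_upwards [(tendsto_line z.1.1 v).eventually z.eventually_mem,
      (tendsto_line z.1.1 v).eventually h3] with s hs hs'
    obtain ⟨w, hw⟩ := hs
    rw [← hw] at hs' ⊢
    rw [pullback_pt, eq_div_iff hs', mul_comm]
    exact h w
  have h4 := h1.congr_of_eventuallyEq h2
  have h5 : z.eval P = z.eval Q * f z.pt := (h z).symm
  have h6 : l = (dEval P z.1.1 v * MvPolynomial.eval (z.1.1 + (0 : ℂ) • v) Q -
      MvPolynomial.eval (z.1.1 + (0 : ℂ) • v) P * dEval Q z.1.1 v) /
      MvPolynomial.eval (z.1.1 + (0 : ℂ) • v) Q ^ 2 := by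
    rw [eq_div_iff (pow_ne_zero 2 hQ'), ← hl]
    simp only [zero_smul, add_zero]
    simp only [Pre.eval] at h5 ⊢
    rw [h5]
    ring
  rw [h6]
  exact h4

theorem hasLineDerivAt_pullback_act {V : Opens (Surface δ)} {f : V → ℂ} {l : ℂ}
    {z v : Fin 4 → ℂ} (t : ℂˣ × ℂˣ) :
    HasLineDerivAt ℂ (pullback f) l (act δ t z) (act δ t v) ↔
      HasLineDerivAt ℂ (pullback f) l z v := by
  have : (fun s : ℂ => pullback f (act δ t z + s • act δ t v)) =
      fun s : ℂ => pullback f (z + s • v) := by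
    funext s
    rw [← act_smul, ← act_add, pullback_act]
  simp only [HasLineDerivAt, this]

theorem hasLineDerivAt_restrict {V W : Opens (Surface δ)} (h : W ≤ V) (f : V → ℂ) (z : Pre W)
    {v : Fin 4 → ℂ} {l : ℂ} :
    HasLineDerivAt ℂ (pullback fun p : W => f ⟨p.1, h p.2⟩) l z.1.1 v ↔
      HasLineDerivAt ℂ (pullback f) l z.1.1 v := by
  apply Filter.EventuallyEq.hasLineDerivAt_iff
  filter_upwards [z.eventually_mem] with y hy
  obtain ⟨w, rfl⟩ := hy
  rw [pullback_pt, show w.1.1 = (w.incl h).1.1 from rfl, pullback_pt]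
  rfl

/-! ### Sections of the twisting sheaves -/

theorem IsRegular.inv {U : Opens (Surface δ)} {g : Pre U → ℂ} (hg : IsRegular U g)
    (h0 : ∀ z, g z ≠ 0) : IsRegular U (fun z => (g z)⁻¹) := by
  refine isRegular_iff.2 fun z => ?_
  obtain ⟨P, Q, hQ, h⟩ := isRegular_iff.1 hg z
  refine ⟨Q, P, ?_, fun w => ?_⟩
  · rw [← h z]; exact mul_ne_zero hQ (h0 z)
  · rw [← h w, mul_assoc, mul_inv_cancel₀ (h0 w), mul_one]

theorem IsRegular.pow {U : Opens (Surface δ)} {g : Pre U → ℂ} (hg : IsRegular U g) (n : ℕ) :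
    IsRegular U (fun z => g z ^ n) := by
  induction n with
  | zero => simpa using IsRegular.const U 1
  | succ n ih => simpa only [pow_succ] using ih.mul hg

theorem IsRegular.zpow {U : Opens (Surface δ)} {g : Pre U → ℂ} (hg : IsRegular U g)
    (h0 : ∀ z, g z ≠ 0) (n : ℤ) : IsRegular U (fun z => g z ^ n) := by
  obtain ⟨n, rfl | rfl⟩ := n.eq_nat_or_neg
  · simpa using hg.pow n
  · simpa using (hg.pow n).inv fun z => pow_ne_zero n (h0 z)

theorem mul_mem_twistSec {d e : ℤ × ℤ} {U : Opens (Surface δ)} {g h : Pre U → ℂ}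
    (hg : g ∈ twistSec d U) (hh : h ∈ twistSec e U) :
    (fun z => g z * h z) ∈ twistSec (d + e) U := by
  rw [mem_twistSec_iff] at hg hh ⊢
  refine ⟨hg.1.mul hh.1, fun t z => ?_⟩
  rw [hg.2, hh.2, chr_add]; ring

theorem incl_mem_twistSec {d : ℤ × ℤ} {U V : Opens (Surface δ)} (h : V ≤ U) {g : Pre U → ℂ}
    (hg : g ∈ twistSec d U) : (fun z : Pre V => g (z.incl h)) ∈ twistSec d V :=
  ⟨hg.1.comp_incl h, fun t z w hw => hg.2 t (z.incl h) (w.incl h) hw⟩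

theorem pt_mem_twistSec {U : Opens (Surface δ)} (f : regFun U) :
    (fun z : Pre U => f.1 z.pt) ∈ twistSec 0 U :=
  mem_twistSec_iff.2 ⟨f.2, fun t z => by rw [Pre.act_pt, chr_zero, one_mul]⟩

theorem inv_mem_twistSec {d : ℤ × ℤ} {U : Opens (Surface δ)} {g : Pre U → ℂ}
    (hg : g ∈ twistSec d U) (h0 : ∀ z, g z ≠ 0) : (fun z => (g z)⁻¹) ∈ twistSec (-d) U := by
  rw [mem_twistSec_iff] at hg ⊢
  exact ⟨hg.1.inv h0, fun t z => by rw [hg.2, chr_neg, mul_inv]⟩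

theorem poly_mem_twistSec {e : ℤ × ℤ} (U : Opens (Surface δ)) {P : CoxPoly}
    (hP : MvPolynomial.IsWeightedHomogeneous (coxDeg δ) P e) :
    (fun z : Pre U => z.eval P) ∈ twistSec e U :=
  mem_twistSec_iff.2 ⟨IsRegular.poly U P, fun t z => eval_act_of_homogeneous hP t z.1.1⟩

theorem zpow_mem_twistSec {d : ℤ × ℤ} {U : Opens (Surface δ)} {g : Pre U → ℂ}
    (hg : g ∈ twistSec d U) (h0 : ∀ z, g z ≠ 0) (n : ℤ) :
    (fun z => g z ^ n) ∈ twistSec (n • d) U := by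
  rw [mem_twistSec_iff] at hg ⊢
  refine ⟨hg.1.zpow h0 n, fun t z => ?_⟩
  rw [hg.2, mul_zpow]
  congr 1
  simp only [chr, Prod.smul_fst, Prod.smul_snd, smul_eq_mul, mul_comm n, zpow_mul,
    Units.val_zpow_eq_zpow_val, Units.val_mul, mul_zpow]

/-- A section of `𝒪(0, 0)` as a regular function. -/
noncomputable def descend {U : Opens (Surface δ)} (g : twistSec (0 : ℤ × ℤ) U) : regFun U :=
  ⟨fun p => g.1 (Pre.exists_pt p).choose, by
    have : (fun z : Pre U => g.1 (Pre.exists_pt z.pt).choose) = g.1 := by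
      funext z
      obtain ⟨t, ht⟩ := Pre.pt_eq_iff.1 (Pre.exists_pt z.pt).choose_spec
      conv_rhs => rw [ht, (mem_twistSec_iff.1 g.2).2, chr_zero, one_mul]
    show IsRegular U (fun z : Pre U => g.1 (Pre.exists_pt z.pt).choose)
    rw [this]
    exact g.2.1⟩

theorem descend_pt {U : Opens (Surface δ)} (g : twistSec (0 : ℤ × ℤ) U) (z : Pre U) :
    (descend g).1 z.pt = g.1 z := by
  obtain ⟨t, ht⟩ := Pre.pt_eq_iff.1 (Pre.exists_pt z.pt).choose_spec
  conv_rhs => rw [ht, (mem_twistSec_iff.1 g.2).2, chr_zero, one_mul]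
  rfl

theorem regFun_ext {U : Opens (Surface δ)} {f g : regFun U} (h : ∀ z : Pre U, f.1 z.pt = g.1 z.pt) :
    f = g := by
  refine Subtype.ext (funext fun p => ?_)
  obtain ⟨z, rfl⟩ := Pre.exists_pt p
  exact h z

/-- The value of regular functions at a point. -/
def evalAt {U : Opens (Surface δ)} (p : U) : regFun U →ₐ[ℂ] ℂ :=
  (Pi.evalAlgHom ℂ (fun _ : U => ℂ) p).comp (regFun U).val

theorem aeval_apply {U : Opens (Surface δ)} (c : Fin 4 → regFun U) (P : CoxPoly) (p : U) :
    (MvPolynomial.aeval c P : regFun U).1 p = MvPolynomial.eval (fun k => (c k).1 p) P := by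
  have h : evalAt p (MvPolynomial.aeval c P) =
      MvPolynomial.aeval (fun k => evalAt p (c k)) P := by
    rw [← MvPolynomial.comp_aeval_apply]
  exact h

/-- On a chart a regular function is a fraction of polynomials in the slice coordinates; this chain
rule lets a derivation be computed from its values on those coordinates. -/
theorem derivation_aeval {A : Type*} [CommRing A] [Algebra ℂ A] (D : Derivation ℂ A A)
    (c : Fin 4 → A) (P : CoxPoly) :
    D (MvPolynomial.aeval c P) = ∑ k, D (c k) * MvPolynomial.aeval c (MvPolynomial.pderiv k P) := by
  induction P using MvPolynomial.induction_on with
  | C a => simp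
  | add P Q hP hQ => simp only [map_add, hP, hQ, mul_add, Finset.sum_add_distrib]
  | mul_X P i hP =>
    simp only [map_mul, Derivation.leibniz, hP, MvPolynomial.aeval_X, smul_eq_mul, map_add,
      mul_add, Finset.sum_add_distrib, MvPolynomial.pderiv_X, Pi.single_apply,
      apply_ite (MvPolynomial.aeval c), map_zero, mul_ite, mul_one, mul_zero,
      Finset.sum_ite_eq, Finset.mem_univ, if_true, Finset.mul_sum]
    refine congrArg₂ _ (mul_comm _ _) (Finset.sum_congr rfl fun k _ => by ring)

/-! ### Pointwise lifts of tangent fields -/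

/-- The vector `v` at `z` lifts the value of the tangent field `D` at `π z`. -/
def IsLift {U : Opens (Surface δ)} (D : TangentSec U) (z : Pre U) (v : Fin 4 → ℂ) : Prop :=
  ∀ (V : Opens (Surface δ)) (h : V ≤ U) (f : regFun V) (hz : proj δ z.1 ∈ V),
    HasLineDerivAt ℂ (pullback f.1) ((D.der V h f).1 ⟨proj δ z.1, hz⟩) z.1.1 v

theorem isPushforward_iff {U : Opens (Surface δ)} {v : Pre U → Fin 4 → ℂ} {D : TangentSec U} :
    IsPushforward v D ↔ ∀ z, IsLift D z (v z) :=
  ⟨fun H z V h f hz => H V h f ⟨z.1, hz⟩, fun H V h f z => H (z.incl h) V h f z.2⟩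

/-- Directional derivatives of an arbitrary function are not additive in the direction. Additivity
comes from the relation Q · (f ∘ π) = P, whose differentiated form is linear. -/
theorem IsLift.add {U : Opens (Surface δ)} {D E : TangentSec U} {z : Pre U} {v w : Fin 4 → ℂ}
    (hD : IsLift D z v) (hE : IsLift E z w) : IsLift (D + E) z (v + w) := by
  intro V h f hz
  obtain ⟨P, Q, hQ, hPQ⟩ := isRegular_iff.1 f.2 ⟨z.1, hz⟩
  have h1 := rel_of_hasLineDerivAt hPQ (z := ⟨z.1, hz⟩) (hD V h f hz)
  have h2 := rel_of_hasLineDerivAt hPQ (z := ⟨z.1, hz⟩) (hE V h f hz)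
  refine hasLineDerivAt_of_rel hPQ (z := ⟨z.1, hz⟩) hQ ?_
  rw [dEval_add, dEval_add, ← h1, ← h2, TangentSec.add_der]
  show _ * ((D.der V h f).1 _ + (E.der V h f).1 _) + _ = _
  ring

theorem IsLift.smul {U : Opens (Surface δ)} {D : TangentSec U} {z : Pre U} {v : Fin 4 → ℂ}
    (hD : IsLift D z v) (g : regFun U) : IsLift (g • D) z (g.1 z.pt • v) := by
  intro V h f hz
  obtain ⟨P, Q, hQ, hPQ⟩ := isRegular_iff.1 f.2 ⟨z.1, hz⟩
  have h1 := rel_of_hasLineDerivAt hPQ (z := ⟨z.1, hz⟩) (hD V h f hz)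
  refine hasLineDerivAt_of_rel hPQ (z := ⟨z.1, hz⟩) hQ ?_
  rw [dEval_smul, dEval_smul, ← h1, TangentSec.smul_der]
  show _ * (g.1 z.pt * (D.der V h f).1 _) + _ = _
  ring

theorem IsLift.zero {U : Opens (Surface δ)} (z : Pre U) : IsLift (0 : TangentSec U) z 0 := by
  have h1 : IsLift (0 : TangentSec U) z 0 := by
    intro V h f hz
    have : HasLineDerivAt ℂ (pullback f.1) 0 z.1.1 0 := by
      simpa [HasLineDerivAt] using hasDerivAt_const (0 : ℂ) (pullback f.1 z.1.1)
    exact this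
  exact h1

theorem IsLift.neg {U : Opens (Surface δ)} {D : TangentSec U} {z : Pre U} {v : Fin 4 → ℂ}
    (hD : IsLift D z v) : IsLift (-D) z (-v) := by
  have h := hD.smul (-1)
  rw [neg_one_smul] at h
  convert h using 1
  show -v = (-1 : ℂ) • v
  rw [neg_one_smul]

theorem IsLift.sub {U : Opens (Surface δ)} {D E : TangentSec U} {z : Pre U} {v w : Fin 4 → ℂ}
    (hD : IsLift D z v) (hE : IsLift E z w) : IsLift (D - E) z (v - w) := by
  rw [sub_eq_add_neg, sub_eq_add_neg]
  exact hD.add hE.neg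

theorem isLift_act {U : Opens (Surface δ)} {D : TangentSec U} {z : Pre U} {v : Fin 4 → ℂ}
    (t : ℂˣ × ℂˣ) : IsLift D (z.act t) (act δ t v) ↔ IsLift D z v := by
  have hp : proj δ (z.act t).1 = proj δ z.1 := proj_act t z.1
  constructor
  · intro H V h f hz
    have hz' : proj δ (z.act t).1 ∈ V := by rw [hp]; exact hz
    have h1 := (hasLineDerivAt_pullback_act t).1 (H V h f hz')
    convert h1 using 3
    exact hp.symm
  · intro H V h f hz
    have hz' : proj δ z.1 ∈ V := by rw [← hp]; exact hz
    have h1 := (hasLineDerivAt_pullback_act t).2 (H V h f hz')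
    convert h1 using 3
    rfl

theorem isLift_res {U V : Opens (Surface δ)} (h : V ≤ U) {D : TangentSec U} {z : Pre V}
    {v : Fin 4 → ℂ} : IsLift ((tangentSheaf δ).res h D) z v ↔ IsLift D (z.incl h) v := by
  constructor
  · intro H W hW f hz
    have hz' : proj δ z.1 ∈ W ⊓ V := ⟨hz, z.2⟩
    have h1 := H (W ⊓ V) inf_le_right (resFun inf_le_left f) hz'
    have h2 : D.der (W ⊓ V) (inf_le_right.trans h) (resFun inf_le_left f) =
        resFun inf_le_left (D.der W hW f) := (D.compat W (W ⊓ V) hW inf_le_left f).symm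
    have h3 : ((tangentSheaf δ).res h D : TangentSec V).der (W ⊓ V) inf_le_right =
      D.der (W ⊓ V) (inf_le_right.trans h) := rfl
    rw [h3, h2] at h1
    exact (hasLineDerivAt_restrict inf_le_left f.1 ⟨z.1, hz'⟩).1 h1
  · intro H W hW f hz
    exact H W (hW.trans h) f hz

/-- Uniqueness of derivatives. It reduces every identity between tangent fields to exhibiting one
common vector at each point. -/
theorem TangentSec.ext_lift {U : Opens (Surface δ)} {D E : TangentSec U}
    (H : ∀ z : Pre U, ∃ v, IsLift D z v ∧ IsLift E z v) : D = E := by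
  refine TangentSec.ext' fun V h => Derivation.ext fun f => regFun_ext fun z => ?_
  obtain ⟨v, h1, h2⟩ := H (z.incl h)
  exact (h1 V h f z.2).unique (h2 V h f z.2)

/-! ### Radial vectors -/

/-- The combination `a R₁ + b R₂` of the radial vector fields at `z`. -/
def radial (δ : ℕ) (a b : ℂ) (z : Fin 4 → ℂ) : Fin 4 → ℂ :=
  fun k => ((coxDeg δ k).1 * a + (coxDeg δ k).2 * b) * z k

/-- The curve s ↦ (exp(sa), exp(sb)) · z stays in one orbit and has velocity aR₁ + bR₂ at s = 0.
Since f ∘ π is constant along it, differentiating Q · (f ∘ π) = P there gives the relation with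
derivative 0. -/
theorem isLift_radial {U : Opens (Surface δ)} (z : Pre U) (a b : ℂ) :
    IsLift (0 : TangentSec U) z (radial δ a b z.1.1) := by
  intro V h f hz
  obtain ⟨P, Q, hQ, hPQ⟩ := isRegular_iff.1 f.2 ⟨z.1, hz⟩
  refine hasLineDerivAt_of_rel hPQ (z := ⟨z.1, hz⟩) (l := 0) hQ ?_
  let t : ℂ → ℂˣ × ℂˣ := fun s => (Units.mk0 (Complex.exp (s * a)) (Complex.exp_ne_zero _),
    Units.mk0 (Complex.exp (s * b)) (Complex.exp_ne_zero _))
  have ht : ∀ s k, act δ (t s) z.1.1 k =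
      Complex.exp (s * ((coxDeg δ k).1 * a + (coxDeg δ k).2 * b)) * z.1.1 k := by
    intro s k
    simp only [act_apply, chr, t, Units.val_mul, Units.val_zpow_eq_zpow_val, Units.val_mk0,
      ← Complex.exp_int_mul, ← Complex.exp_add]
    ring_nf
  have hγ : ∀ k, HasDerivAt (fun s => act δ (t s) z.1.1 k) (radial δ a b z.1.1 k) 0 := by
    intro k
    simp only [ht]
    have h1 := (((hasDerivAt_id (0 : ℂ)).mul_const
      ((coxDeg δ k).1 * a + (coxDeg δ k).2 * b : ℂ)).cexp).mul_const (z.1.1 k)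
    simpa [radial] using h1
  have h0 : act δ (t 0) z.1.1 = z.1.1 := by funext k; rw [ht]; simp
  have hP := hasDerivAt_eval P hγ
  have hQ' := (hasDerivAt_eval Q hγ).mul_const (f.1 (Pre.pt ⟨z.1, hz⟩))
  have heq : (fun s => MvPolynomial.eval (act δ (t s) z.1.1) Q * f.1 (Pre.pt ⟨z.1, hz⟩)) =
      fun s => MvPolynomial.eval (act δ (t s) z.1.1) P := by
    funext s
    exact (congrArg (fun p => MvPolynomial.eval (act δ (t s) z.1.1) Q * f.1 p)
      (Pre.act_pt (U := V) (t s) ⟨z.1, hz⟩).symm).trans (hPQ (Pre.act (t s) ⟨z.1, hz⟩))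
  rw [heq] at hQ'
  have := hQ'.unique hP
  rw [h0] at this
  rw [← this]
  simp only [mul_zero, zero_add]
  ring

theorem IsLift.add_radial {U : Opens (Surface δ)} {D : TangentSec U} {z : Pre U}
    {v : Fin 4 → ℂ} (hD : IsLift D z v) (a b : ℂ) : IsLift D z (v + radial δ a b z.1.1) := by
  have := hD.add (isLift_radial z a b)
  rwa [add_zero] at this

theorem radial_sub (a b a' b' : ℂ) (z : Fin 4 → ℂ) :
    radial δ (a - a') (b - b') z = radial δ a b z - radial δ a' b' z := by
  funext k; simp only [radial, Pi.sub_apply]; ring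

theorem radial_zero (a b : ℂ) (z : Fin 4 → ℂ) : radial δ a b z 0 = a * z 0 := by
  simp [radial, coxDeg]

theorem radial_one (a b : ℂ) (z : Fin 4 → ℂ) : radial δ a b z 1 = a * z 1 := by
  simp [radial, coxDeg]

theorem radial_two (a b : ℂ) (z : Fin 4 → ℂ) : radial δ a b z 2 = b * z 2 := by
  simp [radial, coxDeg]

theorem radial_three (a b : ℂ) (z : Fin 4 → ℂ) : radial δ a b z 3 = (b - δ * a) * z 3 := by
  show (((-(δ : ℤ) : ℤ) : ℂ) * a + ((1 : ℤ) : ℂ) * b) * z 3 = _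
  push_cast; ring

/-! ### Charts -/

/-- Two bi-homogeneous polynomials of bi-degrees `(1, 0)` and `(0, 1)`; where they do not vanish,
the torus action has a slice. -/
structure Chart (δ : ℕ) where
  fst : CoxPoly
  snd : CoxPoly
  fst_homogeneous : MvPolynomial.IsWeightedHomogeneous (coxDeg δ) fst (1, 0)
  snd_homogeneous : MvPolynomial.IsWeightedHomogeneous (coxDeg δ) snd (0, 1)

namespace Chart

/-- The domain of a chart. -/
noncomputable def opens (c : Chart δ) : Opens (Surface δ) :=
  basicOpen (c.fst * c.snd) (c.fst_homogeneous.mul c.snd_homogeneous)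

theorem mem_opens (c : Chart δ) {z : Cone} : proj δ z ∈ c.opens ↔
    MvPolynomial.eval z.1 c.fst ≠ 0 ∧ MvPolynomial.eval z.1 c.snd ≠ 0 := by
  rw [opens, proj_mem_basicOpen, map_mul, mul_ne_zero_iff]

/-- The torus element that carries the slice to a given point. -/
noncomputable def tau (c : Chart δ) (z : Pre c.opens) : ℂˣ × ℂˣ :=
  (Units.mk0 (z.eval c.fst) (c.mem_opens.1 z.2).1, Units.mk0 (z.eval c.snd) (c.mem_opens.1 z.2).2)

/-- The generator of `𝒪(d₁, d₂)` on the domain of a chart. -/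
noncomputable def gen (c : Chart δ) (d : ℤ × ℤ) (z : Pre c.opens) : ℂ := chr (c.tau z) d

theorem gen_ne_zero (c : Chart δ) (d : ℤ × ℤ) (z : Pre c.opens) : c.gen d z ≠ 0 :=
  chr_ne_zero _ _

theorem gen_eq (c : Chart δ) (d : ℤ × ℤ) (z : Pre c.opens) :
    c.gen d z = z.eval c.fst ^ d.1 * z.eval c.snd ^ d.2 := by
  simp only [gen, chr, tau, Units.val_mul, Units.val_zpow_eq_zpow_val]
  rfl

theorem gen_mem (c : Chart δ) (d : ℤ × ℤ) : c.gen d ∈ twistSec d c.opens := by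
  have h1 := zpow_mem_twistSec (poly_mem_twistSec c.opens c.fst_homogeneous)
    (fun z => (c.mem_opens.1 z.2).1) d.1
  have h2 := zpow_mem_twistSec (poly_mem_twistSec c.opens c.snd_homogeneous)
    (fun z => (c.mem_opens.1 z.2).2) d.2
  convert mul_mem_twistSec h1 h2 using 1
  · exact congrArg (fun e => twistSec e c.opens) (by ext <;> simp)
  · exact funext fun z => c.gen_eq d z

/-- The coordinates of the point of the slice in a given orbit. -/
noncomputable def coord (c : Chart δ) (k : Fin 4) : regFun c.opens :=
  descend ⟨fun z => c.gen (-coxDeg δ k) z * z.eval (MvPolynomial.X k), by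
    have h := mul_mem_twistSec (c.gen_mem (-coxDeg δ k)) (poly_mem_twistSec c.opens
      (MvPolynomial.isWeightedHomogeneous_X ℂ (coxDeg δ) k))
    rwa [neg_add_cancel] at h⟩

theorem coord_pt (c : Chart δ) (z : Pre c.opens) (k : Fin 4) :
    (c.coord k).1 z.pt = act δ (c.tau z)⁻¹ z.1.1 k := by
  rw [coord, descend_pt, act_apply, chr_inv, ← chr_neg]
  simp [gen, Pre.eval]

/-- The point is moved by τ⁻¹ to the slice where both chart polynomials equal 1. There its
coordinates are the regular functions `coord k`, so the vector of values D(`coord k`) lifts D by the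
chain rule; applying τ carries it back to z. -/
theorem isLift_coord (c : Chart δ) {U : Opens (Surface δ)} (hU : U ≤ c.opens) (D : TangentSec U)
    (z : Pre U) : IsLift D z (act δ (c.tau (z.incl hU))
      fun k => (D.der U le_rfl (resFun hU (c.coord k))).1 z.pt) := by
  set t := c.tau (z.incl hU) with ht
  set w : Fin 4 → ℂ := fun k => (D.der U le_rfl (resFun hU (c.coord k))).1 z.pt with hw
  have hact : ∀ ζ : Pre U, (ζ.act (c.tau (ζ.incl hU))⁻¹).1.1 =
      fun k => (c.coord k).1 (ζ.incl hU).pt := fun ζ => funext fun k => (c.coord_pt _ k).symm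
  suffices h : IsLift D (z.act t⁻¹) w by
    have h2 := (isLift_act t).2 h
    have h3 : (z.act t⁻¹).act t = z := Pre.ext_val (act_act_inv t z.1.1)
    rwa [h3] at h2
  intro V hV f hz
  set y : Pre V := ⟨(z.act t⁻¹).1, hz⟩ with hy
  obtain ⟨P, Q, hQ, hPQ⟩ := isRegular_iff.1 f.2 y
  let cV : Fin 4 → regFun V := fun k => resFun (hV.trans hU) (c.coord k)
  -- The relation Qf = P, evaluated on the slice, becomes an identity of regular functions on the
  -- surface, to which the derivation can be applied.
  have hrel : MvPolynomial.aeval cV Q * f = MvPolynomial.aeval cV P := by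
    refine regFun_ext fun ζ => ?_
    have h1 := hPQ (ζ.act (c.tau (ζ.incl (hV.trans hU)))⁻¹)
    rw [Pre.act_pt] at h1
    have h2 := hact (ζ.incl hV)
    show (MvPolynomial.aeval cV Q : regFun V).1 ζ.pt * f.1 ζ.pt = _
    rw [aeval_apply, aeval_apply]
    simp only [Pre.eval] at h1
    rw [show (ζ.act (c.tau (ζ.incl (hV.trans hU)))⁻¹).1.1 =
      fun k => (cV k).1 ζ.pt from h2] at h1
    exact h1
  have hyz : y.1.1 = fun k => (cV k).1 y.pt := by
    rw [show y.1.1 = (z.act t⁻¹).1.1 from rfl, hact z]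
    funext k
    exact congrArg (c.coord k).1 (Subtype.ext (proj_act t⁻¹ z.1).symm)
  have hD : ∀ k, (D.der V hV (cV k)).1 y.pt = w k := by
    intro k
    have h1 : D.der V hV (cV k) = resFun hV (D.der U le_rfl (resFun hU (c.coord k))) :=
      (D.compat U V le_rfl hV (resFun hU (c.coord k))).symm
    rw [h1]
    exact congrArg (D.der U le_rfl (resFun hU (c.coord k))).1 (Subtype.ext (proj_act t⁻¹ z.1))
  have hval : ∀ R : CoxPoly, (D.der V hV (MvPolynomial.aeval cV R)).1 y.pt = dEval R y.1.1 w := by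
    intro R
    have h1 := congrArg (evalAt y.pt) (derivation_aeval (D.der V hV) cV R)
    rw [map_sum] at h1
    refine Eq.trans h1 (Finset.sum_congr rfl fun k _ => ?_)
    rw [map_mul]
    show (D.der V hV (cV k)).1 y.pt * (MvPolynomial.aeval cV _ : regFun V).1 y.pt = _
    rw [hD, aeval_apply, ← hyz]
  refine hasLineDerivAt_of_rel hPQ (z := y) hQ ?_
  rw [← hval, ← hval, ← hrel, Derivation.leibniz]
  show _ = (MvPolynomial.aeval cV Q : regFun V).1 y.pt * (D.der V hV f).1 y.pt + f.1 y.pt * _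
  rw [aeval_apply, ← hyz]
  rfl

theorem exists_lift (c : Chart δ) {U : Opens (Surface δ)} (hU : U ≤ c.opens) (D : TangentSec U) :
    ∃ v, IsEulerSec U v ∧ IsPushforward v D := by
  refine ⟨fun z => act δ (c.tau (z.incl hU))
      fun k => (D.der U le_rfl (resFun hU (c.coord k))).1 z.pt, fun k => ?_,
    isPushforward_iff.2 (c.isLift_coord hU D)⟩
  have h := mul_mem_twistSec (incl_mem_twistSec hU (c.gen_mem (coxDeg δ k)))
    (pt_mem_twistSec (D.der U le_rfl (resFun hU (c.coord k))))
  rwa [add_zero] at h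

/-- On a chart each coordinate is fst^d₁ · snd^d₂ times a function pulled back from the surface,
where (d₁, d₂) is its bi-degree. A vector killed by dπ does not see the last factor, so v is radial
with coefficients the logarithmic derivatives of fst and snd along v. -/
theorem radial_of_isLift_zero (c : Chart δ) {U : Opens (Surface δ)} (z : Pre U)
    (hz : proj δ z.1 ∈ c.opens) {v : Fin 4 → ℂ} (hv : IsLift (0 : TangentSec U) z v) :
    ∃ a b, v = radial δ a b z.1.1 := by
  have hzV : proj δ z.1 ∈ U ⊓ c.opens := ⟨z.2, hz⟩
  obtain ⟨h1, h2⟩ := c.mem_opens.1 hz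
  refine ⟨dEval c.fst z.1.1 v / z.eval c.fst, dEval c.snd z.1.1 v / z.eval c.snd,
    funext fun k => ?_⟩
  set V := U ⊓ c.opens
  set f : regFun V := resFun inf_le_right (c.coord k) with hf
  have hd : HasLineDerivAt ℂ (pullback f.1) 0 z.1.1 v := hv V inf_le_left f hzV
  have hd1 := (hasDerivAt_eval_line c.fst z.1.1 v)
  have hd2 := (hasDerivAt_eval_line c.snd z.1.1 v)
  have e1 : MvPolynomial.eval (z.1.1 + (0 : ℂ) • v) c.fst ≠ 0 := by simpa using h1
  have e2 : MvPolynomial.eval (z.1.1 + (0 : ℂ) • v) c.snd ≠ 0 := by simpa using h2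
  have g1 := (hasDerivAt_zpow (coxDeg δ k).1 _ (Or.inl e1)).comp (0 : ℂ) hd1
  have g2 := (hasDerivAt_zpow (coxDeg δ k).2 _ (Or.inl e2)).comp (0 : ℂ) hd2
  have g := (g1.mul g2).mul hd
  have gk : HasDerivAt (fun s : ℂ => (z.1.1 + s • v) k) (v k) 0 := by
    simpa using ((hasDerivAt_id (0 : ℂ)).mul_const (v k)).const_add (z.1.1 k)
  have hval : ∀ y : Pre V, y.1.1 k = y.eval c.fst ^ (coxDeg δ k).1 *
      y.eval c.snd ^ (coxDeg δ k).2 * pullback f.1 y.1.1 := by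
    intro y
    rw [pullback_pt]
    have h3 := c.coord_pt (y.incl inf_le_right) k
    rw [act_apply, chr_inv] at h3
    have h4 : f.1 y.pt = (c.coord k).1 (y.incl inf_le_right : Pre c.opens).pt := rfl
    rw [h4, h3]
    have h5 := c.gen_eq (coxDeg δ k) (y.incl inf_le_right)
    have h6 := c.gen_ne_zero (coxDeg δ k) (y.incl inf_le_right)
    simp only [gen] at h5 h6
    rw [h5] at h6 ⊢
    exact (mul_inv_cancel_left₀ h6 _).symm
  have heq : (fun s : ℂ => (z.1.1 + s • v) k) =ᶠ[nhds 0]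
      (((fun x => x ^ (coxDeg δ k).1) ∘ fun s : ℂ => MvPolynomial.eval (z.1.1 + s • v) c.fst) *
      ((fun x => x ^ (coxDeg δ k).2) ∘ fun s : ℂ => MvPolynomial.eval (z.1.1 + s • v) c.snd)) *
      fun s : ℂ => pullback f.1 (z.1.1 + s • v) := by
    filter_upwards [(tendsto_line z.1.1 v).eventually
      (Pre.eventually_mem (⟨z.1, hzV⟩ : Pre V))] with s hs
    obtain ⟨y, hy⟩ := hs
    simp only [Pi.mul_apply, Function.comp]
    rw [← hy]
    exact hval y
  have hu := (g.congr_of_eventuallyEq heq).unique gk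
  rw [← hu, radial]
  have hv0 := hval ⟨z.1, hzV⟩
  simp only [Pi.mul_apply, Function.comp, zero_smul, add_zero, mul_zero]
  simp only [Pre.eval] at hv0 ⊢
  have hp : (⟨z.1, hzV⟩ : Pre V).1.1 = z.1.1 := rfl
  rw [hp] at hv0
  rw [hv0, zpow_sub_one₀ h1, zpow_sub_one₀ h2]
  field_simp

end Chart

/-- The chart in which `Xᵢ` and `Y₀` do not vanish. -/
noncomputable def chartZero (i : Fin 4) (hi : coxDeg δ i = (1, 0)) : Chart δ where
  fst := MvPolynomial.X i
  snd := MvPolynomial.X 2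
  fst_homogeneous := hi ▸ MvPolynomial.isWeightedHomogeneous_X ℂ (coxDeg δ) i
  snd_homogeneous := MvPolynomial.isWeightedHomogeneous_X ℂ (coxDeg δ) 2

/-- The chart in which `Xᵢ` and `Y₁` do not vanish. -/
noncomputable def chartOne (i : Fin 4) (hi : coxDeg δ i = (1, 0)) : Chart δ where
  fst := MvPolynomial.X i
  snd := MvPolynomial.X i ^ δ * MvPolynomial.X 3
  fst_homogeneous := hi ▸ MvPolynomial.isWeightedHomogeneous_X ℂ (coxDeg δ) i
  snd_homogeneous := by
    have h := ((MvPolynomial.isWeightedHomogeneous_X ℂ (coxDeg δ) i).pow δ).mul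
      (MvPolynomial.isWeightedHomogeneous_X ℂ (coxDeg δ) 3)
    rw [hi] at h
    convert h using 1
    simp [coxDeg]

theorem mem_chartZero {i : Fin 4} (hi : coxDeg δ i = (1, 0)) {z : Cone} :
    proj δ z ∈ (chartZero i hi).opens ↔ z.1 i ≠ 0 ∧ z.1 2 ≠ 0 := by
  rw [Chart.mem_opens]; simp [chartZero]

theorem mem_chartOne {i : Fin 4} (hi : coxDeg δ i = (1, 0)) {z : Cone} :
    proj δ z ∈ (chartOne i hi).opens ↔ z.1 i ≠ 0 ∧ z.1 3 ≠ 0 := by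
  rw [Chart.mem_opens]
  simp only [chartOne, map_mul, map_pow, MvPolynomial.eval_X, mul_ne_zero_iff]
  exact ⟨fun h => ⟨h.1, h.2.2⟩, fun h => ⟨h.1, pow_ne_zero _ h.1, h.2⟩⟩

theorem coxDeg_zero : coxDeg δ 0 = (1, 0) := rfl

theorem coxDeg_one : coxDeg δ 1 = (1, 0) := rfl

theorem exists_chart (z : Cone) : ∃ c : Chart δ, proj δ z ∈ c.opens := by
  rcases z.2 with ⟨h1 | h1, h2 | h2⟩
  · exact ⟨chartZero 0 coxDeg_zero, (mem_chartZero _).2 ⟨h1, h2⟩⟩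
  · exact ⟨chartOne 0 coxDeg_zero, (mem_chartOne _).2 ⟨h1, h2⟩⟩
  · exact ⟨chartZero 1 coxDeg_one, (mem_chartZero _).2 ⟨h1, h2⟩⟩
  · exact ⟨chartOne 1 coxDeg_one, (mem_chartOne _).2 ⟨h1, h2⟩⟩

/-- The kernel of `dπ` is spanned by the radial vectors. -/
theorem isLift_zero_iff {U : Opens (Surface δ)} {z : Pre U} {v : Fin 4 → ℂ} :
    IsLift (0 : TangentSec U) z v ↔ ∃ a b, v = radial δ a b z.1.1 := by
  constructor
  · obtain ⟨c, hc⟩ := exists_chart (δ := δ) z.1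
    exact c.radial_of_isLift_zero z hc
  · rintro ⟨a, b, rfl⟩
    exact isLift_radial z a b

theorem exists_isLift {U : Opens (Surface δ)} (D : TangentSec U) (z : Pre U) :
    ∃ v, IsLift D z v := by
  obtain ⟨c, hc⟩ := exists_chart (δ := δ) z.1
  obtain ⟨v, -, hv⟩ := c.exists_lift (U := U ⊓ c.opens) inf_le_right
    ((tangentSheaf δ).res inf_le_left D)
  exact ⟨_, (isLift_res inf_le_left).1 (isPushforward_iff.1 hv ⟨z.1, z.2, hc⟩)⟩

/-! ### Construction of tangent fields -/

theorem pullback_add {V : Opens (Surface δ)} (f g : V → ℂ) (z : Fin 4 → ℂ) :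
    pullback (f + g) z = pullback f z + pullback g z := by
  simp only [pullback]; split_ifs <;> simp

theorem pullback_mul {V : Opens (Surface δ)} (f g : V → ℂ) (z : Fin 4 → ℂ) :
    pullback (f * g) z = pullback f z * pullback g z := by
  simp only [pullback]; split_ifs <;> simp

theorem pullback_smul {V : Opens (Surface δ)} (c : ℂ) (f : V → ℂ) (z : Fin 4 → ℂ) :
    pullback (c • f) z = c * pullback f z := by
  simp only [pullback]; split_ifs <;> simp

/-- Only regularity of the derivatives has to be supplied: linearity, the Leibniz rule and
compatibility with restriction all follow from uniqueness of derivatives. -/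
theorem exists_isPushforward {U : Opens (Surface δ)} (v : Pre U → Fin 4 → ℂ)
    (key : ∀ (W : Opens (Surface δ)) (h : W ≤ U) (f : regFun W), ∃ g : regFun W, ∀ z : Pre W,
      HasLineDerivAt ℂ (pullback f.1) (g.1 z.pt) z.1.1 (v (z.incl h))) :
    ∃ D : TangentSec U, IsPushforward v D := by
  choose G hG using key
  have uniq : ∀ (W : Opens (Surface δ)) (h : W ≤ U) (f g : regFun W), (∀ z : Pre W,
      HasLineDerivAt ℂ (pullback f.1) (g.1 z.pt) z.1.1 (v (z.incl h))) → G W h f = g :=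
    fun W h f g hg => regFun_ext fun z => (hG W h f z).unique (hg z)
  refine ⟨⟨fun W h => Derivation.mk'
    { toFun := G W h
      map_add' := fun f g => uniq W h _ _ fun z => ?_
      map_smul' := fun c f => uniq W h _ _ fun z => ?_ } (fun f g => uniq W h _ _ fun z => ?_),
    fun V W hV hW f => ?_⟩, fun V h f z => hG V h f z⟩
  · have h1 := (hG W h f z).add (hG W h g z)
    have h2 : pullback (f + g : regFun W).1 = fun y => pullback f.1 y + pullback g.1 y :=
      funext (pullback_add f.1 g.1)
    rw [h2]
    exact h1
  · have h1 := HasDerivAt.const_mul c (hG W h f z)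
    have h2 : pullback (c • f : regFun W).1 = fun y => c * pullback f.1 y :=
      funext (pullback_smul c f.1)
    rw [h2]
    exact h1
  · have h1 := HasDerivAt.mul (hG W h f z) (hG W h g z)
    have h2 : pullback (f * g : regFun W).1 = fun y => pullback f.1 y * pullback g.1 y :=
      funext (pullback_mul f.1 g.1)
    rw [h2]
    have h3 : ((f • G W h g + g • G W h f : regFun W)).1 z.pt =
        (G W h f).1 z.pt * pullback g.1 (z.1.1 + (0 : ℂ) • v (z.incl h)) +
        pullback f.1 (z.1.1 + (0 : ℂ) • v (z.incl h)) * (G W h g).1 z.pt := by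
      rw [zero_smul, add_zero, pullback_pt, pullback_pt]
      show f.1 z.pt * (G W h g).1 z.pt + g.1 z.pt * (G W h f).1 z.pt = _
      ring
    show HasLineDerivAt ℂ _ ((f • G W h g + g • G W h f : regFun W).1 z.pt) _ _
    rw [h3]
    exact h1
  · refine (uniq W _ _ _ fun z => ?_).symm
    exact (hasLineDerivAt_restrict hW f.1 z).2 (hG V hV f (z.incl hW))

/-- Tangent fields glue, along with vector fields on the cone that represent them. -/
theorem exists_isPushforward_of_local {U : Opens (Surface δ)} (v : Pre U → Fin 4 → ℂ)
    (H : ∀ z : Pre U, ∃ (V : Opens (Surface δ)) (hV : V ≤ U) (E : TangentSec V),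
      proj δ z.1 ∈ V ∧ IsPushforward (fun w => v (w.incl hV)) E) :
    ∃ D : TangentSec U, IsPushforward v D := by
  refine exists_isPushforward v fun W h f => ?_
  have H' : ∀ p : W, ∃ (V : Opens (Surface δ)) (hV : V ≤ W) (g : regFun V), p.1 ∈ V ∧
      ∀ z : Pre V, HasLineDerivAt ℂ (pullback f.1) (g.1 z.pt) z.1.1 (v (z.incl (hV.trans h))) := by
    intro p
    obtain ⟨z, rfl⟩ := Pre.exists_pt p
    obtain ⟨V, hV, E, hz, hE⟩ := H (z.incl h)
    refine ⟨W ⊓ V, inf_le_left, E.der (W ⊓ V) inf_le_right (resFun inf_le_left f), ⟨z.2, hz⟩,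
      fun w => ?_⟩
    exact (hasLineDerivAt_restrict inf_le_left f.1 w).1 (hE (W ⊓ V) inf_le_right (resFun inf_le_left f) w)
  choose V hV g hp hg using H'
  have hval : ∀ z : Pre W, HasLineDerivAt ℂ (pullback f.1) ((g z.pt).1 ⟨z.pt.1, hp z.pt⟩) z.1.1
      (v (z.incl h)) := fun z => hg z.pt ⟨z.1, hp z.pt⟩
  refine ⟨⟨fun p => (g p).1 ⟨p.1, hp p⟩, ?_⟩, hval⟩
  -- The chosen local derivatives depend on the point, but uniqueness of derivatives identifies them
  -- with a single regular function near z.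
  refine isRegular_of_local fun z => ⟨V z.pt, hV z.pt, hp z.pt, ?_⟩
  have : (fun w : Pre (V z.pt) => (g (w.incl (hV z.pt)).pt).1
      ⟨(w.incl (hV z.pt)).pt.1, hp (w.incl (hV z.pt)).pt⟩) = fun w => (g z.pt).1 w.pt :=
    funext fun w => (hval (w.incl (hV z.pt))).unique (hg z.pt w)
  show IsRegular (V z.pt) (fun w : Pre (V z.pt) => (g (w.incl (hV z.pt)).pt).1
      ⟨(w.incl (hV z.pt)).pt.1, hp (w.incl (hV z.pt)).pt⟩)
  rw [this]
  exact (g z.pt).2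

theorem IsEulerSec.act {U : Opens (Surface δ)} {v : Pre U → Fin 4 → ℂ} (hv : IsEulerSec U v)
    (t : ℂˣ × ℂˣ) (z : Pre U) : v (z.act t) = Hirzebruch.act δ t (v z) :=
  funext fun k => (mem_twistSec_iff.1 (hv k)).2 t z

/-- The map `dπ : ℋ → Θ` of the Euler sequence. -/
theorem IsEulerSec.exists_isPushforward {U : Opens (Surface δ)} {v : Pre U → Fin 4 → ℂ}
    (hv : IsEulerSec U v) : ∃ D : TangentSec U, IsPushforward v D := by
  refine Hirzebruch.exists_isPushforward v fun W h f => ?_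
  have H : ∀ z : Pre W, ∃ l, HasLineDerivAt ℂ (pullback f.1) l z.1.1 (v (z.incl h)) := by
    intro z
    obtain ⟨P, Q, hQ, hPQ⟩ := isRegular_iff.1 f.2 z
    refine ⟨(dEval P z.1.1 (v (z.incl h)) - f.1 z.pt * dEval Q z.1.1 (v (z.incl h))) / z.eval Q,
      hasLineDerivAt_of_rel hPQ hQ ?_⟩
    rw [mul_div_cancel₀ _ hQ]
    ring
  choose g hg using H
  -- The derivative descends to the surface: Q · g = dP(v) - f · dQ(v) shows that it is regular, and
  -- equivariance of v that it is invariant.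
  have hmem : g ∈ twistSec 0 W := by
    refine mem_twistSec_iff.2 ⟨isRegular_of_mul fun z => ?_, fun t z => ?_⟩
    · obtain ⟨P, Q, hQ, hPQ⟩ := isRegular_iff.1 f.2 z
      refine ⟨Q, hQ, ?_⟩
      have h1 : (fun w : Pre W => w.eval Q * g w) = fun w =>
          dEval P w.1.1 (v (w.incl h)) - f.1 w.pt * dEval Q w.1.1 (v (w.incl h)) := by
        funext w
        rw [← rel_of_hasLineDerivAt hPQ (hg w)]
        ring
      have h2 : ∀ R : CoxPoly, IsRegular W (fun w => dEval R w.1.1 (v (w.incl h))) := fun R =>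
        IsRegular.sum _ fun k _ => ((hv k).1.comp_incl h).mul (IsRegular.poly W _)
      rw [h1]
      exact (h2 P).sub (IsRegular.mul f.2 (h2 Q))
    · rw [chr_zero, one_mul]
      have h1 := (hasLineDerivAt_pullback_act t).2 (hg z)
      rw [← hv.act t (z.incl h)] at h1
      exact (hg (z.act t)).unique h1
  exact ⟨descend ⟨g, hmem⟩, fun z => by rw [descend_pt]; exact hg z⟩

theorem IsEulerSec.radial (U : Opens (Surface δ)) (a b : ℂ) :
    IsEulerSec U (fun z => Hirzebruch.radial δ a b z.1.1) := by
  intro k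
  have h := poly_mem_twistSec U ((MvPolynomial.isWeightedHomogeneous_X ℂ (coxDeg δ) k).C_mul
    ((coxDeg δ k).1 * a + (coxDeg δ k).2 * b : ℂ))
  simpa [Pre.eval, Hirzebruch.radial] using h

/-- Every tangent field lifts to a section of `ℋ` near each point. -/
theorem exists_local_lift {U : Opens (Surface δ)} (D : TangentSec U) (z : Pre U) :
    ∃ (V : Opens (Surface δ)) (hV : V ≤ U) (v : Pre V → Fin 4 → ℂ), proj δ z.1 ∈ V ∧
      IsEulerSec V v ∧ IsPushforward v ((tangentSheaf δ).res hV D : TangentSec V) := by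
  obtain ⟨c, hc⟩ := exists_chart (δ := δ) z.1
  obtain ⟨v, h1, h2⟩ := c.exists_lift (U := U ⊓ c.opens) inf_le_right
    ((tangentSheaf δ).res inf_le_left D)
  exact ⟨_, inf_le_left, v, ⟨z.2, hc⟩, h1, h2⟩

theorem IsLift.sub_eq_radial {U : Opens (Surface δ)} {D : TangentSec U} {z : Pre U}
    {v w : Fin 4 → ℂ} (hv : IsLift D z v) (hw : IsLift D z w) :
    ∃ a b, v = w + Hirzebruch.radial δ a b z.1.1 := by
  have h := hv.sub hw
  rw [sub_self] at h
  obtain ⟨a, b, hab⟩ := isLift_zero_iff.1 h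
  exact ⟨a, b, by rw [← hab]; abel⟩

/-! ### Morphisms -/

/-- Composition of morphisms. -/
def compHom {L M N : OMod δ} (Φ : SheafHom M N) (s : SheafHom L M) : SheafHom L N :=
  ⟨fun U => (Φ.1 U).comp (s.1 U), fun U V h m => by
    simp only [LinearMap.comp_apply]
    rw [Φ.2 U V h, s.2 U V h]⟩

theorem compHom_apply {L M N : OMod δ} (Φ : SheafHom M N) (s : SheafHom L M)
    (U : Opens (Surface δ)) (m : L.sec U) : (compHom Φ s).1 U m = Φ.1 U (s.1 U m) := rfl

/-- The identity morphism. -/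
def idHom (M : OMod δ) : SheafHom M M := ⟨fun _ => LinearMap.id, fun _ _ _ _ => rfl⟩

theorem sheafHom_ext {M N : OMod δ} {Φ Ψ : SheafHom M N} (h : ∀ U m, Φ.1 U m = Ψ.1 U m) :
    Φ = Ψ :=
  Subtype.ext (funext fun U => LinearMap.ext fun m => h U m)

/-- The value at a point of a matrix of polynomials, applied to a vector. -/
noncomputable def matAct (A : Matrix (Fin 4) (Fin 4) CoxPoly) (z v : Fin 4 → ℂ) : Fin 4 → ℂ :=
  Matrix.mulVec (A.map (MvPolynomial.eval z)) v

theorem matAct_add (A : Matrix (Fin 4) (Fin 4) CoxPoly) (z v w : Fin 4 → ℂ) :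
    matAct A z (v + w) = matAct A z v + matAct A z w := Matrix.mulVec_add _ _ _

theorem matAct_smul (A : Matrix (Fin 4) (Fin 4) CoxPoly) (z : Fin 4 → ℂ) (c : ℂ)
    (v : Fin 4 → ℂ) : matAct A z (c • v) = c • matAct A z v := Matrix.mulVec_smul _ _ _

theorem add_matAct (A B : Matrix (Fin 4) (Fin 4) CoxPoly) (z v : Fin 4 → ℂ) :
    matAct (A + B) z v = matAct A z v + matAct B z v := by
  rw [matAct, Matrix.map_add _ (map_add _), Matrix.add_mulVec]; rfl

theorem smul_matAct (c : ℂ) (A : Matrix (Fin 4) (Fin 4) CoxPoly) (z v : Fin 4 → ℂ) :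
    matAct (c • A) z v = c • matAct A z v := by
  funext i
  simp [matAct, Matrix.mulVec, dotProduct, Finset.mul_sum, mul_assoc, MvPolynomial.smul_eval]

theorem mul_matAct (A B : Matrix (Fin 4) (Fin 4) CoxPoly) (z v : Fin 4 → ℂ) :
    matAct (A * B) z v = matAct A z (matAct B z v) := by
  rw [matAct, Matrix.map_mul, ← Matrix.mulVec_mulVec]; rfl

theorem matAct_eval (A : Matrix (Fin 4) (Fin 4) CoxPoly) (z : Fin 4 → ℂ) (X : Fin 4 → CoxPoly) :
    matAct A z (fun i => MvPolynomial.eval z (X i)) =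
      fun i => MvPolynomial.eval z (Matrix.mulVec A X i) := by
  funext i
  simp [matAct, Matrix.mulVec, dotProduct]

theorem represents_iff {A : Matrix (Fin 4) (Fin 4) CoxPoly}
    {Φ : SheafHom (tangentSheaf δ) (tangentSheaf δ)} : Represents A Φ ↔
      ∀ (U : Opens (Surface δ)) (v : Pre U → Fin 4 → ℂ) (D : TangentSec U),
        IsEulerSec U v → IsPushforward v D →
          IsEulerSec U (fun z => matAct A z.1.1 (v z)) ∧
          IsPushforward (fun z => matAct A z.1.1 (v z)) (Φ.1 U D) := Iff.rfl

theorem Represents.euler {A : Matrix (Fin 4) (Fin 4) CoxPoly}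
    {Φ : SheafHom (tangentSheaf δ) (tangentSheaf δ)} (h : Represents A Φ)
    {U : Opens (Surface δ)} {v : Pre U → Fin 4 → ℂ} (hv : IsEulerSec U v) :
    IsEulerSec U (fun z => matAct A z.1.1 (v z)) := by
  obtain ⟨D, hD⟩ := hv.exists_isPushforward
  exact (represents_iff.1 h U v D hv hD).1

theorem isLift_res_hom {Φ : SheafHom (tangentSheaf δ) (tangentSheaf δ)}
    {U V : Opens (Surface δ)} (h : V ≤ U) {D : TangentSec U} {z : Pre V} {v : Fin 4 → ℂ} :
    IsLift (Φ.1 V ((tangentSheaf δ).res h D)) z v ↔ IsLift (Φ.1 U D) (z.incl h) v := by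
  rw [← Φ.2 U V h D]
  exact isLift_res h

theorem isPushforward_zero_radial (U : Opens (Surface δ)) (a b : ℂ) :
    IsPushforward (fun z : Pre U => radial δ a b z.1.1) (0 : TangentSec U) :=
  isPushforward_iff.2 fun z => isLift_radial z a b

/-- The radial fields are sections of ℋ over the zero tangent field, and Φ sends zero to zero. -/
theorem Represents.matAct_radial {A : Matrix (Fin 4) (Fin 4) CoxPoly}
    {Φ : SheafHom (tangentSheaf δ) (tangentSheaf δ)} (h : Represents A Φ) (z : Cone) (a b : ℂ) :
    ∃ a' b', matAct A z.1 (radial δ a b z.1) = radial δ a' b' z.1 := by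
  have h1 := (represents_iff.1 h ⊤ _ _ (IsEulerSec.radial ⊤ a b)
    (isPushforward_zero_radial ⊤ a b)).2
  have h0 : Φ.1 ⊤ (0 : TangentSec ⊤) = (0 : TangentSec ⊤) := map_zero (Φ.1 ⊤)
  rw [h0] at h1
  exact isLift_zero_iff.1 (isPushforward_iff.1 h1 ⟨z, trivial⟩)

/-- `Represents` speaks of sections of ℋ. It passes to single vectors because a vector over D z
differs from the value of a local section only by a radial vector, and A preserves those. -/
theorem Represents.isLift {A : Matrix (Fin 4) (Fin 4) CoxPoly}
    {Φ : SheafHom (tangentSheaf δ) (tangentSheaf δ)} (h : Represents A Φ)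
    {U : Opens (Surface δ)} {D : TangentSec U} {z : Pre U} {v : Fin 4 → ℂ} (hv : IsLift D z v) :
    IsLift (Φ.1 U D) z (matAct A z.1.1 v) := by
  obtain ⟨V, hV, w, hz, hw, hw'⟩ := exists_local_lift D z
  have h1 := isPushforward_iff.1 (represents_iff.1 h V w _ hw hw').2 ⟨z.1, hz⟩
  have h2 := (isLift_res_hom hV).1 h1
  have h3 := (isLift_res hV).1 (isPushforward_iff.1 hw' ⟨z.1, hz⟩)
  obtain ⟨a, b, rfl⟩ := IsLift.sub_eq_radial (z := z) hv h3
  obtain ⟨a', b', hab⟩ := h.matAct_radial z.1 a b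
  rw [matAct_add, hab]
  exact IsLift.add_radial (z := z) h2 a' b'

theorem represents_of_isLift {A : Matrix (Fin 4) (Fin 4) CoxPoly}
    {Φ : SheafHom (tangentSheaf δ) (tangentSheaf δ)}
    (hE : ∀ (U : Opens (Surface δ)) (v : Pre U → Fin 4 → ℂ), IsEulerSec U v →
      IsEulerSec U (fun z => matAct A z.1.1 (v z)))
    (h : ∀ (U : Opens (Surface δ)) (D : TangentSec U) (z : Pre U) (v : Fin 4 → ℂ), IsLift D z v →
      IsLift (Φ.1 U D) z (matAct A z.1.1 v)) : Represents A Φ :=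
  represents_iff.2 fun U v D hv hD => ⟨hE U v hv, isPushforward_iff.2 fun z =>
    h U D z (v z) (isPushforward_iff.1 hD z)⟩

theorem Represents.unique {A : Matrix (Fin 4) (Fin 4) CoxPoly}
    {Φ Ψ : SheafHom (tangentSheaf δ) (tangentSheaf δ)} (hΦ : Represents A Φ)
    (hΨ : Represents A Ψ) : Φ = Ψ := by
  refine sheafHom_ext fun U D => TangentSec.ext_lift fun z => ?_
  obtain ⟨v, hv⟩ := exists_isLift D z
  exact ⟨_, hΦ.isLift hv, hΨ.isLift hv⟩

theorem IsEulerSec.add {U : Opens (Surface δ)} {v w : Pre U → Fin 4 → ℂ} (hv : IsEulerSec U v)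
    (hw : IsEulerSec U w) : IsEulerSec U (fun z => v z + w z) :=
  fun k => (twistSec (coxDeg δ k) U).add_mem (hv k) (hw k)

theorem IsEulerSec.smul {U : Opens (Surface δ)} {v : Pre U → Fin 4 → ℂ} (hv : IsEulerSec U v)
    (c : ℂ) : IsEulerSec U (fun z => c • v z) := fun k =>
  mem_twistSec_iff.2 ⟨(IsRegular.const U c).mul (hv k).1, fun t z => by
    have := (mem_twistSec_iff.1 (hv k)).2 t z
    simp only [Pi.smul_apply, smul_eq_mul, this]; ring⟩

theorem IsLift.const_smul {U : Opens (Surface δ)} {D : TangentSec U} {z : Pre U}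
    {v : Fin 4 → ℂ} (hD : IsLift D z v) (c : ℂ) :
    IsLift (algebraMap ℂ (regFun U) c • D) z (c • v) :=
  hD.smul (algebraMap ℂ (regFun U) c)

theorem Represents.add {A B : Matrix (Fin 4) (Fin 4) CoxPoly}
    {Φ Ψ : SheafHom (tangentSheaf δ) (tangentSheaf δ)} (hA : Represents A Φ)
    (hB : Represents B Ψ) : Represents (A + B) (Φ + Ψ) := by
  refine represents_of_isLift (fun U v hv => ?_) fun U D z v hv => ?_
  · simp only [add_matAct]
    exact (hA.euler hv).add (hB.euler hv)
  · rw [add_matAct]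
    exact (hA.isLift hv).add (hB.isLift hv)

theorem Represents.smul {A : Matrix (Fin 4) (Fin 4) CoxPoly}
    {Φ : SheafHom (tangentSheaf δ) (tangentSheaf δ)} (hA : Represents A Φ) (c : ℂ) :
    Represents (c • A) (c • Φ) := by
  refine represents_of_isLift (fun U v hv => ?_) fun U D z v hv => ?_
  · simp only [smul_matAct]
    exact (hA.euler hv).smul c
  · rw [smul_matAct]
    exact (hA.isLift hv).const_smul c

theorem Represents.comp {A B : Matrix (Fin 4) (Fin 4) CoxPoly}
    {Φ Ψ : SheafHom (tangentSheaf δ) (tangentSheaf δ)} (hA : Represents A Φ)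
    (hB : Represents B Ψ) : Represents (A * B) (compHom Φ Ψ) := by
  refine represents_of_isLift (fun U v hv => ?_) fun U D z v hv => ?_
  · simp only [mul_matAct]
    exact hA.euler (hB.euler hv)
  · rw [mul_matAct]
    exact hA.isLift (hB.isLift hv)

theorem represents_one : Represents 1 (idHom (tangentSheaf δ)) := by
  have h : ∀ z v, matAct 1 z v = v := fun z v => by
    rw [matAct, Matrix.map_one _ (map_zero _) (map_one _), Matrix.one_mulVec]
  refine represents_of_isLift (fun U v hv => ?_) fun U D z v hv => ?_
  · simpa only [h] using hv
  · rw [h]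
    exact hv

theorem represents_zero : Represents 0 (0 : SheafHom (tangentSheaf δ) (tangentSheaf δ)) := by
  have h := (represents_one (δ := δ)).smul 0
  rwa [zero_smul, zero_smul] at h

/-- A matrix that preserves `ℋ` and the span of the radial vector fields represents an
endomorphism. -/
theorem exists_represents {A : Matrix (Fin 4) (Fin 4) CoxPoly}
    (hE : ∀ (U : Opens (Surface δ)) (v : Pre U → Fin 4 → ℂ), IsEulerSec U v →
      IsEulerSec U (fun z => matAct A z.1.1 (v z)))
    (hR : ∀ (z : Cone) (a b : ℂ), ∃ a' b', matAct A z.1 (radial δ a b z.1) = radial δ a' b' z.1) :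
    ∃ Φ : SheafHom (tangentSheaf δ) (tangentSheaf δ), Represents A Φ := by
  have H : ∀ (U : Opens (Surface δ)) (D : TangentSec U), ∃ E : TangentSec U,
      ∀ (z : Pre U) (v : Fin 4 → ℂ), IsLift D z v → IsLift E z (matAct A z.1.1 v) := by
    intro U D
    -- The lifts are chosen point by point without any regularity. Near each point they differ from
    -- a regular lift w by radial vectors, and A keeps these radial, so Av and Aw push forward to
    -- the same field.
    choose v hv using exists_isLift D
    obtain ⟨E, hEv⟩ := exists_isPushforward_of_local (fun z => matAct A z.1.1 (v z)) (by
      intro z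
      obtain ⟨V, hV, w, hz, hw, hw'⟩ := exists_local_lift D z
      obtain ⟨E, hEw⟩ := (hE V w hw).exists_isPushforward
      refine ⟨V, hV, E, hz, isPushforward_iff.2 fun y => ?_⟩
      obtain ⟨a, b, hab⟩ := ((isLift_res hV).2 (hv (y.incl hV))).sub_eq_radial
        (isPushforward_iff.1 hw' y)
      obtain ⟨a', b', hab'⟩ := hR y.1 a b
      rw [hab, matAct_add]
      show IsLift E y (matAct A y.1.1 (w y) + matAct A y.1.1 (radial δ a b y.1.1))
      rw [hab']
      exact (isPushforward_iff.1 hEw y).add_radial a' b')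
    refine ⟨E, fun z w hw => ?_⟩
    obtain ⟨a, b, rfl⟩ := hw.sub_eq_radial (hv z)
    obtain ⟨a', b', hab'⟩ := hR z.1 a b
    rw [matAct_add, hab']
    exact (isPushforward_iff.1 hEv z).add_radial a' b'
  choose F hF using H
  refine ⟨⟨fun U =>
    { toFun := F U
      map_add' := fun D E => TangentSec.ext_lift fun z => ?_
      map_smul' := fun f D => TangentSec.ext_lift fun z => ?_ },
    fun U V h D => TangentSec.ext_lift fun z => ?_⟩, represents_of_isLift hE fun U D => hF U D⟩
  · obtain ⟨v, hv⟩ := exists_isLift D z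
    obtain ⟨w, hw⟩ := exists_isLift E z
    refine ⟨_, hF U _ z _ (hv.add hw), ?_⟩
    rw [matAct_add]
    exact (hF U D z v hv).add (hF U E z w hw)
  · obtain ⟨v, hv⟩ := exists_isLift D z
    refine ⟨_, hF U _ z _ (hv.smul f), ?_⟩
    rw [matAct_smul]
    exact (hF U D z v hv).smul f
  · obtain ⟨v, hv⟩ := exists_isLift D (z.incl h)
    exact ⟨_, (isLift_res h).2 (hF U D (z.incl h) v hv), hF V _ z v ((isLift_res h).2 hv)⟩

/-! ### Sections as Laurent polynomials -/

theorem poly_eq_zero_of_dense {h P : CoxPoly} (hh : h ≠ 0)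
    (H : ∀ z : Fin 4 → ℂ, MvPolynomial.eval z h ≠ 0 → MvPolynomial.eval z P = 0) : P = 0 := by
  have h1 : h * P = 0 := by
    refine MvPolynomial.funext fun z => ?_
    by_cases hz : MvPolynomial.eval z h = 0
    · simp [hz]
    · simp [H z hz]
  exact (mul_eq_zero.1 h1).resolve_left hh

theorem poly_eq_of_dense {h P Q : CoxPoly} (hh : h ≠ 0)
    (H : ∀ z : Fin 4 → ℂ, MvPolynomial.eval z h ≠ 0 →
      MvPolynomial.eval z P = MvPolynomial.eval z Q) : P = Q :=
  sub_eq_zero.1 (poly_eq_zero_of_dense hh fun z hz => by rw [map_sub, H z hz, sub_self])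

theorem poly_eq_zero_of_cone {P : CoxPoly} (H : ∀ z : Cone, MvPolynomial.eval z.1 P = 0) :
    P = 0 := by
  refine poly_eq_zero_of_dense (h := MvPolynomial.X 0 * MvPolynomial.X 2)
    (mul_ne_zero (MvPolynomial.X_ne_zero _) (MvPolynomial.X_ne_zero _)) fun z hz => ?_
  simp only [map_mul, MvPolynomial.eval_X, mul_ne_zero_iff] at hz
  exact H ⟨z, Or.inl hz.1, Or.inl hz.2⟩

/-- For fixed t, the polynomial with coefficients (χ_wt(m)(t) - χ_d(t)) · c_m vanishes on a dense
set, hence is zero. Every weight that occurs thus has the same character as d, so it equals d. -/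
theorem isWeightedHomogeneous_of_eval {h P : CoxPoly} (hh : h ≠ 0) {d : ℤ × ℤ}
    (H : ∀ (t : ℂˣ × ℂˣ) (z : Fin 4 → ℂ), MvPolynomial.eval z h ≠ 0 →
      MvPolynomial.eval (act δ t z) P = chr t d * MvPolynomial.eval z P) :
    MvPolynomial.IsWeightedHomogeneous (coxDeg δ) P d := by
  intro m hm
  refine chr_injective fun t => ?_
  have h1 : (∑ m ∈ P.support, MvPolynomial.monomial m
      ((chr t (Finsupp.weight (coxDeg δ) m) - chr t d) * P.coeff m) : CoxPoly) = 0 := by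
    refine poly_eq_zero_of_dense hh fun z hz => ?_
    have h2 := H t z hz
    rw [eval_act, MvPolynomial.eval_eq', Finset.mul_sum, ← sub_eq_zero,
      ← Finset.sum_sub_distrib] at h2
    rw [map_sum, ← h2]
    refine Finset.sum_congr rfl fun m _ => ?_
    rw [MvPolynomial.eval_monomial, Finsupp.prod_fintype _ _ (by simp)]
    ring
  have h2 := congrArg (MvPolynomial.coeff m) h1
  rw [MvPolynomial.coeff_sum, Finset.sum_eq_single m] at h2
  · rw [MvPolynomial.coeff_monomial, if_pos rfl, MvPolynomial.coeff_zero] at h2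
    exact sub_eq_zero.1 ((mul_eq_zero.1 h2).resolve_right hm)
  · intro b _ hb
    rw [MvPolynomial.coeff_monomial, if_neg hb]
  · intro hm'
    exact absurd (MvPolynomial.mem_support_iff.2 hm) hm'

/-- The denominators of a function. -/
def denominators {U : Opens (Surface δ)} (g : Pre U → ℂ) : Ideal CoxPoly where
  carrier := {Q | ∃ P : CoxPoly, ∀ w : Pre U, w.eval Q * g w = w.eval P}
  add_mem' := by
    rintro Q Q' ⟨P, h⟩ ⟨P', h'⟩
    refine ⟨P + P', fun w => ?_⟩
    have h1 := h w
    have h2 := h' w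
    simp only [Pre.eval, map_add] at h1 h2 ⊢
    rw [add_mul, h1, h2]
  zero_mem' := ⟨0, fun w => by simp [Pre.eval]⟩
  smul_mem' := by
    rintro R Q ⟨P, h⟩
    refine ⟨R * P, fun w => ?_⟩
    have h1 := h w
    simp only [Pre.eval, smul_eq_mul, map_mul] at h1 ⊢
    rw [mul_assoc, h1]

/-- Regular functions on a principal open set are fractions with denominator a power. -/
theorem pow_mem_denominators {U : Opens (Surface δ)} {g : Pre U → ℂ} (hg : IsRegular U g)
    {h : CoxPoly} (hh : ∀ z : Fin 4 → ℂ, MvPolynomial.eval z h ≠ 0 → ∃ w : Pre U, w.1.1 = z) :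
    ∃ n₀, ∀ n ≥ n₀, h ^ n ∈ denominators g := by
  -- By the Nullstellensatz it suffices that h vanishes at the common zeros of the denominators, and
  -- regularity provides a nonzero denominator at each point where h ≠ 0.
  have h1 : h ∈ (denominators g).radical := by
    rw [← MvPolynomial.vanishingIdeal_zeroLocus_eq_radical (K := ℂ),
      MvPolynomial.mem_vanishingIdeal_iff]
    intro z hz
    by_contra h0
    obtain ⟨w, rfl⟩ := hh z h0
    obtain ⟨P, Q, hQ, hPQ⟩ := isRegular_iff.1 hg w
    exact hQ (hz Q ⟨P, hPQ⟩)
  obtain ⟨n, hn⟩ := h1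
  refine ⟨n, fun m hm => ?_⟩
  rw [← Nat.sub_add_cancel hm, pow_add]
  exact (denominators g).mul_mem_left _ hn

theorem isWeightedHomogeneous_numerator {U : Opens (Surface δ)} {d e : ℤ × ℤ} {g : Pre U → ℂ}
    (hg : g ∈ twistSec d U) {h P Q : CoxPoly} (h0 : h ≠ 0)
    (hh : ∀ z : Fin 4 → ℂ, MvPolynomial.eval z h ≠ 0 → ∃ w : Pre U, w.1.1 = z)
    (hQ : MvPolynomial.IsWeightedHomogeneous (coxDeg δ) Q e)
    (hP : ∀ w : Pre U, w.eval Q * g w = w.eval P) :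
    MvPolynomial.IsWeightedHomogeneous (coxDeg δ) P (e + d) := by
  refine isWeightedHomogeneous_of_eval h0 fun t z hz => ?_
  obtain ⟨w, rfl⟩ := hh z hz
  have h1 := hP (w.act t)
  rw [(mem_twistSec_iff.1 hg).2] at h1
  have h2 : (w.act t).eval Q = chr t e * w.eval Q := eval_act_of_homogeneous hQ t w.1.1
  rw [h2] at h1
  refine h1.symm.trans ?_
  show _ = _ * w.eval P
  rw [← hP w, chr_add]
  ring

/-- Removing superfluous denominators. -/
theorem mem_denominators_of_two {U : Opens (Surface δ)} {g : Pre U → ℂ} {h B : CoxPoly}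
    (h0 : h ≠ 0) (hh : ∀ z : Fin 4 → ℂ, MvPolynomial.eval z h ≠ 0 → ∃ w : Pre U, w.1.1 = z)
    {a b : Fin 4} (hab : a ≠ b) (hU : ∀ w : Pre U, w.1.1 a ≠ 0 ∨ w.1.1 b ≠ 0) {m n : ℕ}
    (h1 : B * MvPolynomial.X a ^ m ∈ denominators g)
    (h2 : B * MvPolynomial.X b ^ n ∈ denominators g) : B ∈ denominators g := by
  obtain ⟨P, hP⟩ := h1
  obtain ⟨Q, hQ⟩ := h2
  have e1 : MvPolynomial.X b ^ n * P = MvPolynomial.X a ^ m * Q := by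
    refine poly_eq_of_dense h0 fun z hz => ?_
    obtain ⟨w, rfl⟩ := hh z hz
    have h3 := hP w
    have h4 := hQ w
    simp only [Pre.eval, map_mul, map_pow, MvPolynomial.eval_X] at h3 h4 ⊢
    rw [← h3, ← h4]; ring
  have hp : Prime (MvPolynomial.X a : CoxPoly) := MvPolynomial.X_prime
  -- X_a is prime and does not divide a power of X_b, so the power of X_a in the denominator divides
  -- its own numerator.
  have hdvd : (MvPolynomial.X a : CoxPoly) ^ m ∣ P := by
    refine hp.pow_dvd_of_dvd_mul_left m (fun hd => hab ?_) ⟨Q, e1⟩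
    exact MvPolynomial.X_dvd_X.1 (hp.dvd_of_dvd_pow hd)
  obtain ⟨R, rfl⟩ := hdvd
  refine ⟨R, fun w => ?_⟩
  have h3 := hP w
  have h4 := hQ w
  have h5 := congrArg (MvPolynomial.eval w.1.1) e1
  simp only [Pre.eval, map_mul, map_pow, MvPolynomial.eval_X] at h3 h4 h5 ⊢
  -- Where X_a ≠ 0 the power of X_a cancels; where X_a = 0, X_b is nonzero and the other
  -- presentation of g is used.
  rcases hU w with hw | hw
  · refine mul_left_cancel₀ (pow_ne_zero m hw) ?_
    rw [← h3]; ring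
  · by_cases ha : w.1.1 a = 0
    · have h6 : MvPolynomial.X b ^ n * R = Q := by
        refine mul_left_cancel₀ (pow_ne_zero m (MvPolynomial.X_ne_zero a)) ?_
        rw [← e1]; ring
      refine mul_left_cancel₀ (pow_ne_zero n hw) ?_
      have h7 := congrArg (MvPolynomial.eval w.1.1) h6
      simp only [map_mul, map_pow, MvPolynomial.eval_X] at h7
      rw [h7, ← h4]; ring
    · refine mul_left_cancel₀ (pow_ne_zero m ha) ?_
      rw [← h3]; ring

/-! ### Splitting of cocycles -/

theorem weight_coxDeg (m : Fin 4 →₀ ℕ) : Finsupp.weight (coxDeg δ) m =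
    ((m 0 : ℤ) + m 1 - δ * m 3, (m 2 : ℤ) + m 3) := by
  rw [Finsupp.weight_apply, Finsupp.sum_fintype _ _ (by simp), Fin.sum_univ_four]
  ext
  · simp [coxDeg]; ring
  · simp [coxDeg]

/-- Monomials divisible by X_aⁿ go to the first summand, the remaining ones to the second;
homogeneity survives because it is a condition on single monomials. -/
theorem exists_split_poly {P : CoxPoly} {D : ℤ × ℤ} {a b : Fin 4} {n : ℕ}
    (hP : MvPolynomial.IsWeightedHomogeneous (coxDeg δ) P D)
    (hs : ∀ m ∈ P.support, n ≤ m a ∨ n ≤ m b) :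
    ∃ Q R : CoxPoly, P = MvPolynomial.X a ^ n * Q + MvPolynomial.X b ^ n * R ∧
      MvPolynomial.IsWeightedHomogeneous (coxDeg δ) Q (D - n • coxDeg δ a) ∧
      MvPolynomial.IsWeightedHomogeneous (coxDeg δ) R (D - n • coxDeg δ b) := by
  classical
  have key : ∀ (c : Fin 4) (s : Finset (Fin 4 →₀ ℕ)), s ⊆ P.support → (∀ m ∈ s, n ≤ m c) →
      ∃ Q : CoxPoly, ∑ m ∈ s, MvPolynomial.monomial m (P.coeff m) = MvPolynomial.X c ^ n * Q ∧
        MvPolynomial.IsWeightedHomogeneous (coxDeg δ) Q (D - n • coxDeg δ c) := by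
    intro c s hsP hsc
    refine ⟨∑ m ∈ s, MvPolynomial.monomial (m - Finsupp.single c n) (P.coeff m), ?_, ?_⟩
    · rw [Finset.mul_sum]
      refine Finset.sum_congr rfl fun m hm => ?_
      rw [MvPolynomial.X_pow_eq_monomial, MvPolynomial.monomial_mul, one_mul,
        add_tsub_cancel_of_le]
      simpa using hsc m hm
    · refine MvPolynomial.IsWeightedHomogeneous.sum _ _ _ fun m hm => ?_
      refine MvPolynomial.isWeightedHomogeneous_monomial _ _ _ ?_
      have h1 := hP (MvPolynomial.mem_support_iff.1 (hsP hm))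
      have h2 : m - Finsupp.single c n + Finsupp.single c n = m :=
        tsub_add_cancel_of_le (by simpa using hsc m hm)
      rw [← h2, map_add, Finsupp.weight_single] at h1
      exact eq_sub_of_add_eq h1
  obtain ⟨Q, hQ, hQ'⟩ := key a (P.support.filter fun m => n ≤ m a) (Finset.filter_subset _ _)
    fun m hm => (Finset.mem_filter.1 hm).2
  obtain ⟨R, hR, hR'⟩ := key b (P.support.filter fun m => ¬n ≤ m a) (Finset.filter_subset _ _)
    fun m hm => (hs m (Finset.mem_filter.1 hm).1).resolve_left (Finset.mem_filter.1 hm).2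
  refine ⟨Q, R, ?_, hQ', hR'⟩
  rw [← hQ, ← hR, Finset.sum_filter_add_sum_filter_not]
  exact P.as_sum

theorem div_mem_twistSec {d e : ℤ × ℤ} {U : Opens (Surface δ)} {P Q : CoxPoly}
    (hP : MvPolynomial.IsWeightedHomogeneous (coxDeg δ) P d)
    (hQ : MvPolynomial.IsWeightedHomogeneous (coxDeg δ) Q e) (h0 : ∀ z : Pre U, z.eval Q ≠ 0) :
    (fun z : Pre U => z.eval P / z.eval Q) ∈ twistSec (d - e) U := by
  have h := mul_mem_twistSec (poly_mem_twistSec U hP) (inv_mem_twistSec (poly_mem_twistSec U hQ) h0)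
  simpa only [div_eq_mul_inv, sub_eq_add_neg] using h

/-- A Čech cocycle for two open sets as a Laurent polynomial over B. The hypothesis on the support
excludes monomials with negative exponents in both X_a and X_b, which are the ones that could give
cohomology. -/
theorem exists_split {d e : ℤ × ℤ} {U₁ U₂ : Opens (Surface δ)} {g : Pre (U₁ ⊓ U₂) → ℂ}
    {B P : CoxPoly} {a b : Fin 4} {n : ℕ}
    (hB : MvPolynomial.IsWeightedHomogeneous (coxDeg δ) B e)
    (h1 : ∀ w : Pre U₁, w.eval B ≠ 0 ∧ w.1.1 a ≠ 0)
    (h2 : ∀ w : Pre U₂, w.eval B ≠ 0 ∧ w.1.1 b ≠ 0)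
    (hP : MvPolynomial.IsWeightedHomogeneous (coxDeg δ) P
      (e + n • coxDeg δ a + n • coxDeg δ b + d))
    (hg : ∀ w : Pre (U₁ ⊓ U₂),
      w.eval (B * MvPolynomial.X a ^ n * MvPolynomial.X b ^ n) * g w = w.eval P)
    (hs : ∀ m ∈ P.support, n ≤ m a ∨ n ≤ m b) :
    ∃ g₁ ∈ twistSec d U₁, ∃ g₂ ∈ twistSec d U₂, ∀ z : Pre (U₁ ⊓ U₂),
      g z = g₁ (z.incl inf_le_left) - g₂ (z.incl inf_le_right) := by
  obtain ⟨Q, R, hQR, hQ, hR⟩ := exists_split_poly hP hs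
  have hBa := hB.mul ((MvPolynomial.isWeightedHomogeneous_X ℂ (coxDeg δ) a).pow n)
  have hBb := hB.mul ((MvPolynomial.isWeightedHomogeneous_X ℂ (coxDeg δ) b).pow n)
  have n1 : ∀ w : Pre U₁, w.eval (B * MvPolynomial.X a ^ n) ≠ 0 := fun w => by
    have := h1 w
    simp only [Pre.eval, map_mul, map_pow, MvPolynomial.eval_X] at this ⊢
    exact mul_ne_zero this.1 (pow_ne_zero _ this.2)
  have n2 : ∀ w : Pre U₂, w.eval (B * MvPolynomial.X b ^ n) ≠ 0 := fun w => by
    have := h2 w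
    simp only [Pre.eval, map_mul, map_pow, MvPolynomial.eval_X] at this ⊢
    exact mul_ne_zero this.1 (pow_ne_zero _ this.2)
  -- The two parts are R/(B X_aⁿ) and Q/(B X_bⁿ); the second changes sign because the coboundary is
  -- a difference.
  have m1 := div_mem_twistSec hR hBa n1
  have m2 := div_mem_twistSec hQ.neg hBb n2
  rw [show e + n • coxDeg δ a + n • coxDeg δ b + d - n • coxDeg δ b - (e + n • coxDeg δ a) = d by
    abel] at m1
  rw [show e + n • coxDeg δ a + n • coxDeg δ b + d - n • coxDeg δ a - (e + n • coxDeg δ b) = d by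
    abel] at m2
  refine ⟨_, m1, _, m2, fun z => ?_⟩
  have h3 := hg z
  have h4 := n1 (z.incl inf_le_left)
  have h5 := n2 (z.incl inf_le_right)
  rw [hQR] at h3
  simp only [Pre.eval, Pre.incl, map_mul, map_pow, map_add, map_neg, MvPolynomial.eval_X]
    at h3 h4 h5 ⊢
  obtain ⟨hb, ha⟩ := mul_ne_zero_iff.1 h4
  obtain ⟨-, hc⟩ := mul_ne_zero_iff.1 h5
  rw [neg_div, sub_neg_eq_add, div_add_div _ _ h4 h5, eq_div_iff (mul_ne_zero h4 h5)]
  refine mul_left_cancel₀ hb ?_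
  linear_combination (MvPolynomial.eval z.1.1 B) ^ 2 * h3

/-- The open set where `Xᵢ` does not vanish. -/
noncomputable def coordOpen (δ : ℕ) (i : Fin 4) : Opens (Surface δ) :=
  basicOpen (MvPolynomial.X i) (MvPolynomial.isWeightedHomogeneous_X ℂ (coxDeg δ) i)

theorem mem_coordOpen {i : Fin 4} {z : Cone} : proj δ z ∈ coordOpen δ i ↔ z.1 i ≠ 0 := by
  rw [coordOpen, proj_mem_basicOpen, MvPolynomial.eval_X]

/-- Vanishing of the first cohomology along the fibres. -/
theorem exists_split_fibre {i : Fin 4} (hi : coxDeg δ i = (1, 0)) (hi' : i = 0 ∨ i = 1) {d : ℤ × ℤ}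
    (hd : -1 ≤ d.2) (g : Pre ((chartZero i hi).opens ⊓ (chartOne i hi).opens) → ℂ)
    (hg : g ∈ twistSec d ((chartZero i hi).opens ⊓ (chartOne i hi).opens)) :
    ∃ g₁ ∈ twistSec d (chartZero i hi).opens, ∃ g₂ ∈ twistSec d (chartOne i hi).opens,
      ∀ z : Pre ((chartZero i hi).opens ⊓ (chartOne i hi).opens),
        g z = g₁ (z.incl inf_le_left) - g₂ (z.incl inf_le_right) := by
  set h : CoxPoly := MvPolynomial.X i * MvPolynomial.X 2 * MvPolynomial.X 3 with hh
  have h0 : h ≠ 0 := mul_ne_zero (mul_ne_zero (MvPolynomial.X_ne_zero _)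
    (MvPolynomial.X_ne_zero _)) (MvPolynomial.X_ne_zero _)
  have hU : ∀ z : Fin 4 → ℂ, MvPolynomial.eval z h ≠ 0 →
      ∃ w : Pre ((chartZero i hi).opens ⊓ (chartOne i hi).opens), w.1.1 = z := by
    intro z hz
    simp only [hh, map_mul, MvPolynomial.eval_X, mul_ne_zero_iff] at hz
    have hc : (z 0 ≠ 0 ∨ z 1 ≠ 0) ∧ (z 2 ≠ 0 ∨ z 3 ≠ 0) := by
      refine ⟨?_, Or.inl hz.1.2⟩
      rcases hi' with rfl | rfl
      · exact Or.inl hz.1.1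
      · exact Or.inr hz.1.1
    exact ⟨⟨⟨z, hc⟩, (mem_chartZero hi).2 hz.1, (mem_chartOne hi).2 ⟨hz.1.1, hz.2⟩⟩, rfl⟩
  obtain ⟨n, hn⟩ := pow_mem_denominators hg.1 hU
  obtain ⟨P, hP⟩ := hn n le_rfl
  have hB := (MvPolynomial.isWeightedHomogeneous_X ℂ (coxDeg δ) i).pow n
  rw [hh, mul_pow, mul_pow] at hP
  have hP' := isWeightedHomogeneous_numerator hg h0 hU
    ((hB.mul ((MvPolynomial.isWeightedHomogeneous_X ℂ (coxDeg δ) 2).pow n)).mul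
      ((MvPolynomial.isWeightedHomogeneous_X ℂ (coxDeg δ) 3).pow n)) hP
  refine exists_split hB (fun w => ?_) (fun w => ?_) hP' hP fun m hm => ?_
  · have := (mem_chartZero hi).1 w.2
    exact ⟨by simpa [Pre.eval] using fun h => absurd h this.1, this.2⟩
  · have := (mem_chartOne hi).1 w.2
    exact ⟨by simpa [Pre.eval] using fun h => absurd h this.1, this.2⟩
  · have h1 := congrArg Prod.snd (hP' (MvPolynomial.mem_support_iff.1 hm))
    rw [weight_coxDeg] at h1
    simp only [hi, Prod.snd_add, Prod.smul_snd] at h1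
    simp [coxDeg] at h1
    omega

theorem coordOpen_dense : ∀ z : Fin 4 → ℂ,
    MvPolynomial.eval z (MvPolynomial.X 0 * MvPolynomial.X 1 * MvPolynomial.X 2 : CoxPoly) ≠ 0 →
      ∃ w : Pre (coordOpen δ 0 ⊓ coordOpen δ 1), w.1.1 = z := by
  intro z hz
  simp only [map_mul, MvPolynomial.eval_X, mul_ne_zero_iff] at hz
  exact ⟨⟨⟨z, Or.inl hz.1.1, Or.inl hz.2⟩, mem_coordOpen.2 hz.1.1, mem_coordOpen.2 hz.1.2⟩, rfl⟩

/-- Vanishing of the first cohomology along the base. -/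
theorem exists_split_base {d : ℤ × ℤ} (hd : -1 ≤ d.1)
    (g : Pre (coordOpen δ 0 ⊓ coordOpen δ 1) → ℂ)
    (hg : g ∈ twistSec d (coordOpen δ 0 ⊓ coordOpen δ 1)) :
    ∃ g₁ ∈ twistSec d (coordOpen δ 0), ∃ g₂ ∈ twistSec d (coordOpen δ 1),
      ∀ z : Pre (coordOpen δ 0 ⊓ coordOpen δ 1),
        g z = g₁ (z.incl inf_le_left) - g₂ (z.incl inf_le_right) := by
  have h0 : (MvPolynomial.X 0 * MvPolynomial.X 1 * MvPolynomial.X 2 : CoxPoly) ≠ 0 :=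
    mul_ne_zero (mul_ne_zero (MvPolynomial.X_ne_zero _)
      (MvPolynomial.X_ne_zero _)) (MvPolynomial.X_ne_zero _)
  have hU3 : ∀ z : Fin 4 → ℂ,
      MvPolynomial.eval z (MvPolynomial.X 0 * MvPolynomial.X 1 * MvPolynomial.X 3 : CoxPoly) ≠ 0 →
      ∃ w : Pre (coordOpen δ 0 ⊓ coordOpen δ 1), w.1.1 = z := by
    intro z hz
    simp only [map_mul, MvPolynomial.eval_X, mul_ne_zero_iff] at hz
    exact ⟨⟨⟨z, Or.inl hz.1.1, Or.inr hz.2⟩, mem_coordOpen.2 hz.1.1, mem_coordOpen.2 hz.1.2⟩, rfl⟩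
  obtain ⟨n₁, hn₁⟩ := pow_mem_denominators hg.1 coordOpen_dense
  obtain ⟨n₂, hn₂⟩ := pow_mem_denominators hg.1 hU3
  have e1 := hn₁ (max n₁ n₂) (le_max_left _ _)
  have e2 := hn₂ (max n₁ n₂) (le_max_right _ _)
  set n := max n₁ n₂
  rw [mul_pow] at e1 e2
  obtain ⟨P, hP⟩ := mem_denominators_of_two h0 coordOpen_dense (show (2 : Fin 4) ≠ 3 by decide)
    (fun w => w.1.2.2) e1 e2
  have hB := MvPolynomial.isWeightedHomogeneous_one ℂ (coxDeg δ)
  rw [mul_pow, ← one_mul (MvPolynomial.X 0 ^ n)] at hP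
  have hP' := isWeightedHomogeneous_numerator hg h0 coordOpen_dense
    ((hB.mul ((MvPolynomial.isWeightedHomogeneous_X ℂ (coxDeg δ) 0).pow n)).mul
      ((MvPolynomial.isWeightedHomogeneous_X ℂ (coxDeg δ) 1).pow n)) hP
  refine exists_split hB (fun w => ?_) (fun w => ?_) hP' hP fun m hm => ?_
  · exact ⟨by simp [Pre.eval], mem_coordOpen.1 w.2⟩
  · exact ⟨by simp [Pre.eval], mem_coordOpen.1 w.2⟩
  · have h1 := congrArg Prod.fst (hP' (MvPolynomial.mem_support_iff.1 hm))
    rw [weight_coxDeg] at h1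
    simp [coxDeg] at h1
    have h2 : 0 ≤ (δ : ℤ) * m 3 := by positivity
    omega

/-- The global sections of `𝒪(d₁, d₂)` are the bi-homogeneous polynomials. -/
theorem exists_poly_of_global {d : ℤ × ℤ} {g : Pre (⊤ : Opens (Surface δ)) → ℂ}
    (hg : g ∈ twistSec d ⊤) : ∃ P : CoxPoly,
      MvPolynomial.IsWeightedHomogeneous (coxDeg δ) P d ∧ ∀ w, g w = w.eval P := by
  have hU : ∀ i j : Fin 4, (i = 0 ∨ i = 1) → (j = 2 ∨ j = 3) → ∀ z : Fin 4 → ℂ,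
      MvPolynomial.eval z (MvPolynomial.X i * MvPolynomial.X j : CoxPoly) ≠ 0 →
      ∃ w : Pre (⊤ : Opens (Surface δ)), w.1.1 = z := by
    intro i j hi hj z hz
    simp only [map_mul, MvPolynomial.eval_X, mul_ne_zero_iff] at hz
    refine ⟨⟨⟨z, ?_, ?_⟩, trivial⟩, rfl⟩
    · rcases hi with rfl | rfl
      · exact Or.inl hz.1
      · exact Or.inr hz.1
    · rcases hj with rfl | rfl
      · exact Or.inl hz.2
      · exact Or.inr hz.2
  have h0 : (MvPolynomial.X 0 * MvPolynomial.X 2 : CoxPoly) ≠ 0 :=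
    mul_ne_zero (MvPolynomial.X_ne_zero _) (MvPolynomial.X_ne_zero _)
  have hU0 := hU 0 2 (Or.inl rfl) (Or.inl rfl)
  have key : ∀ i : Fin 4, (i = 0 ∨ i = 1) → ∃ n, MvPolynomial.X i ^ n ∈ denominators g := by
    intro i hi
    obtain ⟨n₁, hn₁⟩ := pow_mem_denominators hg.1 (hU i 2 hi (Or.inl rfl))
    obtain ⟨n₂, hn₂⟩ := pow_mem_denominators hg.1 (hU i 3 hi (Or.inr rfl))
    have e1 := hn₁ (max n₁ n₂) (le_max_left _ _)
    have e2 := hn₂ (max n₁ n₂) (le_max_right _ _)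
    rw [mul_pow] at e1 e2
    exact ⟨_, mem_denominators_of_two h0 hU0 (show (2 : Fin 4) ≠ 3 by decide)
      (fun w => w.1.2.2) e1 e2⟩
  obtain ⟨m, hm⟩ := key 0 (Or.inl rfl)
  obtain ⟨n, hn⟩ := key 1 (Or.inr rfl)
  rw [← one_mul (MvPolynomial.X _ ^ _)] at hm hn
  obtain ⟨P, hP⟩ := mem_denominators_of_two h0 hU0 (show (0 : Fin 4) ≠ 1 by decide)
    (fun w => w.1.2.1) hm hn
  refine ⟨P, ?_, fun w => by simpa [Pre.eval] using hP w⟩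
  have h1 := isWeightedHomogeneous_numerator hg h0 hU0
    (MvPolynomial.isWeightedHomogeneous_one ℂ (coxDeg δ)) hP
  rwa [zero_add] at h1

/-! ### Representation by affine vector fields -/

theorem radial_injective (z : Cone) {a b a' b' : ℂ}
    (h : radial δ a b z.1 = radial δ a' b' z.1) : a = a' ∧ b = b' := by
  have h0 := congrFun h 0
  have h1 := congrFun h 1
  have h2 := congrFun h 2
  have h3 := congrFun h 3
  rw [radial_zero, radial_zero] at h0
  rw [radial_one, radial_one] at h1
  rw [radial_two, radial_two] at h2
  rw [radial_three, radial_three] at h3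
  have ha : a = a' := by
    rcases z.2.1 with hz | hz
    · exact mul_right_cancel₀ hz h0
    · exact mul_right_cancel₀ hz h1
  subst ha
  refine ⟨rfl, ?_⟩
  rcases z.2.2 with hz | hz
  · exact mul_right_cancel₀ hz h2
  · exact sub_left_injective (mul_right_cancel₀ hz h3)

theorem radial_act (t : ℂˣ × ℂˣ) (c a b : ℂ) (z : Fin 4 → ℂ) :
    radial δ (c * a) (c * b) (act δ t z) = c • act δ t (radial δ a b z) := by
  funext k
  simp only [radial, act_apply, Pi.smul_apply, smul_eq_mul]
  ring

/-- Exactness of the Euler sequence at ℋ, twisted by d. The coefficients are equivariant because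
they are unique, and regular because their products with nonvanishing coordinates are; for Y₁ the
term δαY₁ is first moved to the other side. -/
theorem exists_radial_coeff {d : ℤ × ℤ} {V : Opens (Surface δ)} {w : Pre V → Fin 4 → ℂ}
    (hw : ∀ k, (fun z => w z k) ∈ twistSec (coxDeg δ k + d) V)
    (hr : ∀ z, ∃ a b, w z = radial δ a b z.1.1) :
    ∃ α ∈ twistSec d V, ∃ β ∈ twistSec d V, ∀ z, w z = radial δ (α z) (β z) z.1.1 := by
  choose α β h using hr
  have hact : ∀ t z, α (z.act t) = chr t d * α z ∧ β (z.act t) = chr t d * β z := by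
    intro t z
    refine radial_injective (δ := δ) (z.act t).1 ?_
    rw [← h, show (z.act t).1.1 = act δ t z.1.1 from rfl, radial_act, ← h]
    funext k
    have h1 : w (z.act t) k = _ := (mem_twistSec_iff.1 (hw k)).2 t z
    rw [h1, chr_add]
    simp only [act_apply, Pi.smul_apply, smul_eq_mul]
    ring
  have hα : IsRegular V α := by
    refine isRegular_of_mul fun z => ?_
    rcases z.1.2.1 with hz | hz
    · refine ⟨MvPolynomial.X 0, by simpa [Pre.eval] using hz, ?_⟩
      convert (hw 0).1 using 2 with y
      rw [h y, radial_zero]; simp [Pre.eval, mul_comm]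
    · refine ⟨MvPolynomial.X 1, by simpa [Pre.eval] using hz, ?_⟩
      convert (hw 1).1 using 2 with y
      rw [h y, radial_one]; simp [Pre.eval, mul_comm]
  have hβ : IsRegular V β := by
    refine isRegular_of_mul fun z => ?_
    rcases z.1.2.2 with hz | hz
    · refine ⟨MvPolynomial.X 2, by simpa [Pre.eval] using hz, ?_⟩
      convert (hw 2).1 using 2 with y
      rw [h y, radial_two]; simp [Pre.eval, mul_comm]
    · refine ⟨MvPolynomial.X 3, by simpa [Pre.eval] using hz, ?_⟩
      convert (hw 3).1.add (((IsRegular.const V δ).mul hα).mul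
        (IsRegular.poly V (MvPolynomial.X 3))) using 2 with y
      rw [h y, radial_three]; simp only [Pre.eval, MvPolynomial.eval_X]; ring
  exact ⟨α, mem_twistSec_iff.2 ⟨hα, fun t z => (hact t z).1⟩, β,
    mem_twistSec_iff.2 ⟨hβ, fun t z => (hact t z).2⟩, h⟩

/-- The vector field `x` on `Pre U` represents the morphism `σ : 𝒪(e) → Θ` over `U`. -/
structure RepOn {e : ℤ × ℤ} (σ : SheafHom (twist δ e) (tangentSheaf δ)) (U : Opens (Surface δ))
    (x : Pre U → Fin 4 → ℂ) : Prop where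
  mem : ∀ k, (fun z => x z k) ∈ twistSec (coxDeg δ k + -e) U
  lift : ∀ (V : Opens (Surface δ)) (h : V ≤ U) (g : twistSec e V) (z : Pre V),
    IsLift (σ.1 V g) z (g.1 z • x (z.incl h))

section

variable {e : ℤ × ℤ} {σ : SheafHom (twist δ e) (tangentSheaf δ)}

/-- On a chart 𝒪(e) is free, so it suffices to lift the image of the generator and divide by the
generator. -/
theorem exists_repOn_chart (σ : SheafHom (twist δ e) (tangentSheaf δ)) (c : Chart δ) :
    ∃ x, RepOn σ c.opens x := by
  set m : twistSec e c.opens := ⟨c.gen e, c.gen_mem e⟩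
  obtain ⟨v, hv, hv'⟩ := c.exists_lift le_rfl (σ.1 c.opens m)
  refine ⟨fun z => c.gen (-e) z • v z, fun k => ?_, fun V h g z => ?_⟩
  · rw [add_comm]
    exact mul_mem_twistSec (c.gen_mem (-e)) (hv k)
  · have hmem : (fun z : Pre V => g.1 z * c.gen (-e) (z.incl h)) ∈ twistSec (0 : ℤ × ℤ) V := by
      have := mul_mem_twistSec g.2 (incl_mem_twistSec h (c.gen_mem (-e)))
      rwa [add_neg_cancel] at this
    set f : regFun V := descend ⟨_, hmem⟩
    have hg : g = f • (show twistSec e V from (twist δ e).res h m) := by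
      refine Subtype.ext (funext fun y => ?_)
      show g.1 y = f.1 y.pt * c.gen e (y.incl h)
      rw [show f.1 y.pt = _ from descend_pt _ y]
      show g.1 y = g.1 y * c.gen (-e) (y.incl h) * c.gen e (y.incl h)
      have h1 : c.gen (-e) (y.incl h) = (c.gen e (y.incl h))⁻¹ := chr_neg _ _
      rw [h1, inv_mul_cancel_right₀ (c.gen_ne_zero _ _)]
    have hσ : σ.1 V g = f • (tangentSheaf δ).res h (σ.1 c.opens m) := by
      rw [σ.2 c.opens V h m, ← map_smul]
      exact congrArg (σ.1 V) hg
    rw [hσ]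
    have h2 := ((isLift_res h).2 (isPushforward_iff.1 hv' (z.incl h))).smul f
    rw [show f.1 z.pt = _ from descend_pt _ z] at h2
    simp only at h2
    rw [smul_smul]
    exact h2

theorem RepOn.diff {U U' : Opens (Surface δ)} {x : Pre U → Fin 4 → ℂ} {x' : Pre U' → Fin 4 → ℂ}
    (hx : RepOn σ U x) (hx' : RepOn σ U' x') (z : Pre (U ⊓ U')) :
    ∃ a b, x (z.incl inf_le_left) - x' (z.incl inf_le_right) = radial δ a b z.1.1 := by
  obtain ⟨c, hc⟩ := exists_chart (δ := δ) z.1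
  set V := U ⊓ U' ⊓ c.opens
  let y : Pre V := ⟨z.1, z.2, hc⟩
  have hm := incl_mem_twistSec (V := V) inf_le_right (c.gen_mem e)
  have h1 := hx.lift V (inf_le_left.trans inf_le_left) ⟨_, hm⟩ y
  have h2 := hx'.lift V (inf_le_left.trans inf_le_right) ⟨_, hm⟩ y
  obtain ⟨a, b, hab⟩ := h1.sub_eq_radial h2
  have h0 := c.gen_ne_zero e (y.incl inf_le_right)
  set γ := c.gen e (y.incl inf_le_right)
  refine ⟨γ⁻¹ * a, γ⁻¹ * b, ?_⟩
  have h3 : γ • x (z.incl inf_le_left) = γ • x' (z.incl inf_le_right) + radial δ a b z.1.1 := hab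
  have h4 : radial δ (γ⁻¹ * a) (γ⁻¹ * b) z.1.1 = γ⁻¹ • radial δ a b z.1.1 := by
    funext k; simp only [radial, Pi.smul_apply, smul_eq_mul]; ring
  rw [h4, ← sub_eq_of_eq_add' h3, ← smul_sub, inv_smul_smul₀ h0]

theorem RepOn.sub_radial {U : Opens (Surface δ)} {x : Pre U → Fin 4 → ℂ} (hx : RepOn σ U x)
    {α β : Pre U → ℂ} (hα : α ∈ twistSec (-e) U) (hβ : β ∈ twistSec (-e) U) :
    RepOn σ U (fun z => x z - radial δ (α z) (β z) z.1.1) := by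
  refine ⟨fun k => ?_, fun V h g z => ?_⟩
  · refine (twistSec _ U).sub_mem (hx.mem k) ?_
    have hX : (fun z : Pre U => z.1.1 k) ∈ twistSec (coxDeg δ k) U := by
      simpa [Pre.eval] using
        poly_mem_twistSec U (MvPolynomial.isWeightedHomogeneous_X ℂ (coxDeg δ) k)
    have hc : ∀ c : ℂ, (fun _ : Pre U => c) ∈ twistSec (0 : ℤ × ℤ) U := fun c =>
      mem_twistSec_iff.2 ⟨IsRegular.const U c, fun t z => by rw [chr_zero, one_mul]⟩
    have h1 := mul_mem_twistSec hX ((twistSec (-e) U).add_mem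
      (by simpa using mul_mem_twistSec (hc (coxDeg δ k).1) hα)
      (by simpa using mul_mem_twistSec (hc (coxDeg δ k).2) hβ))
    convert h1 using 1
    funext z
    simp [radial, mul_comm]
  · have h1 := (hx.lift V h g z).add_radial (-(g.1 z * α (z.incl h))) (-(g.1 z * β (z.incl h)))
    convert h1 using 1
    funext k
    simp only [radial, Pi.smul_apply, Pi.sub_apply, Pi.add_apply, smul_eq_mul]
    rw [show (z.incl h).1.1 = z.1.1 from rfl]
    ring

theorem RepOn.union {U U' : Opens (Surface δ)} {x : Pre U → Fin 4 → ℂ} {x' : Pre U' → Fin 4 → ℂ}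
    (hx : RepOn σ U x) (hx' : RepOn σ U' x')
    (h : ∀ z : Pre (U ⊓ U'), x (z.incl inf_le_left) = x' (z.incl inf_le_right)) :
    ∃ y, RepOn σ (U ⊔ U') y := by
  classical
  have hor : ∀ z : Pre (U ⊔ U'), proj δ z.1 ∉ U → proj δ z.1 ∈ U' := fun z hz =>
    (show proj δ z.1 ∈ U ∨ proj δ z.1 ∈ U' from z.2).resolve_left hz
  set y : Pre (U ⊔ U') → Fin 4 → ℂ := fun z =>
    if hz : proj δ z.1 ∈ U then x ⟨z.1, hz⟩ else x' ⟨z.1, hor z hz⟩ with hy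
  have h1 : ∀ z : Pre U, y (z.incl le_sup_left) = x z := fun z => dif_pos z.2
  have h2 : ∀ z : Pre U', y (z.incl le_sup_right) = x' z := by
    intro z
    by_cases hz : proj δ z.1 ∈ U
    · exact (dif_pos hz).trans (h ⟨z.1, hz, z.2⟩)
    · exact dif_neg hz
  refine ⟨y, fun k => mem_twistSec_iff.2 ⟨isRegular_of_local fun z => ?_, fun t z => ?_⟩,
    fun V hV g z => ?_⟩
  · by_cases hz : proj δ z.1 ∈ U
    · refine ⟨U, le_sup_left, hz, ?_⟩
      simp only [h1]
      exact (hx.mem k).1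
    · refine ⟨U', le_sup_right, hor z hz, ?_⟩
      simp only [h2]
      exact (hx'.mem k).1
  · by_cases hz : proj δ z.1 ∈ U
    · have h3 := (mem_twistSec_iff.1 (hx.mem k)).2 t ⟨z.1, hz⟩
      exact (congrFun (h1 _) k).trans (h3.trans (congrArg _ (congrFun (h1 ⟨z.1, hz⟩) k).symm))
    · have h3 := (mem_twistSec_iff.1 (hx'.mem k)).2 t ⟨z.1, hor z hz⟩
      exact (congrFun (h2 _) k).trans
        (h3.trans (congrArg _ (congrFun (h2 ⟨z.1, hor z hz⟩) k).symm))
  · by_cases hz : proj δ z.1 ∈ U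
    · have h3 := hx.lift (V ⊓ U) inf_le_right
        ((twist δ e).res (U := V) inf_le_left g) ⟨z.1, z.2, hz⟩
      rw [← σ.2 V (V ⊓ U) inf_le_left g, ← h1] at h3
      exact (isLift_res inf_le_left).1 h3
    · have h3 := hx'.lift (V ⊓ U') inf_le_right
        ((twist δ e).res (U := V) inf_le_left g) ⟨z.1, z.2, hor (z.incl hV) hz⟩
      rw [← σ.2 V (V ⊓ U') inf_le_left g, ← h2] at h3
      exact (isLift_res inf_le_left).1 h3

/-- The connecting map by hand: two local representatives differ by αR₁ + βR₂ with α, β sections of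
𝒪(-e). Splitting α and β lets each representative be corrected by a radial field until they agree.
-/
theorem RepOn.glue {U U' : Opens (Surface δ)} {x : Pre U → Fin 4 → ℂ} {x' : Pre U' → Fin 4 → ℂ}
    (hx : RepOn σ U x) (hx' : RepOn σ U' x')
    (hs : ∀ g ∈ twistSec (-e) (U ⊓ U'), ∃ g₁ ∈ twistSec (-e) U, ∃ g₂ ∈ twistSec (-e) U',
      ∀ z : Pre (U ⊓ U'), g z = g₁ (z.incl inf_le_left) - g₂ (z.incl inf_le_right)) :
    ∃ y, RepOn σ (U ⊔ U') y := by
  obtain ⟨α, hα, β, hβ, hab⟩ := exists_radial_coeff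
    (w := fun z : Pre (U ⊓ U') => x (z.incl inf_le_left) - x' (z.incl inf_le_right))
    (fun k => (twistSec _ (U ⊓ U')).sub_mem (incl_mem_twistSec inf_le_left (hx.mem k))
      (incl_mem_twistSec inf_le_right (hx'.mem k))) (hx.diff hx')
  obtain ⟨α₁, hα₁, α₂, hα₂, hα'⟩ := hs α hα
  obtain ⟨β₁, hβ₁, β₂, hβ₂, hβ'⟩ := hs β hβ
  refine (hx.sub_radial hα₁ hβ₁).union (hx'.sub_radial hα₂ hβ₂) fun z => ?_
  have h1 := hab z
  simp only [hα', hβ', radial_sub] at h1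
  rw [sub_eq_sub_iff_sub_eq_sub]
  exact h1

/-- A morphism `𝒪(e₁, e₂) → Θ` with `e₁, e₂ ≤ 1` is represented by an affine vector field. -/
theorem exists_poly_rep (σ : SheafHom (twist δ e) (tangentSheaf δ)) (h1 : e.1 ≤ 1)
    (h2 : e.2 ≤ 1) : ∃ X : Fin 4 → CoxPoly,
      (∀ i, MvPolynomial.IsWeightedHomogeneous (coxDeg δ) (X i) (coxDeg δ i + -e)) ∧
      ∀ (U : Opens (Surface δ)) (g : twistSec e U) (z : Pre U),
        IsLift (σ.1 U g) z (g.1 z • fun i => z.eval (X i)) := by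
  have d1 : -1 ≤ (-e).1 := by simpa using neg_le_neg h1
  have d2 : -1 ≤ (-e).2 := by simpa using neg_le_neg h2
  -- Gluing along the fibres comes first: it yields a representative on each set X_i ≠ 0, and only
  -- these two sets remain to be glued along the base.
  have key : ∀ (i : Fin 4) (hi : coxDeg δ i = (1, 0)) (hi' : i = 0 ∨ i = 1),
      ∃ x, RepOn σ (coordOpen δ i) x := by
    intro i hi hi'
    obtain ⟨x, hx⟩ := exists_repOn_chart σ (chartZero i hi)
    obtain ⟨x', hx'⟩ := exists_repOn_chart σ (chartOne i hi)
    have hU : (chartZero i hi).opens ⊔ (chartOne i hi).opens = coordOpen δ i := by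
      ext p
      obtain ⟨z, rfl⟩ := Quotient.exists_rep p
      show proj δ z ∈ (chartZero i hi).opens ∨ proj δ z ∈ (chartOne i hi).opens ↔
        proj δ z ∈ coordOpen δ i
      rw [mem_chartZero, mem_chartOne, mem_coordOpen, ← and_or_left]
      exact and_iff_left z.2.2
    rw [← hU]
    exact hx.glue hx' (exists_split_fibre hi hi' d2)
  obtain ⟨x, hx⟩ := key 0 coxDeg_zero (Or.inl rfl)
  obtain ⟨x', hx'⟩ := key 1 coxDeg_one (Or.inr rfl)
  have hxy := hx.glue hx' (exists_split_base d1)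
  have hU : coordOpen δ 0 ⊔ coordOpen δ 1 = ⊤ := by
    refine top_unique fun p _ => ?_
    obtain ⟨z, rfl⟩ := Quotient.exists_rep p
    exact z.2.1.imp mem_coordOpen.2 mem_coordOpen.2
  rw [hU] at hxy
  obtain ⟨y, hy⟩ := hxy
  have hX : ∀ i, ∃ P : CoxPoly, MvPolynomial.IsWeightedHomogeneous (coxDeg δ) P
      (coxDeg δ i + -e) ∧ ∀ w, y w i = w.eval P := fun i => exists_poly_of_global (hy.mem i)
  choose X hX1 hX2 using hX
  refine ⟨X, hX1, fun U g z => ?_⟩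
  have h3 := hy.lift U le_top g z
  rw [show y (z.incl le_top) = fun i => z.eval (X i) from funext fun i => hX2 i _] at h3
  exact h3

end

/-! ### Matrices of bi-homogeneous polynomials -/

/-- The matrices that define endomorphisms of `ℋ`. -/
def IsGraded (δ : ℕ) (A : Matrix (Fin 4) (Fin 4) CoxPoly) : Prop :=
  ∀ l k, MvPolynomial.IsWeightedHomogeneous (coxDeg δ) (A l k) (coxDeg δ l + -coxDeg δ k)

theorem matAct_apply (A : Matrix (Fin 4) (Fin 4) CoxPoly) (z v : Fin 4 → ℂ) (l : Fin 4) :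
    matAct A z v l = ∑ k, MvPolynomial.eval z (A l k) * v k := rfl

theorem IsGraded.euler {A : Matrix (Fin 4) (Fin 4) CoxPoly} (hA : IsGraded δ A)
    {U : Opens (Surface δ)} {v : Pre U → Fin 4 → ℂ} (hv : IsEulerSec U v) :
    IsEulerSec U (fun z => matAct A z.1.1 (v z)) := by
  intro l
  have h : ∀ k, (fun z : Pre U => z.eval (A l k) * v z k) ∈ twistSec (coxDeg δ l) U := by
    intro k
    have := mul_mem_twistSec (poly_mem_twistSec U (hA l k)) (hv k)
    rwa [neg_add_cancel_right] at this
  have h2 := (twistSec (coxDeg δ l) U).sum_mem (fun k (_ : k ∈ Finset.univ) => h k)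
  convert h2 using 1
  funext z
  rw [Finset.sum_apply]
  rfl

theorem IsGraded.mulVec {A : Matrix (Fin 4) (Fin 4) CoxPoly} (hA : IsGraded δ A)
    {X : Fin 4 → CoxPoly} {d : ℤ × ℤ}
    (hX : ∀ i, MvPolynomial.IsWeightedHomogeneous (coxDeg δ) (X i) (d + coxDeg δ i)) (i : Fin 4) :
    MvPolynomial.IsWeightedHomogeneous (coxDeg δ) (Matrix.mulVec A X i) (d + coxDeg δ i) := by
  refine MvPolynomial.IsWeightedHomogeneous.sum _ _ _ fun k _ => ?_
  have h := (hA i k).mul (hX k)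
  rwa [show coxDeg δ i + -coxDeg δ k + (d + coxDeg δ k) = d + coxDeg δ i by abel] at h

/-! ### Every endomorphism is represented by a matrix -/

theorem IsLift.sum {U : Opens (Surface δ)} {ι : Type*} (s : Finset ι) {D : ι → TangentSec U}
    {z : Pre U} {v : ι → Fin 4 → ℂ} (h : ∀ i ∈ s, IsLift (D i) z (v i)) :
    IsLift (∑ i ∈ s, D i) z (∑ i ∈ s, v i) := by
  classical
  induction s using Finset.induction_on with
  | empty => simpa using IsLift.zero z
  | insert a s ha ih =>
    rw [Finset.sum_insert ha, Finset.sum_insert ha]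
    exact (h a (by simp)).add (ih fun i hi => h i (by simp [hi]))

theorem single_isEulerSec {U : Opens (Surface δ)} (k : Fin 4) (g : twistSec (coxDeg δ k) U) :
    IsEulerSec U (fun z => Pi.single k (g.1 z)) := by
  intro i
  by_cases h : i = k
  · subst h
    simp
  · rw [show (fun z : Pre U => (Pi.single k (g.1 z) : Fin 4 → ℂ) i) = 0 from
      funext fun z => Pi.single_eq_of_ne h _]
    exact (twistSec (coxDeg δ i) U).zero_mem

/-- The restriction of `dπ : ℋ → Θ` to a summand of `ℋ`. -/
noncomputable def eulerHom (δ : ℕ) (k : Fin 4) :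
    SheafHom (twist δ (coxDeg δ k)) (tangentSheaf δ) := by
  refine ⟨fun U =>
    { toFun := fun g => (single_isEulerSec (U := U) k g).exists_isPushforward.choose
      map_add' := fun g g' => ?_
      map_smul' := fun f g => ?_ }, fun U V h g => ?_⟩
  · refine TangentSec.ext_lift fun z => ⟨_, isPushforward_iff.1
      (single_isEulerSec k (g + g' : twistSec (coxDeg δ k) U)).exists_isPushforward.choose_spec z,
      ?_⟩
    have h := (isPushforward_iff.1
      (single_isEulerSec (U := U) k g).exists_isPushforward.choose_spec z).add
      (isPushforward_iff.1 (single_isEulerSec (U := U) k g').exists_isPushforward.choose_spec z)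
    rw [← Pi.single_add] at h
    exact h
  · refine TangentSec.ext_lift fun z => ⟨_, isPushforward_iff.1
      (single_isEulerSec k (f • g : twistSec (coxDeg δ k) U)).exists_isPushforward.choose_spec z,
      ?_⟩
    have h := (isPushforward_iff.1
      (single_isEulerSec (U := U) k g).exists_isPushforward.choose_spec z).smul f
    rw [← Pi.single_smul] at h
    exact h
  · refine TangentSec.ext_lift fun z => ⟨_, (isLift_res h).2 (isPushforward_iff.1
      (single_isEulerSec (U := U) k g).exists_isPushforward.choose_spec (z.incl h)),
      isPushforward_iff.1 (single_isEulerSec (U := V) k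
        ((twist δ (coxDeg δ k)).res h g)).exists_isPushforward.choose_spec z⟩

theorem isLift_eulerHom {U : Opens (Surface δ)} (k : Fin 4) (g : twistSec (coxDeg δ k) U)
    (z : Pre U) : IsLift ((eulerHom δ k).1 U g) z (Pi.single k (g.1 z)) :=
  isPushforward_iff.1 (single_isEulerSec k g).exists_isPushforward.choose_spec z

theorem coxDeg_le (k : Fin 4) : (coxDeg δ k).1 ≤ 1 ∧ (coxDeg δ k).2 ≤ 1 := by
  fin_cases k <;> simp [coxDeg]

/-- Column k is the polynomial vector field representing Φ ∘ dπ on the k-th summand of ℋ. By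
linearity the columns determine Φ on everything that lifts to ℋ. -/
theorem exists_graded_represents (Φ : SheafHom (tangentSheaf δ) (tangentSheaf δ)) :
    ∃ A, IsGraded δ A ∧ Represents A Φ := by
  choose X hX hX' using fun k : Fin 4 =>
    exists_poly_rep (compHom Φ (eulerHom δ k)) (coxDeg_le k).1 (coxDeg_le k).2
  have hA : IsGraded δ (Matrix.of fun l k => X k l) := fun l k => hX k l
  refine ⟨_, hA, represents_iff.2 fun U v D hv hD =>
    ⟨hA.euler hv, isPushforward_iff.2 fun z => ?_⟩⟩
  have h1 : D = ∑ k, (show TangentSec U from (eulerHom δ k).1 U ⟨_, hv k⟩) := by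
    refine TangentSec.ext_lift fun y => ⟨_, isPushforward_iff.1 hD y, ?_⟩
    have h2 := IsLift.sum Finset.univ fun k (_ : k ∈ Finset.univ) =>
      isLift_eulerHom k ⟨_, hv k⟩ y
    rw [Finset.univ_sum_single] at h2
    exact h2
  have h3 := IsLift.sum Finset.univ fun k (_ : k ∈ Finset.univ) => hX' k U ⟨_, hv k⟩ z
  have h4 : Φ.1 U D = ∑ k, (show TangentSec U from
      (compHom Φ (eulerHom δ k)).1 U (⟨_, hv k⟩ : twistSec (coxDeg δ k) U)) := by
    rw [h1]
    exact map_sum (Φ.1 U) _ _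
  rw [h4]
  convert h3 using 1
  funext l
  rw [matAct_apply, Finset.sum_apply]
  exact Finset.sum_congr rfl fun k _ => mul_comm _ _

/-! ### Classification of the matrices -/

theorem IsWeightedHomogeneous.exponents {P : CoxPoly} {D : ℤ × ℤ}
    (hP : MvPolynomial.IsWeightedHomogeneous (coxDeg δ) P D) {m : Fin 4 →₀ ℕ}
    (hm : P.coeff m ≠ 0) : (m 0 : ℤ) + m 1 - δ * m 3 = D.1 ∧ (m 2 : ℤ) + m 3 = D.2 := by
  have h := hP hm
  rw [weight_coxDeg] at h
  exact Prod.ext_iff.1 h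

theorem eq_zero_of_exponents {P : CoxPoly} {D : ℤ × ℤ}
    (hP : MvPolynomial.IsWeightedHomogeneous (coxDeg δ) P D)
    (h : ∀ m : Fin 4 → ℤ, (∀ i, 0 ≤ m i) → m 0 + m 1 - δ * m 3 = D.1 → m 2 + m 3 = D.2 → False) :
    P = 0 := by
  refine MvPolynomial.ext _ _ fun m => ?_
  by_contra hm
  obtain ⟨h1, h2⟩ := IsWeightedHomogeneous.exponents hP hm
  exact h (fun i => m i) (fun i => by positivity) h1 h2

theorem eq_C_of_homogeneous_zero {P : CoxPoly}
    (hP : MvPolynomial.IsWeightedHomogeneous (coxDeg δ) P 0) : ∃ c, P = MvPolynomial.C c := by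
  refine ⟨P.coeff 0, MvPolynomial.ext _ _ fun m => ?_⟩
  rw [MvPolynomial.coeff_C]
  split_ifs with h
  · rw [h]
  · by_contra hm
    obtain ⟨h1, h2⟩ := IsWeightedHomogeneous.exponents hP hm
    simp only [Prod.fst_zero, Prod.snd_zero] at h1 h2
    have h3 : m 3 = 0 := by omega
    rw [h3] at h1
    refine h (Finsupp.ext fun i => ?_)
    fin_cases i <;> simp <;> omega

/-- Second degree 0 excludes Y₀ and Y₁, so the fibre coordinates of a test point may be moved
freely. -/
theorem eval_congr_of_snd_eq_zero {P : CoxPoly} {D : ℤ × ℤ}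
    (hP : MvPolynomial.IsWeightedHomogeneous (coxDeg δ) P D) (hD : D.2 = 0) {z w : Fin 4 → ℂ}
    (h0 : z 0 = w 0) (h1 : z 1 = w 1) : MvPolynomial.eval z P = MvPolynomial.eval w P := by
  rw [MvPolynomial.eval_eq', MvPolynomial.eval_eq']
  refine Finset.sum_congr rfl fun m hm => ?_
  obtain ⟨-, h2⟩ := IsWeightedHomogeneous.exponents hP (MvPolynomial.mem_support_iff.1 hm)
  rw [Fin.prod_univ_four, Fin.prod_univ_four, h0, h1, show m 2 = 0 by omega,
    show m 3 = 0 by omega]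
  simp

/-- The common shape of the matrices `A(a, d)`, `A(a)` and `A(a, C)`, with `E = Y₁ C`. -/
noncomputable def normalMatrix (a d : ℂ) (E : CoxPoly) : Matrix (Fin 4) (Fin 4) CoxPoly :=
  !![MvPolynomial.C a, 0, 0, 0;
     0, MvPolynomial.C a, 0, 0;
     MvPolynomial.X 1 * E, -(MvPolynomial.X 0 * E), MvPolynomial.C d, 0;
     0, 0, 0, MvPolynomial.C d]

/-- A point of the product of two punctured planes. -/
def mkCone (x y u v : ℂ) (h1 : x ≠ 0 ∨ y ≠ 0) (h2 : u ≠ 0 ∨ v ≠ 0) : Cone :=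
  ⟨![x, y, u, v], h1, h2⟩

/-- Bi-degrees make the diagonal entries and the upper left block constant and kill the upper right
block and the X-entries of the last row. Preserving R₂ makes the lower right block scalar.
Preserving R₁ makes the upper left block scalar and leaves one syzygy for the X-entries of the third
row. -/
theorem eq_normalMatrix {A : Matrix (Fin 4) (Fin 4) CoxPoly} (hA : IsGraded δ A)
    (hR : ∀ (z : Cone) (a b : ℂ), ∃ a' b', matAct A z.1 (radial δ a b z.1) = radial δ a' b' z.1) :
    ∃ a d E, MvPolynomial.IsWeightedHomogeneous (coxDeg δ) E (-2, 1) ∧ (δ : ℂ) * (a - d) = 0 ∧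
      A = normalMatrix a d E := by
  have hδ : (0 : ℤ) ≤ δ := by positivity
  obtain ⟨a00, h00⟩ := eq_C_of_homogeneous_zero (δ := δ) (P := A 0 0) (by simpa using hA 0 0)
  obtain ⟨a01, h01⟩ := eq_C_of_homogeneous_zero (δ := δ) (P := A 0 1)
    (by rw [← add_neg_cancel (coxDeg δ 0)]; exact hA 0 1)
  obtain ⟨a10, h10⟩ := eq_C_of_homogeneous_zero (δ := δ) (P := A 1 0)
    (by rw [← add_neg_cancel (coxDeg δ 0)]; exact hA 1 0)
  obtain ⟨a11, h11⟩ := eq_C_of_homogeneous_zero (δ := δ) (P := A 1 1) (by simpa using hA 1 1)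
  obtain ⟨a22, h22⟩ := eq_C_of_homogeneous_zero (δ := δ) (P := A 2 2) (by simpa using hA 2 2)
  obtain ⟨a33, h33⟩ := eq_C_of_homogeneous_zero (δ := δ) (P := A 3 3) (by simpa using hA 3 3)
  have hneg : ∀ l k : Fin 4, (coxDeg δ l + -coxDeg δ k).2 < 0 → A l k = 0 := fun l k h =>
    eq_zero_of_exponents (hA l k) fun m hm _ h2 => by
      have := hm 2; have := hm 3; omega
  have h02 : A 0 2 = 0 := hneg 0 2 (by simp [coxDeg])
  have h03 : A 0 3 = 0 := hneg 0 3 (by simp [coxDeg])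
  have h12 : A 1 2 = 0 := hneg 1 2 (by simp [coxDeg])
  have h13 : A 1 3 = 0 := hneg 1 3 (by simp [coxDeg])
  -- The bi-degree is (-δ - 1, 1). Since m₃ ≤ 1, this forces m₀ + m₁ = δm₃ - δ - 1 < 0.
  have hlow : ∀ k : Fin 4, coxDeg δ k = (1, 0) → A 3 k = 0 := by
    intro k hk
    refine eq_zero_of_exponents (hA 3 k) fun m hm h1 h2 => ?_
    rw [hk] at h1 h2
    simp [coxDeg] at h1 h2
    have h3 : m 3 ≤ 1 := by have := hm 2; omega
    have h4 : (δ : ℤ) * m 3 ≤ δ * 1 := mul_le_mul_of_nonneg_left h3 hδ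
    have := hm 0; have := hm 1; omega
  have h30 : A 3 0 = 0 := hlow 0 rfl
  have h31 : A 3 1 = 0 := hlow 1 rfl
  -- the second radial vector field
  have hR2 : ∀ z : Cone, (a22 * z.1 2 + MvPolynomial.eval z.1 (A 2 3) * z.1 3) * z.1 3 =
      (MvPolynomial.eval z.1 (A 3 2) * z.1 2 + a33 * z.1 3) * z.1 2 := by
    intro z
    obtain ⟨a', b', h⟩ := hR z 0 1
    have e0 := congrFun h 0
    have e1 := congrFun h 1
    have e2 := congrFun h 2
    have e3 := congrFun h 3
    simp only [matAct_apply, Fin.sum_univ_four, radial_zero, radial_one, radial_two,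
      radial_three, h02, h03, h12, h13, h22, h33, map_zero, MvPolynomial.eval_C, zero_mul,
      mul_zero, add_zero, zero_add, one_mul, sub_zero] at e0 e1 e2 e3
    have ha' : a' = 0 := by
      rcases z.2.1 with hz | hz
      · exact (mul_eq_zero.1 e0.symm).resolve_right hz
      · exact (mul_eq_zero.1 e1.symm).resolve_right hz
    subst ha'
    rw [e2, e3]; ring
  -- Fibre coordinates (1, 0), (0, 1) and (1, 1) in turn isolate the two off-diagonal entries and
  -- the difference of the diagonal ones.
  have h32 : A 3 2 = 0 := by
    refine poly_eq_zero_of_cone fun z => ?_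
    have h := hR2 (mkCone (z.1 0) (z.1 1) 1 0 z.2.1 (Or.inl one_ne_zero))
    rw [eval_congr_of_snd_eq_zero (hA 3 2) (by simp [coxDeg])
      (z := z.1) (w := (mkCone (z.1 0) (z.1 1) 1 0 z.2.1 (Or.inl one_ne_zero)).1) rfl rfl]
    simpa [mkCone] using h.symm
  have h23 : A 2 3 = 0 := by
    refine poly_eq_zero_of_cone fun z => ?_
    have h := hR2 (mkCone (z.1 0) (z.1 1) 0 1 z.2.1 (Or.inr one_ne_zero))
    rw [eval_congr_of_snd_eq_zero (hA 2 3) (by simp [coxDeg])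
      (z := z.1) (w := (mkCone (z.1 0) (z.1 1) 0 1 z.2.1 (Or.inr one_ne_zero)).1) rfl rfl]
    simpa [mkCone] using h
  have hd : a22 = a33 := by
    have h := hR2 (mkCone 1 1 1 1 (Or.inl one_ne_zero) (Or.inl one_ne_zero))
    simpa [mkCone, h32, h23] using h
  subst hd
  -- the first radial vector field
  have hR1 : ∀ z : Cone, ∃ a', a00 * z.1 0 + a01 * z.1 1 = a' * z.1 0 ∧
      a10 * z.1 0 + a11 * z.1 1 = a' * z.1 1 ∧
      (MvPolynomial.eval z.1 (A 2 0) * z.1 0 + MvPolynomial.eval z.1 (A 2 1) * z.1 1) * z.1 3 =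
        δ * (a' - a22) * z.1 2 * z.1 3 := by
    intro z
    obtain ⟨a', b', h⟩ := hR z 1 0
    have e0 := congrFun h 0
    have e1 := congrFun h 1
    have e2 := congrFun h 2
    have e3 := congrFun h 3
    simp only [matAct_apply, Fin.sum_univ_four, radial_zero, radial_one, radial_two,
      radial_three, h00, h01, h10, h11, h02, h03, h12, h13, h22, h33, h23, h32, h30, h31, map_zero,
      MvPolynomial.eval_C, zero_mul, mul_zero, add_zero, zero_add, one_mul, zero_sub] at e0 e1 e2 e3
    -- The unknown b' is eliminated between the last two rows. The factor Y₁ stays for now, since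
    -- the last row determines b' only where Y₁ ≠ 0.
    refine ⟨a', e0, e1, ?_⟩
    rw [e2]
    linear_combination (-z.1 2) * e3
  -- Every (X₀, X₁) is an eigenvector of the upper left block; (1, 0), (0, 1) and (1, 1) show that
  -- it is scalar.
  have e10 : a10 = 0 := by
    obtain ⟨a', -, h, -⟩ := hR1 (mkCone 1 0 1 0 (Or.inl one_ne_zero) (Or.inl one_ne_zero))
    simpa [mkCone] using h
  have e01 : a01 = 0 := by
    obtain ⟨a', h, -, -⟩ := hR1 (mkCone 0 1 1 0 (Or.inr one_ne_zero) (Or.inl one_ne_zero))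
    simpa [mkCone] using h
  subst e10 e01
  have e11 : a00 = a11 := by
    obtain ⟨a', h, h', -⟩ := hR1 (mkCone 1 1 1 0 (Or.inl one_ne_zero) (Or.inl one_ne_zero))
    simp [mkCone] at h h'
    rw [h, h']
  subst e11
  have hB : A 2 0 * MvPolynomial.X 0 + A 2 1 * MvPolynomial.X 1 =
      MvPolynomial.C (δ * (a00 - a22)) * MvPolynomial.X 2 := by
    have h : (A 2 0 * MvPolynomial.X 0 + A 2 1 * MvPolynomial.X 1 -
        MvPolynomial.C (δ * (a00 - a22)) * MvPolynomial.X 2) * MvPolynomial.X 3 = 0 := by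
      refine poly_eq_zero_of_cone fun z => ?_
      obtain ⟨a', e0, e1, e2⟩ := hR1 z
      have ha' : a' = a00 := by
        rw [zero_mul, add_zero] at e0
        rw [zero_mul, zero_add] at e1
        rcases z.2.1 with hz | hz
        · exact (mul_right_cancel₀ hz e0).symm
        · exact (mul_right_cancel₀ hz e1).symm
      subst ha'
      simp only [map_mul, map_sub, map_add, MvPolynomial.eval_X, MvPolynomial.eval_C]
      linear_combination e2
    exact sub_eq_zero.1 ((mul_eq_zero.1 h).resolve_right (MvPolynomial.X_ne_zero _))
  -- At (1, 0, 1, 0) the left side vanishes: X₁ = 0, and bi-degree (-1, 1) forces a factor Y₁ in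
  -- every monomial of `A 2 0`.
  have hκ : (δ : ℂ) * (a00 - a22) = 0 := by
    have h := congrArg (MvPolynomial.eval ![1, 0, 1, 0]) hB
    have h20 : MvPolynomial.eval ![1, 0, 1, 0] (A 2 0) = 0 := by
      rw [MvPolynomial.eval_eq']
      refine Finset.sum_eq_zero fun m hm => ?_
      obtain ⟨h1, -⟩ := IsWeightedHomogeneous.exponents (hA 2 0)
        (MvPolynomial.mem_support_iff.1 hm)
      have h3 : m 3 ≠ 0 := by
        intro h3
        rw [h3] at h1
        simp [coxDeg] at h1
        omega
      rw [Fin.prod_univ_four]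
      simp [h3]
    simp [h20] at h
    simpa using h
  rw [hκ, map_zero, zero_mul] at hB
  -- What remains is the syzygy A₂₀X₀ + A₂₁X₁ = 0, so (A₂₀, A₂₁) is a multiple of (X₁, -X₀).
  have hdvd : (MvPolynomial.X 1 : CoxPoly) ∣ A 2 0 := by
    have hp : Prime (MvPolynomial.X 1 : CoxPoly) := MvPolynomial.X_prime
    have h1 : (MvPolynomial.X 1 : CoxPoly) ∣ A 2 0 * MvPolynomial.X 0 :=
      ⟨-A 2 1, by linear_combination hB⟩
    refine (hp.dvd_or_dvd h1).resolve_right fun h => ?_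
    exact absurd (MvPolynomial.X_dvd_X.1 h) (by decide)
  obtain ⟨E, hE⟩ := hdvd
  have h21 : A 2 1 = -(MvPolynomial.X 0 * E) := by
    rw [hE] at hB
    refine mul_right_cancel₀ (MvPolynomial.X_ne_zero (1 : Fin 4)) ?_
    linear_combination hB
  refine ⟨a00, a22, E, fun m hm => ?_, hκ, ?_⟩
  · have h1 := hA 2 0 (d := Finsupp.single 1 1 + m) (by rw [hE, MvPolynomial.coeff_X_mul]; exact hm)
    rw [map_add, Finsupp.weight_single] at h1
    rw [← add_right_inj ((1 : ℕ) • coxDeg δ 1), h1]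
    simp [coxDeg]
  · ext i j : 1
    fin_cases i <;> fin_cases j <;>
      simp [normalMatrix, h00, h01, h02, h03, h10, h11, h12, h13, hE, h21, h22, h23, h30, h31,
        h32, h33]

/-! ### The matrices in normal form -/

theorem normalMatrix_isGraded {a d : ℂ} {E : CoxPoly}
    (hE : MvPolynomial.IsWeightedHomogeneous (coxDeg δ) E (-2, 1)) :
    IsGraded δ (normalMatrix a d E) := by
  have hC : ∀ (c : ℂ) (l k : Fin 4), coxDeg δ l = coxDeg δ k →
      MvPolynomial.IsWeightedHomogeneous (coxDeg δ) (MvPolynomial.C c)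
        (coxDeg δ l + -coxDeg δ k) := by
    intro c l k h
    rw [h, add_neg_cancel]
    exact MvPolynomial.isWeightedHomogeneous_C _ c
  have h0 := MvPolynomial.isWeightedHomogeneous_zero ℂ (coxDeg δ)
  have h20 : MvPolynomial.IsWeightedHomogeneous (coxDeg δ) (MvPolynomial.X 1 * E)
      (coxDeg δ 2 + -coxDeg δ 0) := by
    have h := (MvPolynomial.isWeightedHomogeneous_X ℂ (coxDeg δ) 1).mul hE
    rwa [show coxDeg δ 1 + (-2, 1) = coxDeg δ 2 + -coxDeg δ 0 from rfl] at h
  have h21 : MvPolynomial.IsWeightedHomogeneous (coxDeg δ) (-(MvPolynomial.X 0 * E))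
      (coxDeg δ 2 + -coxDeg δ 1) := by
    have h := ((MvPolynomial.isWeightedHomogeneous_X ℂ (coxDeg δ) 0).mul hE).neg
    rwa [show coxDeg δ 0 + (-2, 1) = coxDeg δ 2 + -coxDeg δ 1 from rfl] at h
  intro l k
  fin_cases l <;> fin_cases k <;>
    first
    | exact h0 _
    | exact hC _ _ _ rfl
    | exact h20
    | exact h21

theorem normalMatrix_matAct (a d : ℂ) (E : CoxPoly) (z v : Fin 4 → ℂ) :
    matAct (normalMatrix a d E) z v = ![a * v 0, a * v 1,
      (z 1 * v 0 - z 0 * v 1) * MvPolynomial.eval z E + d * v 2, d * v 3] := by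
  funext l
  rw [matAct_apply, Fin.sum_univ_four]
  fin_cases l <;> simp [normalMatrix]
  ring

/-- The E-terms cancel on radial vectors. The field R₁ is scaled by a in its X-entries but by d in
its entry -δY₁, which is where δ(a - d) = 0 enters. -/
theorem normalMatrix_radial {a d : ℂ} (h : (δ : ℂ) * (a - d) = 0) (E : CoxPoly)
    (z : Fin 4 → ℂ) (α β : ℂ) :
    matAct (normalMatrix a d E) z (radial δ α β z) = radial δ (a * α) (d * β) z := by
  rw [normalMatrix_matAct, radial_zero, radial_one, radial_two, radial_three]
  funext l
  fin_cases l
  · simp [radial_zero, mul_assoc]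
  · simp [radial_one, mul_assoc]
  · simp [radial_two]; ring
  · simp only [Fin.reduceFinMk, Matrix.cons_val, radial_three]
    linear_combination (α * z 3) * h

theorem normalMatrix_add (a d a' d' : ℂ) (E E' : CoxPoly) :
    normalMatrix a d E + normalMatrix a' d' E' = normalMatrix (a + a') (d + d') (E + E') := by
  ext i j : 1
  fin_cases i <;> fin_cases j <;> simp [normalMatrix] <;> ring

theorem normalMatrix_smul (c a d : ℂ) (E : CoxPoly) :
    c • normalMatrix a d E = normalMatrix (c * a) (c * d) (c • E) := by
  ext i j : 1
  fin_cases i <;> fin_cases j <;>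
    simp [normalMatrix, MvPolynomial.smul_eq_C_mul] <;> ring

theorem normalMatrix_mul (a d a' d' : ℂ) (E E' : CoxPoly) :
    normalMatrix a d E * normalMatrix a' d' E' =
      normalMatrix (a * a') (d * d') (a' • E + d • E') := by
  ext i j : 1
  fin_cases i <;> fin_cases j <;>
    simp [normalMatrix, MvPolynomial.smul_eq_C_mul, Matrix.mul_apply, Fin.sum_univ_four] <;> ring

theorem normalMatrix_one : normalMatrix 1 1 0 = 1 := by
  ext i j : 1
  fin_cases i <;> fin_cases j <;> simp [normalMatrix]

theorem normalMatrix_zero : normalMatrix 0 0 0 = 0 := by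
  ext i j : 1
  fin_cases i <;> fin_cases j <;> simp [normalMatrix]

/-- Every vector at a point is the value of a local section of ℋ: on a chart, constant multiples of
the generators interpolate it. -/
theorem Represents.matAct_eq_radial {A : Matrix (Fin 4) (Fin 4) CoxPoly}
    (hA : Represents A (0 : SheafHom (tangentSheaf δ) (tangentSheaf δ))) (z : Cone)
    (v : Fin 4 → ℂ) : ∃ α β, matAct A z.1 v = radial δ α β z.1 := by
  obtain ⟨c, hc⟩ := exists_chart (δ := δ) z
  let y : Pre c.opens := ⟨z, hc⟩
  have hw : IsEulerSec c.opens
      (fun w k => c.gen (coxDeg δ k) w * (v k / c.gen (coxDeg δ k) y)) := by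
    intro k
    have h := mul_mem_twistSec (c.gen_mem (coxDeg δ k)) (mem_twistSec_iff.2
      ⟨IsRegular.const c.opens (v k / c.gen (coxDeg δ k) y), fun t z => by
        rw [chr_zero, one_mul]⟩ : _ ∈ twistSec (0 : ℤ × ℤ) c.opens)
    rwa [add_zero] at h
  obtain ⟨D, hD⟩ := hw.exists_isPushforward
  have h := isPushforward_iff.1 (represents_iff.1 hA _ _ D hw hD).2 y
  have hv : (fun k => c.gen (coxDeg δ k) y * (v k / c.gen (coxDeg δ k) y)) = v :=
    funext fun k => mul_div_cancel₀ _ (c.gen_ne_zero _ _)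
  rw [hv] at h
  exact isLift_zero_iff.1 h

/-- At points with all coordinates nonzero, the image of the first basis vector is radial only if a
and the value of E vanish, and that of the last only if d vanishes. -/
theorem normalMatrix_eq_zero_of_represents {a d : ℂ} {E : CoxPoly}
    (h : Represents (normalMatrix a d E) (0 : SheafHom (tangentSheaf δ) (tangentSheaf δ))) :
    a = 0 ∧ d = 0 ∧ E = 0 := by
  have key : ∀ (z : Cone) (v : Fin 4 → ℂ), z.1 0 ≠ 0 → z.1 1 ≠ 0 → z.1 2 ≠ 0 → z.1 3 ≠ 0 →
      v 1 = 0 → v 2 = 0 → (v 0 = 0 ∨ v 3 = 0) →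
      a * v 0 = 0 ∧ d * v 3 = 0 ∧ v 0 * MvPolynomial.eval z.1 E = 0 := by
    intro z v z0 z1 z2 z3 v1 v2 v03
    obtain ⟨α, β, hv⟩ := h.matAct_eq_radial z v
    rw [normalMatrix_matAct, v1, v2] at hv
    have e0 := congrFun hv 0
    have e1 := congrFun hv 1
    have e2 := congrFun hv 2
    have e3 := congrFun hv 3
    rw [radial_zero] at e0
    rw [radial_one] at e1
    rw [radial_two] at e2
    rw [radial_three] at e3
    simp only [Matrix.cons_val, mul_zero, sub_zero, add_zero] at e0 e1 e2 e3
    have hα : α = 0 := (mul_eq_zero.1 e1.symm).resolve_right z1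
    subst hα
    rw [zero_mul] at e0
    simp only [mul_zero, sub_zero] at e3
    have hβ : β = 0 := by
      rcases v03 with hv0 | hv3
      · rw [hv0, mul_zero, zero_mul] at e2
        exact (mul_eq_zero.1 e2.symm).resolve_right z2
      · rw [hv3, mul_zero] at e3
        exact (mul_eq_zero.1 e3.symm).resolve_right z3
    subst hβ
    rw [zero_mul] at e2 e3
    exact ⟨e0, e3, (mul_eq_zero.1 ((mul_assoc _ _ _).symm.trans e2)).resolve_left z1⟩
  set o : Cone := mkCone 1 1 1 1 (Or.inl one_ne_zero) (Or.inl one_ne_zero)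
  have o1 : ∀ i, o.1 i ≠ 0 := by intro i; fin_cases i <;> simp [o, mkCone]
  refine ⟨?_, ?_, ?_⟩
  · simpa using (key o (Pi.single 0 1) (o1 0) (o1 1) (o1 2) (o1 3) (by simp) (by simp)
      (Or.inr (by simp))).1
  · simpa using (key o (Pi.single 3 1) (o1 0) (o1 1) (o1 2) (o1 3) (by simp) (by simp)
      (Or.inl (by simp))).2.1
  · refine poly_eq_zero_of_dense (h := MvPolynomial.X 0 * MvPolynomial.X 1 *
      (MvPolynomial.X 2 * MvPolynomial.X 3)) ?_ fun z hz => ?_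
    · have := fun i : Fin 4 => MvPolynomial.X_ne_zero (R := ℂ) i
      exact mul_ne_zero (mul_ne_zero (this 0) (this 1)) (mul_ne_zero (this 2) (this 3))
    · simp only [map_mul, MvPolynomial.eval_X, mul_ne_zero_iff] at hz
      obtain ⟨⟨z0, z1⟩, z2, z3⟩ := hz
      simpa using (key ⟨z, Or.inl z0, Or.inl z2⟩ (Pi.single 0 1) z0 z1 z2 z3 (by simp) (by simp)
        (Or.inr (by simp))).2.2

/-- The parameters `(a, d, E)` of matrices in normal form that represent endomorphisms. -/
def normalParams (δ : ℕ) : Submodule ℂ (ℂ × ℂ × CoxPoly) where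
  carrier := {x | (δ : ℂ) * (x.1 - x.2.1) = 0 ∧
    MvPolynomial.IsWeightedHomogeneous (coxDeg δ) x.2.2 (-2, 1)}
  add_mem' := by
    rintro x y ⟨hx, hx'⟩ ⟨hy, hy'⟩
    refine ⟨?_, hx'.add hy'⟩
    show (δ : ℂ) * (x.1 + y.1 - (x.2.1 + y.2.1)) = 0
    linear_combination hx + hy
  zero_mem' := ⟨by simp, MvPolynomial.isWeightedHomogeneous_zero _ _ _⟩
  smul_mem' := by
    rintro c x ⟨hx, hx'⟩
    refine ⟨?_, ?_⟩
    · show (δ : ℂ) * (c * x.1 - c * x.2.1) = 0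
      linear_combination c * hx
    · show MvPolynomial.IsWeightedHomogeneous (coxDeg δ) (c • x.2.2) (-2, 1)
      rw [MvPolynomial.smul_eq_C_mul]
      exact hx'.C_mul c

theorem exists_represents_normalMatrix (x : normalParams δ) :
    ∃ Φ : SheafHom (tangentSheaf δ) (tangentSheaf δ),
      Represents (normalMatrix x.1.1 x.1.2.1 x.1.2.2) Φ :=
  exists_represents (fun _ _ hv => (normalMatrix_isGraded x.2.2).euler hv)
    fun z α β => ⟨_, _, normalMatrix_radial x.2.1 _ z.1 α β⟩

theorem normalMatrix_unique {x y : ℂ × ℂ × CoxPoly}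
    {Φ : SheafHom (tangentSheaf δ) (tangentSheaf δ)}
    (hx : Represents (normalMatrix x.1 x.2.1 x.2.2) Φ)
    (hy : Represents (normalMatrix y.1 y.2.1 y.2.2) Φ) : x = y := by
  have h := hx.add (hy.smul (-1))
  rw [neg_one_smul ℂ Φ, add_neg_cancel, normalMatrix_smul, normalMatrix_add] at h
  obtain ⟨h1, h2, h3⟩ := normalMatrix_eq_zero_of_represents h
  refine Prod.ext ?_ (Prod.ext ?_ ?_)
  · linear_combination h1
  · linear_combination h2
  · rw [neg_one_smul] at h3
    linear_combination h3

theorem exists_normalParams (Φ : SheafHom (tangentSheaf δ) (tangentSheaf δ)) :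
    ∃ x : normalParams δ, Represents (normalMatrix x.1.1 x.1.2.1 x.1.2.2) Φ := by
  obtain ⟨A, hA, hΦ⟩ := exists_graded_represents Φ
  obtain ⟨a, d, E, hE, had, rfl⟩ := eq_normalMatrix hA hΦ.matAct_radial
  exact ⟨⟨(a, d, E), had, hE⟩, hΦ⟩

/-- Endomorphisms of the tangent sheaf correspond to matrices in normal form. -/
noncomputable def endoEquiv (δ : ℕ) :
    normalParams δ ≃ₗ[ℂ] SheafHom (tangentSheaf δ) (tangentSheaf δ) :=
  LinearEquiv.ofBijective
    { toFun := fun x => (exists_represents_normalMatrix x).choose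
      map_add' := fun x y => by
        refine (exists_represents_normalMatrix (x + y)).choose_spec.unique ?_
        have h := (exists_represents_normalMatrix x).choose_spec.add
          (exists_represents_normalMatrix y).choose_spec
        rw [normalMatrix_add] at h
        exact h
      map_smul' := fun c x => by
        refine (exists_represents_normalMatrix (c • x)).choose_spec.unique ?_
        have h := (exists_represents_normalMatrix x).choose_spec.smul c
        rw [normalMatrix_smul] at h
        exact h }
    ⟨fun x y h => Subtype.ext (normalMatrix_unique
        (exists_represents_normalMatrix x).choose_spec
        ((show (exists_represents_normalMatrix x).choose = (exists_represents_normalMatrix y).choose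
          from h) ▸ (exists_represents_normalMatrix y).choose_spec)),
      fun Φ => by
        obtain ⟨x, hx⟩ := exists_normalParams Φ
        exact ⟨x, (exists_represents_normalMatrix x).choose_spec.unique hx⟩⟩

/-! ### The dimension -/

theorem exponents_of_fibre_form {m : Fin 4 →₀ ℕ}
    (h : Finsupp.weight (coxDeg δ) m = (-2, 1)) : m 2 = 0 ∧ m 3 = 1 ∧ m 0 + m 1 + 2 = δ := by
  rw [weight_coxDeg, Prod.mk.injEq] at h
  obtain ⟨h1, h2⟩ := h
  have h3 : m 3 = 0 ∨ m 3 = 1 := by omega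
  rcases h3 with h3 | h3
  · rw [h3] at h1; simp at h1; omega
  · rw [h3] at h1; refine ⟨by omega, h3, ?_⟩; simp at h1; omega

/-- The exponents of the monomials that occur in the parameter `E`. -/
noncomputable def exponentEquiv (δ : ℕ) :
    {m : Fin 4 →₀ ℕ | Finsupp.weight (coxDeg δ) m = (-2, 1)} ≃ Fin (δ - 1) where
  toFun m := ⟨m.1 0, by have := exponents_of_fibre_form m.2; omega⟩
  invFun i := ⟨Finsupp.equivFunOnFinite.symm ![i, δ - 2 - i, 0, 1], by
    have := i.2
    show Finsupp.weight (coxDeg δ) _ = _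
    rw [weight_coxDeg]
    simp
    omega⟩
  left_inv m := by
    obtain ⟨h2, h3, h0⟩ := exponents_of_fibre_form m.2
    refine Subtype.ext (Finsupp.ext fun k => ?_)
    fin_cases k
    · simp
    · simp; omega
    · simp [h2]
    · simp [h3]
  right_inv i := by simp

/-- The monomials form a basis. The truncated value δ - 1 = 0 is also right for δ = 0, since m₀ + m₁
+ 2 = δ then has no solution. -/
theorem finrank_fibre_forms (δ : ℕ) :
    Module.Finite ℂ (MvPolynomial.weightedHomogeneousSubmodule ℂ (coxDeg δ) (-2, 1)) ∧
    Module.finrank ℂ (MvPolynomial.weightedHomogeneousSubmodule ℂ (coxDeg δ) (-2, 1)) =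
      δ - 1 := by
  rw [MvPolynomial.weightedHomogeneousSubmodule_eq_finsupp_supported]
  have b := MvPolynomial.basisRestrictSupport ℂ
    {m : Fin 4 →₀ ℕ | Finsupp.weight (coxDeg δ) m = (-2, 1)}
  have b' := b.reindex (exponentEquiv δ)
  exact ⟨Module.Finite.of_basis b', by
    have := Module.finrank_eq_card_basis b'
    rwa [Fintype.card_fin] at this⟩

theorem finrank_endomorphisms (δ : ℕ) :
    Module.finrank ℂ (SheafHom (tangentSheaf δ) (tangentSheaf δ)) = if δ = 0 then 2 else δ := by
  rw [← (endoEquiv δ).finrank_eq]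
  obtain ⟨hfin, hrank⟩ := finrank_fibre_forms δ
  split_ifs with h
  · subst h
    have e : (normalParams 0) ≃ₗ[ℂ] (ℂ × ℂ) × MvPolynomial.weightedHomogeneousSubmodule ℂ
        (coxDeg 0) (-2, 1) :=
      { toFun := fun x => ((x.1.1, x.1.2.1), ⟨x.1.2.2, x.2.2⟩)
        invFun := fun y => ⟨(y.1.1, y.1.2, y.2.1), by simp, y.2.2⟩
        map_add' := fun _ _ => rfl
        map_smul' := fun _ _ => rfl
        left_inv := fun _ => rfl
        right_inv := fun _ => rfl }
    rw [e.finrank_eq, Module.finrank_prod, Module.finrank_prod, hrank, Module.finrank_self]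
  · have e : (normalParams δ) ≃ₗ[ℂ] ℂ × MvPolynomial.weightedHomogeneousSubmodule ℂ
        (coxDeg δ) (-2, 1) :=
      { toFun := fun x => (x.1.1, ⟨x.1.2.2, x.2.2⟩)
        invFun := fun y => ⟨(y.1, y.1, y.2.1), by simp, y.2.2⟩
        map_add' := fun _ _ => rfl
        map_smul' := fun _ _ => rfl
        left_inv := fun x => by
          have h1 : x.1.1 = x.1.2.1 := sub_eq_zero.1
            ((mul_eq_zero.1 x.2.1).resolve_left (Nat.cast_ne_zero.2 h))
          exact Subtype.ext (Prod.ext rfl (Prod.ext h1 rfl))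
        right_inv := fun _ => rfl }
    rw [e.finrank_eq, Module.finrank_prod, hrank, Module.finrank_self]
    omega

/-! ### The parameters -/

/-- The entries `(a, d, E)` of the normal form of `endoMatrix δ p`. -/
noncomputable def Params.data : (δ : ℕ) → Params δ → ℂ × ℂ × CoxPoly
  | 0, (a, d) => (a, d, 0)
  | 1, a => (a, a, 0)
  | _ + 2, (a, C) => (a, a, MvPolynomial.X 3 * MvPolynomial.rename ![0, 1] C.1)

theorem endoMatrix_eq : ∀ (δ : ℕ) (p : Params δ), endoMatrix δ p =
    normalMatrix (Params.data δ p).1 (Params.data δ p).2.1 (Params.data δ p).2.2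
  | 0, (a, d) => by
    refine Matrix.ext fun i j => ?_
    fin_cases i <;> fin_cases j <;> simp [endoMatrix, normalMatrix, Params.data]
  | 1, a => by
    refine Matrix.ext fun i j => ?_
    fin_cases i <;> fin_cases j <;> simp [endoMatrix, normalMatrix, Params.data]
  | n + 2, (a, C) => by
    refine Matrix.ext fun i j => ?_
    fin_cases i <;> fin_cases j <;> simp [endoMatrix, normalMatrix, Params.data, mul_assoc]

/-- For δ ≥ 1 the two scalars coincide, so one formula that exchanges them and negates E covers all
three cases. -/
theorem data_conjParams : ∀ (δ : ℕ) (p : Params δ), Params.data δ (conjParams δ p) =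
    ((Params.data δ p).2.1, (Params.data δ p).1, -(Params.data δ p).2.2)
  | 0, (a, d) => by simp [Params.data, conjParams]
  | 1, a => by simp [Params.data, conjParams]
  | n + 2, (a, C) => by simp [Params.data, conjParams]

theorem nonDegenerate_iff : ∀ (δ : ℕ) (p : Params δ), NonDegenerate δ p ↔
    (Params.data δ p).1 * (Params.data δ p).2.1 ≠ 0
  | 0, (a, d) => Iff.rfl
  | 1, a => (mul_self_ne_zero (a := (show ℂ from a))).symm
  | n + 2, (a, C) => by simp [Params.data, NonDegenerate]

theorem rename_injective : Function.Injective (MvPolynomial.rename ![0, 1] :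
    MvPolynomial (Fin 2) ℂ → CoxPoly) :=
  MvPolynomial.rename_injective _ (by decide)

theorem data_injective : ∀ δ : ℕ, Function.Injective (Params.data δ)
  | 0 => by
    rintro ⟨a, d⟩ ⟨a', d'⟩ h
    simp only [Params.data, Prod.mk.injEq] at h
    exact Prod.ext h.1 h.2.1
  | 1 => fun a a' h => (Prod.ext_iff.1 h).1
  | n + 2 => by
    rintro ⟨a, C⟩ ⟨a', C'⟩ h
    simp only [Params.data, Prod.mk.injEq] at h
    refine Prod.ext h.1 (Subtype.ext (rename_injective ?_))
    exact mul_left_cancel₀ (MvPolynomial.X_ne_zero _) h.2.2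

theorem data_mem : ∀ (δ : ℕ) (p : Params δ), Params.data δ p ∈ normalParams δ
  | 0, (a, d) => ⟨by simp, MvPolynomial.isWeightedHomogeneous_zero _ _ _⟩
  | 1, a => ⟨by
      show ((1 : ℕ) : ℂ) * ((show ℂ from a) - (show ℂ from a)) = 0
      rw [sub_self, mul_zero], MvPolynomial.isWeightedHomogeneous_zero _ _ _⟩
  | n + 2, (a, C) => by
    refine ⟨by simp [Params.data], ?_⟩
    have h : MvPolynomial.IsWeightedHomogeneous (coxDeg (n + 2))
        (MvPolynomial.rename ![0, 1] C.1) ((n : ℤ), 0) := by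
      intro m hm
      obtain ⟨u, rfl, hu⟩ := MvPolynomial.coeff_rename_ne_zero _ _ _ hm
      have h1 := C.2 hu
      rw [Finsupp.weight_apply, Finsupp.sum_fintype _ _ (by simp)] at h1
      simp at h1
      rw [Finsupp.weight_apply, Finsupp.sum_mapDomain_index (by simp) (by simp [add_smul]),
        Finsupp.sum_fintype _ _ (by simp), ← h1]
      ext <;> simp [coxDeg]
    have h2 := (MvPolynomial.isWeightedHomogeneous_X ℂ (coxDeg (n + 2)) 3).mul h
    rwa [show coxDeg (n + 2) 3 + ((n : ℤ), 0) = (-2, 1) by simp [coxDeg]] at h2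

theorem exists_form {n : ℕ} {E : CoxPoly}
    (hE : MvPolynomial.IsWeightedHomogeneous (coxDeg (n + 2)) E (-2, 1)) :
    ∃ C : MvPolynomial.homogeneousSubmodule (Fin 2) ℂ n,
      E = MvPolynomial.X 3 * MvPolynomial.rename ![0, 1] C.1 := by
  let μ : (Fin 4 →₀ ℕ) → Fin 2 →₀ ℕ := fun m => Finsupp.single 0 (m 0) + Finsupp.single 1 (m 1)
  refine ⟨⟨∑ m ∈ E.support, MvPolynomial.monomial (μ m) (E.coeff m), ?_⟩, ?_⟩
  · refine Submodule.sum_mem _ fun m hm => ?_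
    obtain ⟨-, -, h⟩ := exponents_of_fibre_form (hE (MvPolynomial.mem_support_iff.1 hm))
    refine MvPolynomial.isHomogeneous_monomial _ ?_
    simp only [μ, map_add, Finsupp.degree_single]
    omega
  · rw [map_sum, Finset.mul_sum]
    refine E.as_sum.trans (Finset.sum_congr rfl fun m hm => ?_)
    obtain ⟨h2, h3, -⟩ := exponents_of_fibre_form (hE (MvPolynomial.mem_support_iff.1 hm))
    have hμ : m = Finsupp.single 3 1 + Finsupp.mapDomain ![0, 1] (μ m) := by
      refine Finsupp.ext fun k => ?_
      simp only [μ, Finsupp.mapDomain_add, Finsupp.mapDomain_single]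
      fin_cases k <;> simp [h2, h3]
    rw [MvPolynomial.rename_monomial, MvPolynomial.X, MvPolynomial.monomial_mul, one_mul]
    exact congrArg (fun k => MvPolynomial.monomial k (E.coeff m)) hμ

theorem data_surjective : ∀ (δ : ℕ) (x : normalParams δ), ∃ p, Params.data δ p = x.1
  | 0, x => ⟨(x.1.1, x.1.2.1), Prod.ext rfl (Prod.ext rfl (eq_zero_of_exponents x.2.2
      fun m hm h1 h2 => by
        have := hm 0; have := hm 1; have := hm 2; have := hm 3
        push_cast at h1; omega).symm)⟩
  | 1, x => by
    have h := x.2.1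
    rw [Nat.cast_one, one_mul] at h
    refine ⟨x.1.1, Prod.ext rfl (Prod.ext (sub_eq_zero.1 h) (eq_zero_of_exponents x.2.2
      fun m hm h1 h2 => ?_).symm)⟩
    have := hm 0; have := hm 1; have := hm 2; have := hm 3
    push_cast at h1; omega
  | n + 2, x => by
    have h := x.2.1
    obtain ⟨C, hC⟩ := exists_form x.2.2
    refine ⟨(x.1.1, C), Prod.ext rfl (Prod.ext (sub_eq_zero.1
      ((mul_eq_zero.1 h).resolve_left (Nat.cast_ne_zero.2 (by omega)))) hC.symm)⟩

/-! ### Invertibility -/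

/-- If ad ≠ 0, the product rule gives the inverse (1/a, 1/d, -E/(ad)). If ad = 0, a nonzero normal
matrix killed by left multiplication with A contradicts injectivity of Φ. -/
theorem isInvertibleEndo_iff {x : normalParams δ} {Φ : SheafHom (tangentSheaf δ) (tangentSheaf δ)}
    (hΦ : Represents (normalMatrix x.1.1 x.1.2.1 x.1.2.2) Φ) :
    IsInvertibleEndo Φ ↔ x.1.1 * x.1.2.1 ≠ 0 := by
  obtain ⟨⟨a, d, E⟩, had, hE⟩ := x
  simp only at had hE hΦ ⊢
  have hsmul : ∀ c : ℂ, MvPolynomial.IsWeightedHomogeneous (coxDeg δ) (c • E) (-2, 1) := fun c =>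
    by rw [MvPolynomial.smul_eq_C_mul]; exact hE.C_mul c
  constructor
  · rintro ⟨Ψ, hΨ⟩ h0
    have cancel : ∀ y ∈ normalParams δ,
        normalMatrix a d E * normalMatrix y.1 y.2.1 y.2.2 = 0 → y = 0 := by
      intro y hy hxy
      obtain ⟨Φ', hΦ'⟩ := exists_represents_normalMatrix ⟨y, hy⟩
      have h1 := hΦ.comp hΦ'
      rw [hxy] at h1
      have h2 : compHom Φ Φ' = 0 := h1.unique represents_zero
      have h3 : Φ' = 0 := by
        refine sheafHom_ext fun U m => ?_
        have h4 : Φ.1 U (Φ'.1 U m) = 0 := by rw [← compHom_apply, h2]; rfl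
        rw [← (hΨ U (Φ'.1 U m)).1, h4]
        exact map_zero (Ψ.1 U)
      subst h3
      obtain ⟨k1, k2, k3⟩ := normalMatrix_eq_zero_of_represents hΦ'
      exact Prod.ext k1 (Prod.ext k2 k3)
    by_cases ha : a = 0
    · by_cases hd : d = 0
      · subst ha hd
        -- With a = d = 0 the matrix has square zero, so it annihilates itself; hence E = 0, and
        -- then A = 0 annihilates the identity.
        have h1 := cancel (0, 0, E) ⟨by simp, hE⟩ (by
          rw [normalMatrix_mul]; simp [normalMatrix_zero])
        have hE0 : E = 0 := congrArg (fun y : ℂ × ℂ × CoxPoly => y.2.2) h1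
        subst hE0
        have h2 := cancel (1, 1, 0) ⟨by simp, hE⟩ (by
          rw [normalMatrix_mul]; simp [normalMatrix_zero])
        exact one_ne_zero (congrArg Prod.fst h2)
      · subst ha
        have hδ : (δ : ℂ) = 0 := by simpa [hd] using had
        -- Exactly one vanishing scalar forces δ = 0, so the scalars of the annihilated matrix are
        -- free; -E/d solves 1 · E + dE' = 0.
        have h1 := cancel (1, 0, (-d⁻¹) • E) ⟨by simp [hδ], hsmul _⟩ (by
          rw [normalMatrix_mul]
          simp [smul_smul, hd, normalMatrix_zero])
        exact one_ne_zero (congrArg Prod.fst h1)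
    · have hd : d = 0 := (mul_eq_zero.1 h0).resolve_left ha
      subst hd
      have hδ : (δ : ℂ) = 0 := by simpa [ha] using had
      have h1 := cancel (0, 1, 0) ⟨by simp [hδ], MvPolynomial.isWeightedHomogeneous_zero _ _ _⟩ (by
        rw [normalMatrix_mul]; simp [normalMatrix_zero])
      exact one_ne_zero (congrArg (fun y : ℂ × ℂ × CoxPoly => y.2.1) h1)
  · intro h0
    obtain ⟨ha, hd⟩ := mul_ne_zero_iff.1 h0
    have hy : (a⁻¹, d⁻¹, (-(a⁻¹ * d⁻¹)) • E) ∈ normalParams δ := by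
      refine ⟨?_, hsmul _⟩
      show (δ : ℂ) * (a⁻¹ - d⁻¹) = 0
      rw [inv_sub_inv ha hd, ← mul_div_assoc, show (δ : ℂ) * (d - a) = 0 by
        linear_combination -had, zero_div]
    obtain ⟨Ψ, hΨ⟩ := exists_represents_normalMatrix ⟨_, hy⟩
    have h1 : normalMatrix a⁻¹ d⁻¹ ((-(a⁻¹ * d⁻¹)) • E) * normalMatrix a d E = 1 := by
      rw [normalMatrix_mul, inv_mul_cancel₀ ha, inv_mul_cancel₀ hd, smul_smul, ← add_smul,
        show a * -(a⁻¹ * d⁻¹) + d⁻¹ = 0 by field_simp; ring, zero_smul, normalMatrix_one]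
    have h2 : normalMatrix a d E * normalMatrix a⁻¹ d⁻¹ ((-(a⁻¹ * d⁻¹)) • E) = 1 := by
      rw [normalMatrix_mul, mul_inv_cancel₀ ha, mul_inv_cancel₀ hd, smul_smul, ← add_smul,
        show a⁻¹ + d * -(a⁻¹ * d⁻¹) = 0 by field_simp; ring, zero_smul, normalMatrix_one]
    have h3 := hΨ.comp hΦ
    have h4 := hΦ.comp hΨ
    simp only at h3 h4
    rw [h1] at h3
    rw [h2] at h4
    refine ⟨Ψ, fun U m => ⟨?_, ?_⟩⟩
    · rw [← compHom_apply, h3.unique represents_one]; rfl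
    · rw [← compHom_apply, h4.unique represents_one]; rfl

/-! ### Affine forms -/

theorem affineForm_eq (δ : ℕ) (X : Fin 4 → CoxPoly) : affineForm δ X =
    ![MvPolynomial.X 1 * (MvPolynomial.X 2 * X 3 - MvPolynomial.X 3 * X 2) +
        (δ : CoxPoly) * MvPolynomial.X 2 * MvPolynomial.X 3 * X 1,
      -(MvPolynomial.X 0 * (MvPolynomial.X 2 * X 3 - MvPolynomial.X 3 * X 2) +
        (δ : CoxPoly) * MvPolynomial.X 2 * MvPolynomial.X 3 * X 0),
      -(MvPolynomial.X 3 * (MvPolynomial.X 0 * X 1 - MvPolynomial.X 1 * X 0)),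
      MvPolynomial.X 2 * (MvPolynomial.X 0 * X 1 - MvPolynomial.X 1 * X 0)] := by
  funext j
  fin_cases j <;>
    simp [affineForm, Matrix.det_succ_row_zero, Fin.sum_univ_succ, Fin.succAbove] <;> ring

/-- The adjugate identity ω(v, Aw) = ω((tr - A)v, w) on the rank two quotient by the radial span,
checked coefficient by coefficient; δ(a - d) = 0 is needed only for the dX-coefficients. -/
theorem affineForm_normalMatrix {a d : ℂ} (had : (δ : ℂ) * (a - d) = 0) (E : CoxPoly)
    (X : Fin 4 → CoxPoly) : affineForm δ (Matrix.mulVec (normalMatrix a d E) X) =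
      Matrix.vecMul (affineForm δ X) (normalMatrix d a (-E)) := by
  have h : (δ : CoxPoly) * (MvPolynomial.C a - MvPolynomial.C d) = 0 := by
    rw [← map_sub, ← map_natCast (MvPolynomial.C : ℂ →+* CoxPoly), ← map_mul, had, map_zero]
  rw [affineForm_eq, affineForm_eq]
  funext j
  fin_cases j
  · simp [normalMatrix, Matrix.mulVec, Matrix.vecMul, dotProduct, Fin.sum_univ_four]
    linear_combination (MvPolynomial.X 2 * MvPolynomial.X 3 * X 1) * h
  · simp [normalMatrix, Matrix.mulVec, Matrix.vecMul, dotProduct, Fin.sum_univ_four]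
    linear_combination (-MvPolynomial.X 2 * MvPolynomial.X 3 * X 0) * h
  · simp [normalMatrix, Matrix.mulVec, Matrix.vecMul, dotProduct, Fin.sum_univ_four]
    ring
  · simp [normalMatrix, Matrix.mulVec, Matrix.vecMul, dotProduct, Fin.sum_univ_four]
    ring

/-- The radial fields are rows of the determinant, so adding their multiples to the last row changes
nothing. -/
theorem affineForm_congr {X X' : Fin 4 → CoxPoly}
    (h : ∀ z : Cone, ∃ a b, ∀ i, MvPolynomial.eval z.1 (X' i) =
      MvPolynomial.eval z.1 (X i) + radial δ a b z.1 i) : affineForm δ X' = affineForm δ X := by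
  funext j
  refine sub_eq_zero.1 (poly_eq_zero_of_cone fun z => ?_)
  obtain ⟨a, b, hab⟩ := h z
  have e0 := hab 0
  have e1 := hab 1
  have e2 := hab 2
  have e3 := hab 3
  rw [radial_zero] at e0
  rw [radial_one] at e1
  rw [radial_two] at e2
  rw [radial_three] at e3
  rw [affineForm_eq, affineForm_eq]
  fin_cases j <;> simp [e0, e1, e2, e3] <;> ring

/-! ### Representing vector fields -/

theorem IsRepresentedBy.isLift {L : OMod δ} {d : ℤ × ℤ} {e : SheafHom (twist δ (-d)) L}
    {s : SheafHom L (tangentSheaf δ)} {X : Fin 4 → CoxPoly} (h : IsRepresentedBy e s X)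
    {U : Opens (Surface δ)} (g : twistSec (-d) U) (z : Pre U) :
    IsLift (s.1 U (e.1 U g)) z (g.1 z • fun i => MvPolynomial.eval z.1.1 (X i)) :=
  isPushforward_iff.1 (h.2 U g) z

theorem Represents.isRepresentedBy {A : Matrix (Fin 4) (Fin 4) CoxPoly}
    {Φ : SheafHom (tangentSheaf δ) (tangentSheaf δ)} (hΦ : Represents A Φ) (hA : IsGraded δ A)
    {L : OMod δ} {d : ℤ × ℤ} {e : SheafHom (twist δ (-d)) L}
    {s : SheafHom L (tangentSheaf δ)} {X : Fin 4 → CoxPoly} (h : IsRepresentedBy e s X) :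
    IsRepresentedBy e (compHom Φ s) (Matrix.mulVec A X) := by
  refine ⟨hA.mulVec h.1, fun U g => isPushforward_iff.2 fun z => ?_⟩
  have h1 := hΦ.isLift (h.isLift g z)
  rw [matAct_smul, matAct_eval] at h1
  exact h1

/-- A section determines its representing field only up to radial vectors, so its 1-form is well
defined. This reduces the claim for an arbitrary representative of Φ ∘ s to the particular one AX.
-/
theorem affineForm_unique {L : OMod δ} {d : ℤ × ℤ} {e : SheafHom (twist δ (-d)) L}
    {s : SheafHom L (tangentSheaf δ)} {X X' : Fin 4 → CoxPoly} (h : IsRepresentedBy e s X)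
    (h' : IsRepresentedBy e s X') : affineForm δ X' = affineForm δ X := by
  refine affineForm_congr fun z => ?_
  obtain ⟨c, hc⟩ := exists_chart (δ := δ) z
  let y : Pre c.opens := ⟨z, hc⟩
  obtain ⟨a, b, hab⟩ := (h'.isLift ⟨_, c.gen_mem (-d)⟩ y).sub_eq_radial
    (h.isLift ⟨_, c.gen_mem (-d)⟩ y)
  have h0 := c.gen_ne_zero (-d) y
  refine ⟨a / c.gen (-d) y, b / c.gen (-d) y, fun i => mul_left_cancel₀ h0 ?_⟩
  refine (congrFun hab i).trans ?_
  simp only [Pi.add_apply, Pi.smul_apply, smul_eq_mul, radial]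
  show _ = c.gen (-d) y * (MvPolynomial.eval y.1.1 (X i) + _ * y.1.1 i)
  field_simp

end Hirzebruch

/-! ### Assembly of the theorem -/

open Hirzebruch
theorem mainTheorem2 (δ : ℕ) :
    -- the dimension
    Module.finrank ℂ (SheafHom (tangentSheaf δ) (tangentSheaf δ)) = (if δ = 0 then 2 else δ) ∧
    -- endomorphisms correspond one-to-one to the matrices
    (∀ Φ : SheafHom (tangentSheaf δ) (tangentSheaf δ),
      ∃! p : Params δ, Represents (endoMatrix δ p) Φ) ∧
    (∀ p : Params δ, ∃! Φ : SheafHom (tangentSheaf δ) (tangentSheaf δ),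
      Represents (endoMatrix δ p) Φ) ∧
    (∀ (Φ : SheafHom (tangentSheaf δ) (tangentSheaf δ)) (p : Params δ),
      Represents (endoMatrix δ p) Φ →
        -- invertibility
        (IsInvertibleEndo Φ ↔ NonDegenerate δ p) ∧
        ∀ L : OMod δ, L.IsInvertible → ∀ s : SheafHom L (tangentSheaf δ),
          ∃ s' : SheafHom L (tangentSheaf δ),
            (∀ (U : TopologicalSpace.Opens (Surface δ)) (m : L.sec U),
              s'.1 U m = Φ.1 U (s.1 U m)) ∧
            ∀ (d : ℤ × ℤ) (e : SheafHom (twist δ (-d)) L), IsSheafIso e →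
              ∀ X : Fin 4 → CoxPoly, IsRepresentedBy e s X →
                -- the action on representing vector fields
                IsRepresentedBy e s' (Matrix.mulVec (endoMatrix δ p) X) ∧
                -- the action on representing one-forms
                ∀ X' : Fin 4 → CoxPoly, IsRepresentedBy e s' X' →
                  affineForm δ X' =
                    Matrix.vecMul (affineForm δ X) (endoMatrix δ (conjParams δ p))) ∧
    -- representability
    (∀ d : ℤ × ℤ, 0 ≤ d.2 → (δ = 0 ∧ 0 ≤ d.1 ∨ 1 ≤ δ ∧ -1 ≤ d.1) →
      ∀ (L : OMod δ) (e : SheafHom (twist δ (-d)) L), IsSheafIso e →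
        ∀ s : SheafHom L (tangentSheaf δ), ∃ X : Fin 4 → CoxPoly, IsRepresentedBy e s X) := by
  refine ⟨finrank_endomorphisms δ, fun Φ => ?_, fun p => ?_, fun Φ p hΦ => ?_,
    fun d hd hd' L e _ s => ?_⟩
  · obtain ⟨x, hx⟩ := exists_normalParams Φ
    obtain ⟨p, hp⟩ := data_surjective δ x
    refine ⟨p, ?_, fun q hq => data_injective δ ?_⟩
    · simp only [endoMatrix_eq, hp]
      exact hx
    · simp only [endoMatrix_eq] at hq
      exact (normalMatrix_unique hq hx).trans hp.symm
  · obtain ⟨Φ, hΦ⟩ := exists_represents_normalMatrix ⟨_, data_mem δ p⟩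
    simp only [endoMatrix_eq]
    exact ⟨Φ, hΦ, fun Ψ hΨ => hΨ.unique hΦ⟩
  · rw [endoMatrix_eq] at hΦ
    refine ⟨?_, fun L _ s => ⟨compHom Φ s, fun _ _ => rfl, fun d e _ X hX => ?_⟩⟩
    · rw [nonDegenerate_iff]
      exact isInvertibleEndo_iff (x := ⟨_, data_mem δ p⟩) hΦ
    · have h1 := hΦ.isRepresentedBy (normalMatrix_isGraded (data_mem δ p).2) hX
      rw [endoMatrix_eq, endoMatrix_eq, data_conjParams]
      refine ⟨h1, fun X' hX' => ?_⟩
      rw [affineForm_unique h1 hX', affineForm_normalMatrix (data_mem δ p).1]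
  · have h1 : (-d).1 ≤ 1 := by
      show -d.1 ≤ 1
      omega
    have h2 : (-d).2 ≤ 1 := by
      show -d.2 ≤ 1
      omega
    obtain ⟨X, hX, hX'⟩ := exists_poly_rep (compHom s e) h1 h2
    refine ⟨X, fun i => ?_, fun U g => isPushforward_iff.2 (hX' U g)⟩
    rw [add_comm, ← neg_neg d]
    exact hX i
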